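/- Let $Y$ be a Riemann surface (for instance a smooth complex projective curve), let $G$ be a finite-dimensional complex Lie group (for instance a semisimple affine algebraic group over $\mathbb C$) with Lie algebra $\mathfrak g$, let $F\to Y$ be a holomorphic principal $G$-bundle, and let $\nabla_0$ be a holomorphic connection on $F$, viewed as a $\mathfrak g$-valued $1$-form on $F$. Let $\pi: F(G)=F\times^G G\to Y$ be the bundle of groups associated with the conjugation action of $G$ on itself, and let $\mathrm{ad}(F)=F\times^G\mathfrak g$ be its bundle of Lie algebras. Write $[f,z]$ and $[f,\xi]$ for the classes in $F(G)$ and $\mathrm{ad}(F)$ of $(f,z)\in F\times G$ and $(f,\xi)\in F\times\mathfrak g$. The connection $\nabla_0$ induces a connection on $F(G)$; its horizontal tangent vectors are the images of the $\nabla_0$-horizontal vectors of $F$ under the maps $f\mapsto[f,z]$, $z\in G$. A connection (relative to $\nabla_0$) on a holomorphic right $F(G)$-torsor $\varphi:T\to Y$ is a holomorphic homomorphism of vector bundles $\beta:TT\to\varphi^*\mathrm{ad}(F)$ on $T$ such that (1) on $\ker d\varphi$ it is the identification $\ker d\varphi\cong\varphi^*\mathrm{ad}(F)$ given by the action, and (2)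 the differential $\delta$ of the action map $T\times_Y F(G)\to T$ satisfies $\beta(\delta(v,w))=0$ for every tangent vector $(v,w)$ of $T\times_Y F(G)$ with $\beta(v)=0$ and $w$ horizontal. For a holomorphic principal $G$-bundle $E\to Y$, the twist of $E$ by $F$ is the $F(G)$-torsor $E\times^G F^{op}=(E\times_Y F)/\sim$, where $(e,f)\sim(ez,fz)$ for $z\in G$, with the action of $F(G)$ determined by $[e,f]\cdot[f,z]=[ez,f]$. Then twisting by $F$ defines an equivalence from the category of pairs $(E,D)$ of a holomorphic principal $G$-bundle on $Y$ and a holomorphic connection on it to the category of pairs $(T,\beta)$ of a holomorphic $F(G)$-torsor on $Y$ and a connection on it relative to $\nabla_0$; in both categories the morphisms are the (iso)morphisms of bundles, respectively torsors, over $Y$ that preserve the connections. More precisely, there is an equivalence of categories that sends $(E,D)$ to $(E\times^G F^{op},\beta)$, where the pullback of $\beta$ to $E\times_Y F$ is $(v,w)\mapsto[f,\,D(v)-\nabla_0(w)]$ for tangent vectors $(v,w)$ of $E\times_Y F$ at $(e,f)$, and that sends a morphism $h:(E,D)\to(E',D')$ to the map $[e,f]\mapsto[h(e),f]$. -/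

import Mathlib

open Set Topology CategoryTheory
open scoped Manifold ContDiff

set_option linter.unusedSectionVars false

universe u v w x

/-- The model of a complex manifold fibred over a Riemann surface with fibres locally modelled on
the complex vector space `EG`: the product of the models of the base and of the fibre. -/
noncomputable abbrev totalModel (EG : Type w) [NormedAddCommGroup EG] [NormedSpace ℂ EG] :
    ModelWithCorners ℂ (ℂ × EG) (ModelProd ℂ EG) :=
  𝓘(ℂ, ℂ).prod 𝓘(ℂ, EG)

/-! ### Principal bundles -/

/-- A holomorphic principal `G`-bundle on the Riemann surface `Y`: a complex manifold with a
holomorphic map to `Y` and a holomorphic right action of `G` along the fibres, which is locally on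
`Y` isomorphic to the product with `G`. -/
structure PrincipalBundle (EG : Type w) [NormedAddCommGroup EG] [NormedSpace ℂ EG]
    (G : Type v) [TopologicalSpace G] [ChartedSpace EG G] [Group G]
    (Y : Type x) [TopologicalSpace Y] [ChartedSpace ℂ Y] where
  carrier : Type u
  [top : TopologicalSpace carrier]
  [charted : ChartedSpace (ModelProd ℂ EG) carrier]
  [manifold : IsManifold (totalModel EG) ω carrier]
  proj : carrier → Y
  proj_hol : ContMDiff (totalModel EG) 𝓘(ℂ, ℂ) ω proj
  act : carrier → G → carrier
  act_hol : ContMDiff ((totalModel EG).prod 𝓘(ℂ, EG)) (totalModel EG) ω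
    (fun p : carrier × G => act p.1 p.2)
  act_one : ∀ e, act e 1 = e
  act_mul : ∀ e g h, act e (g * h) = act (act e g) h
  proj_act : ∀ e g, proj (act e g) = proj e
  locally_trivial : ∀ y : Y, ∃ t : Bundle.Trivialization G proj, y ∈ t.baseSet ∧
    ContMDiffOn (totalModel EG) (totalModel EG) ω t t.source ∧
    ContMDiffOn (totalModel EG) (totalModel EG) ω t.toOpenPartialHomeomorph.symm t.target ∧
    ∀ e ∈ t.source, ∀ g, t (act e g) = ((t e).1, (t e).2 * g)

attribute [instance] PrincipalBundle.top PrincipalBundle.charted PrincipalBundle.manifold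

section Setting

variable {EG : Type w} [NormedAddCommGroup EG] [NormedSpace ℂ EG]
  {G : Type v} [TopologicalSpace G] [ChartedSpace EG G] [Group G] [LieGroup 𝓘(ℂ, EG) ω G]
  {Y : Type x} [TopologicalSpace Y] [ChartedSpace ℂ Y]

/-- A holomorphic connection on a principal `G`-bundle, as a holomorphic `1`-form with values in
the Lie algebra `T_1 G` that reproduces the generators of the action and is equivariant for the
adjoint action: `D (v · g) = Ad (g⁻¹) (D v)`. -/
structure PrincipalConnection (E : PrincipalBundle.{u} EG G Y) where
  form : ∀ e : E.carrier, TangentSpace (totalModel EG) e →L[ℂ] GroupLieAlgebra 𝓘(ℂ, EG) G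
  form_hol : ContMDiff (totalModel EG).tangent 𝓘(ℂ, EG).tangent ω
    (fun V : TangentBundle (totalModel EG) E.carrier =>
      (⟨1, form V.1 V.2⟩ : TangentBundle 𝓘(ℂ, EG) G))
  form_vertical : ∀ (e : E.carrier) (X : GroupLieAlgebra 𝓘(ℂ, EG) G),
    form (E.act e 1) (mfderiv 𝓘(ℂ, EG) (totalModel EG) (fun g => E.act e g) 1 X) = X
  form_act : ∀ (e : E.carrier) (g : G) (v : TangentSpace (totalModel EG) e),
    (⟨1, form (E.act e g)
        (mfderiv (totalModel EG) (totalModel EG) (fun e' => E.act e' g) e v)⟩ :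
      TangentBundle 𝓘(ℂ, EG) G) =
    tangentMap 𝓘(ℂ, EG) 𝓘(ℂ, EG) (fun h : G => g⁻¹ * h * g) ⟨1, form e v⟩

namespace PrincipalBundle

variable (F : PrincipalBundle.{u} EG G Y)

/-- A holomorphic `G`-equivariant local trivialization. -/
def IsTriv (t : Bundle.Trivialization G F.proj) : Prop :=
  ContMDiffOn (totalModel EG) (totalModel EG) ω t t.source ∧
    ContMDiffOn (totalModel EG) (totalModel EG) ω t.toOpenPartialHomeomorph.symm t.target ∧
    ∀ e ∈ t.source, ∀ g, t (F.act e g) = ((t e).1, (t e).2 * g)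

theorem exists_act_eq {f f' : F.carrier} (h : F.proj f = F.proj f') : ∃ z, f' = F.act f z := by
  obtain ⟨t, hy, -, -, ht⟩ := F.locally_trivial (F.proj f)
  have hf : f ∈ t.source := t.mem_source.2 hy
  have hf' : f' ∈ t.source := t.mem_source.2 (h ▸ hy)
  refine ⟨(t f).2⁻¹ * (t f').2, ?_⟩
  have hfz : F.act f ((t f).2⁻¹ * (t f').2) ∈ t.source :=
    t.mem_source.2 (by rw [F.proj_act]; exact hy)
  apply t.injOn hf' hfz
  refine Eq.trans ?_ (ht f hf _).symm
  refine Prod.ext ?_ ?_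
  · exact (t.coe_fst hf').trans (h.symm.trans (t.coe_fst hf).symm)
  · exact (mul_inv_cancel_left _ _).symm

theorem act_injective (f : F.carrier) : Function.Injective (F.act f) := by
  intro z z' h
  obtain ⟨t, hy, -, -, ht⟩ := F.locally_trivial (F.proj f)
  have hf : f ∈ t.source := t.mem_source.2 hy
  have h2 := congrArg t h
  rw [ht f hf, ht f hf] at h2
  simpa using congrArg Prod.snd h2

theorem proj_surjective : Function.Surjective F.proj := by
  intro y
  obtain ⟨t, hy, -, -, -⟩ := F.locally_trivial y
  exact ⟨t.toOpenPartialHomeomorph.symm (y, 1), t.proj_symm_apply' hy⟩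

/-! ### The group bundle `F(G) = F ×^G G` -/

/-- The equivalence relation on `F × G` given by the action `(f, g) · z = (f z, z⁻¹ g z)`. -/
def conjSetoid : Setoid (F.carrier × G) where
  r p q := ∃ z : G, q = (F.act p.1 z, z⁻¹ * p.2 * z)
  iseqv :=
    { refl := fun p => ⟨1, by simp [F.act_one]⟩
      symm := by
        rintro p q ⟨z, rfl⟩
        exact ⟨z⁻¹, by simp [← F.act_mul, F.act_one, mul_assoc]⟩
      trans := by
        rintro p q r ⟨z, rfl⟩ ⟨z', rfl⟩
        exact ⟨z * z', by simp [← F.act_mul, mul_assoc]⟩ }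

/-- `F(G) = Ad(F) = F ×^G G`, where `G` acts on itself by conjugation. -/
def AdBundle : Type (max u v) := Quotient F.conjSetoid

namespace AdBundle

/-- The class `[f, g]` in `F(G)`. -/
def mk (f : F.carrier) (g : G) : F.AdBundle := Quotient.mk F.conjSetoid (f, g)

variable {F}

theorem mk_eq_mk {f f' : F.carrier} {g g' : G} :
    mk F f g = mk F f' g' ↔ ∃ z, f' = F.act f z ∧ g' = z⁻¹ * g * z := by
  refine Quotient.eq.trans ?_
  change (∃ z : G, (f', g') = (F.act f z, z⁻¹ * g * z)) ↔ _
  simp [Prod.ext_iff]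

theorem mk_act (f : F.carrier) (g z : G) : mk F (F.act f z) g = mk F f (z * g * z⁻¹) := by
  refine (mk_eq_mk.2 ⟨z, rfl, ?_⟩).symm
  group

theorem exists_rep (γ : F.AdBundle) : ∃ f g, mk F f g = γ := by
  obtain ⟨⟨f, g⟩, h⟩ := Quotient.exists_rep γ
  exact ⟨f, g, h⟩

variable (F) in
/-- The projection `F(G) → Y`. -/
def proj (γ : F.AdBundle) : Y :=
  Quotient.lift (fun p : F.carrier × G => F.proj p.1)
    (by rintro p q ⟨z, rfl⟩; exact (F.proj_act _ _).symm) γ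

@[simp] theorem proj_mk (f : F.carrier) (g : G) : proj F (mk F f g) = F.proj f := rfl

theorem mk_injective (f : F.carrier) : Function.Injective (mk F f) := by
  intro g g' h
  obtain ⟨z, hz, hg⟩ := mk_eq_mk.1 h
  have : z = 1 := F.act_injective f (by rw [← hz, F.act_one])
  simpa [this] using hg.symm

theorem exists_rep_of_proj_eq (γ : F.AdBundle) (f : F.carrier) (h : proj F γ = F.proj f) :
    ∃ g, mk F f g = γ := by
  obtain ⟨f', g, rfl⟩ := exists_rep γ
  obtain ⟨z, rfl⟩ := F.exists_act_eq (f := f') (f' := f) h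
  exact ⟨z⁻¹ * g * z, (mk_eq_mk.2 ⟨z, rfl, rfl⟩).symm⟩

variable (F) in
/-- The unit section of `F(G)`. -/
noncomputable def one (y : Y) : F.AdBundle := mk F (F.proj_surjective y).choose 1

theorem one_proj (f : F.carrier) : one F (F.proj f) = mk F f 1 := by
  have h := (F.proj_surjective (F.proj f)).choose_spec
  obtain ⟨z, hz⟩ := F.exists_act_eq h
  exact mk_eq_mk.2 ⟨z, hz, by simp⟩

@[simp] theorem proj_one (y : Y) : proj F (one F y) = y :=
  (F.proj_surjective y).choose_spec

open Classical in
/-- The fibrewise multiplication `[f, g] [f, g'] = [f, g g']` of `F(G)`. It is only meaningful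
(and only used) for two points of the same fibre. -/
noncomputable def mul (γ γ' : F.AdBundle) : F.AdBundle :=
  if h : ∃ (f : F.carrier) (p : G × G), γ = mk F f p.1 ∧ γ' = mk F f p.2 then
    mk F h.choose (h.choose_spec.choose.1 * h.choose_spec.choose.2)
  else γ

theorem mk_mul_mk (f : F.carrier) (g g' : G) : mul (mk F f g) (mk F f g') = mk F f (g * g') := by
  have h : ∃ (f' : F.carrier) (p : G × G), mk F f g = mk F f' p.1 ∧ mk F f g' = mk F f' p.2 :=
    ⟨f, (g, g'), rfl, rfl⟩
  rw [mul, dif_pos h]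
  obtain ⟨h1, h2⟩ := h.choose_spec.choose_spec
  obtain ⟨z, hz, hg⟩ := mk_eq_mk.1 h1
  have h3 : mk F f g' = mk F f (z * h.choose_spec.choose.2 * z⁻¹) := by
    rw [← mk_act, ← hz]; exact h2
  have h4 := mk_injective f h3
  refine (mk_eq_mk.2 ⟨z, hz, ?_⟩).symm
  have h5 : h.choose_spec.choose.2 = z⁻¹ * g' * z := by
    have := congrArg (fun a => z⁻¹ * a * z) h4
    simpa [mul_assoc] using this.symm
  calc h.choose_spec.choose.1 * h.choose_spec.choose.2 = (z⁻¹ * g * z) * (z⁻¹ * g' * z) :=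
        congrArg₂ (· * ·) hg h5
    _ = z⁻¹ * (g * g') * z := by group

instance : TopologicalSpace F.AdBundle :=
  inferInstanceAs (TopologicalSpace (Quotient F.conjSetoid))

theorem isQuotientMap_mk : IsQuotientMap (fun p : F.carrier × G => mk F p.1 p.2) :=
  isQuotientMap_quotient_mk'

theorem continuous_proj : Continuous (proj F) :=
  isQuotientMap_mk.continuous_iff.2 (F.proj_hol.continuous.comp continuous_fst)

open Classical in
/-- The map `F(G)|_U → U × G` defined by a trivialization of `F` over `U`,
extended arbitrarily outside of `U`. -/
noncomputable def trivFun (t : Bundle.Trivialization G F.proj) (ht : F.IsTriv t) (γ : F.AdBundle) :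
    Y × G :=
  Quotient.lift (fun p : F.carrier × G =>
      (F.proj p.1, if F.proj p.1 ∈ t.baseSet then (t p.1).2 * p.2 * (t p.1).2⁻¹ else 1))
    (by
      rintro p q ⟨z, rfl⟩
      simp only [F.proj_act]
      split_ifs with hp
      · rw [ht.2.2 _ (t.mem_source.2 hp)]
        simp [mul_assoc]
      · rfl) γ

open Classical in
theorem trivFun_mk (t : Bundle.Trivialization G F.proj) (ht : F.IsTriv t) {f : F.carrier}
    (hf : F.proj f ∈ t.baseSet) (g : G) :
    trivFun t ht (mk F f g) = (F.proj f, (t f).2 * g * (t f).2⁻¹) := by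
  change (F.proj f, if F.proj f ∈ t.baseSet then (t f).2 * g * (t f).2⁻¹ else 1) = _
  rw [if_pos hf]

/-- The inverse map `U × G → F(G)|_U`, `(y, g) ↦ [s y, g]`, where `s` is the section of `F` defined
by the trivialization. -/
noncomputable def trivInv (t : Bundle.Trivialization G F.proj) (p : Y × G) : F.AdBundle :=
  mk F (t.toOpenPartialHomeomorph.symm (p.1, 1)) p.2

theorem trivInv_trivFun (t : Bundle.Trivialization G F.proj) (ht : F.IsTriv t) {γ : F.AdBundle}
    (hγ : proj F γ ∈ t.baseSet) : trivInv t (trivFun t ht γ) = γ := by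
  obtain ⟨f, g, rfl⟩ := exists_rep γ
  have hf : f ∈ t.source := t.mem_source.2 hγ
  rw [trivFun_mk t ht hγ, trivInv]
  have hs : t.toOpenPartialHomeomorph.symm (F.proj f, 1) ∈ t.source :=
    t.map_target (t.mem_target.2 hγ)
  have : f = F.act (t.toOpenPartialHomeomorph.symm (F.proj f, 1)) (t f).2 := by
    apply t.injOn hf (t.mem_source.2 (by rw [F.proj_act]; exact t.mem_source.1 hs))
    refine Eq.trans ?_ (ht.2.2 _ hs _).symm
    rw [t.apply_symm_apply' (show F.proj f ∈ t.baseSet from hγ)]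
    exact Prod.ext (t.coe_fst hf) (one_mul _).symm
  refine mk_eq_mk.2 ⟨(t f).2, this, ?_⟩
  simp only; group

theorem trivFun_trivInv (t : Bundle.Trivialization G F.proj) (ht : F.IsTriv t) {p : Y × G}
    (hp : p.1 ∈ t.baseSet) : trivFun t ht (trivInv t p) = p := by
  have h1 : F.proj (t.toOpenPartialHomeomorph.symm (p.1, 1)) = p.1 := t.proj_symm_apply' hp
  rw [trivInv, trivFun_mk t ht (by rw [h1]; exact hp), h1, t.apply_symm_apply' hp]
  simp

/-- A local trivialization of `F` over `U` induces one of `F(G)` over `U`. -/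
noncomputable def triv (t : Bundle.Trivialization G F.proj)
    (ht : F.IsTriv t) : OpenPartialHomeomorph F.AdBundle (Y × G) where
  toFun := trivFun t ht
  invFun := trivInv t
  source := proj F ⁻¹' t.baseSet
  target := t.baseSet ×ˢ univ
  map_source' := by
    intro γ hγ
    obtain ⟨f, g, rfl⟩ := exists_rep γ
    rw [trivFun_mk t ht hγ]
    exact ⟨hγ, mem_univ _⟩
  map_target' := by
    rintro p ⟨hp, -⟩
    change F.proj (t.toOpenPartialHomeomorph.symm (p.1, 1)) ∈ t.baseSet
    rw [t.proj_symm_apply' hp]; exact hp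
  left_inv' := fun γ hγ => trivInv_trivFun t ht hγ
  right_inv' := fun p hp => trivFun_trivInv t ht hp.1
  open_source := t.open_baseSet.preimage continuous_proj
  open_target := t.open_baseSet.prod isOpen_univ
  continuousOn_toFun := by
    refine (isQuotientMap_mk.continuousOn_isOpen_iff
      (t.open_baseSet.preimage continuous_proj)).2 ?_
    have : IsTopologicalGroup G := topologicalGroup_of_lieGroup 𝓘(ℂ, EG) ω
    have h1 : ContinuousOn (fun p : F.carrier × G => t p.1)
        (Prod.fst ⁻¹' t.source) := t.toOpenPartialHomeomorph.continuousOn.comp continuousOn_fst (fun _ h => h)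
    have h2 : ContinuousOn (fun p : F.carrier × G =>
        (F.proj p.1, (t p.1).2 * p.2 * (t p.1).2⁻¹)) (Prod.fst ⁻¹' t.source) :=
      (F.proj_hol.continuous.comp continuous_fst).continuousOn.prodMk
        ((h1.snd.mul continuousOn_snd).mul h1.snd.inv)
    refine (h2.mono ?_).congr ?_
    · intro p hp; exact t.mem_source.2 hp
    · intro p hp; exact trivFun_mk t ht hp _
  continuousOn_invFun := by
    refine isQuotientMap_mk.continuous.comp_continuousOn (ContinuousOn.prodMk ?_ continuousOn_snd)
    refine t.toOpenPartialHomeomorph.continuousOn_symm.comp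
      (continuousOn_fst.prodMk continuousOn_const) ?_
    intro p hp
    exact t.mem_target.2 hp.1

/-- The change of trivializations of `F(G)` is holomorphic. -/
theorem contMDiffOn_triv_symm_trans (t t' : Bundle.Trivialization G F.proj)
    (ht : F.IsTriv t) (ht' : F.IsTriv t') :
    ContMDiffOn (totalModel EG) (totalModel EG) ω
      ((triv t ht).symm.trans (triv t' ht')) ((triv t ht).symm.trans (triv t' ht')).source := by
  have hsrc : ((triv t ht).symm.trans (triv t' ht')).source ⊆
      (t.baseSet ∩ t'.baseSet) ×ˢ (univ : Set G) := by
    rintro p ⟨⟨hp, -⟩, hp'⟩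
    have h2 : F.proj (t.toOpenPartialHomeomorph.symm (p.1, 1)) ∈ t'.baseSet := hp'
    rw [t.proj_symm_apply' hp] at h2
    exact ⟨⟨hp, h2⟩, mem_univ _⟩
  have hs : ContMDiffOn (totalModel EG) (totalModel EG) ω
      (fun p : Y × G => t' (t.toOpenPartialHomeomorph.symm (p.1, (1 : G))))
      ((t.baseSet ∩ t'.baseSet) ×ˢ (univ : Set G)) := by
    refine ht'.1.comp (t := t'.source) (ht.2.1.comp (t := t.target)
      (contMDiffOn_fst.prodMk contMDiffOn_const) ?_) ?_
    · intro p hp; exact t.mem_target.2 hp.1.1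
    · intro p hp
      refine t'.mem_source.2 ?_
      change F.proj (t.toOpenPartialHomeomorph.symm (p.1, 1)) ∈ t'.baseSet
      rw [t.proj_symm_apply' hp.1.1]; exact hp.1.2
  have ha : ContMDiffOn (totalModel EG) 𝓘(ℂ, EG) ω
      (fun p : Y × G => (t' (t.toOpenPartialHomeomorph.symm (p.1, (1 : G)))).2)
      ((t.baseSet ∩ t'.baseSet) ×ˢ (univ : Set G)) := contMDiff_snd.comp_contMDiffOn hs
  refine ((contMDiffOn_fst.prodMk ((ha.mul contMDiffOn_snd).mul ha.inv)).mono hsrc).congr ?_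
  intro p hp
  have hp' := hsrc hp
  have h1 := t.proj_symm_apply' (x := (1 : G)) hp'.1.1
  refine (trivFun_mk t' ht' (by rw [h1]; exact hp'.1.2) _).trans ?_
  rw [h1]
  rfl

variable (F) in
/-- A chosen trivialization of `F` near a point. -/
noncomputable def trivAt (y : Y) : Bundle.Trivialization G F.proj := (F.locally_trivial y).choose

theorem mem_trivAt (y : Y) : y ∈ (trivAt F y).baseSet := (F.locally_trivial y).choose_spec.1

theorem isTriv_trivAt (y : Y) : F.IsTriv (trivAt F y) := (F.locally_trivial y).choose_spec.2

/-- The charts of `F(G)` are the compositions of the trivializations `F(G)|_U → U × G` induced by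
trivializations of `F` with the charts of `Y × G`. -/
noncomputable instance : ChartedSpace (ModelProd ℂ EG) F.AdBundle where
  atlas := {c | ∃ (t : Bundle.Trivialization G F.proj) (ht : F.IsTriv t),
    ∃ c' ∈ atlas (ModelProd ℂ EG) (Y × G), c = (triv t ht).trans c'}
  chartAt γ := (triv (trivAt F (proj F γ)) (isTriv_trivAt _)).trans
    (chartAt (ModelProd ℂ EG) (triv (trivAt F (proj F γ)) (isTriv_trivAt _) γ))
  mem_chart_source γ := by
    exact ⟨mem_trivAt _, mem_chart_source (ModelProd ℂ EG)
      (triv (trivAt F (proj F γ)) (isTriv_trivAt _) γ)⟩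
  chart_mem_atlas γ := ⟨_, isTriv_trivAt _, _, chart_mem_atlas (ModelProd ℂ EG)
    (triv (trivAt F (proj F γ)) (isTriv_trivAt _) γ), rfl⟩

instance [IsManifold 𝓘(ℂ, ℂ) ω Y] : IsManifold (totalModel EG) ω F.AdBundle := by
  refine isManifold_of_contDiffOn _ _ _ ?_
  rintro _ _ ⟨t, ht, c, hc, rfl⟩ ⟨t', ht', c', hc', rfl⟩
  rw [← contMDiffOn_iff_contDiffOn]
  have hc1 := contMDiffOn_symm_of_mem_maximalAtlas
    (IsManifold.subset_maximalAtlas (I := totalModel EG) (n := ω) hc)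
  have hc2 := contMDiffOn_of_mem_maximalAtlas
    (IsManifold.subset_maximalAtlas (I := totalModel EG) (n := ω) hc')
  have key : ContMDiffOn (totalModel EG) (totalModel EG) ω
      (((triv t ht).trans c).symm.trans ((triv t' ht').trans c'))
      (((triv t ht).trans c).symm.trans ((triv t' ht').trans c')).source := by
    have h := hc2.comp (t := c'.source)
      (s := (((triv t ht).trans c).symm.trans ((triv t' ht').trans c')).source)
      ((contMDiffOn_triv_symm_trans t t' ht ht').comp (hc1.mono (fun p hp => hp.1.1))
        (fun p hp => ⟨hp.1.2, hp.2.1⟩)) (fun p hp => hp.2.2)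
    exact h
  exact ((totalModel EG).contMDiff).comp_contMDiffOn
    (key.comp (((totalModel EG).contMDiffOn_symm).mono inter_subset_right) (fun p hp => hp.1))

end AdBundle

variable [IsManifold 𝓘(ℂ, ℂ) ω Y]

/-- The fibre at `y` of the adjoint bundle `ad(F)`, the bundle of Lie algebras of the group bundle
`F(G)`: the vectors tangent to the fibre of `F(G)` at its unit element. The total space `ad(F)` is
a submanifold of the tangent bundle of `F(G)`. -/
noncomputable def ad (y : Y) :
    Submodule ℂ (TangentSpace (totalModel EG) (AdBundle.one F y)) :=
  LinearMap.ker (mfderiv (totalModel EG) 𝓘(ℂ, ℂ) (AdBundle.proj F) (AdBundle.one F y)).toLinearMap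

variable {F} in
/-- The class `[f, X]` in `ad(F) = F ×^G Lie(G)`, as a point of the tangent bundle of `F(G)`:
the derivative at `1` in the direction `X` of the map `G → F(G)`, `g ↦ [f, g]`. -/
noncomputable def adMk (f : F.carrier) (X : GroupLieAlgebra 𝓘(ℂ, EG) G) :
    TangentBundle (totalModel EG) F.AdBundle :=
  tangentMap 𝓘(ℂ, EG) (totalModel EG) (AdBundle.mk F f) ⟨1, X⟩

end PrincipalBundle

variable [IsManifold 𝓘(ℂ, ℂ) ω Y]

/-- The horizontal tangent vectors of `F(G)` for the connection induced by the connection `D₀` on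
`F`, i.e. the kernel of the induced connection on `F(G)`: the images of the `D₀`-horizontal vectors
of `F` under the maps `F → F(G)`, `f ↦ [f, g]`. -/
def PrincipalConnection.adHorizontal {F : PrincipalBundle.{u} EG G Y}
    (D₀ : PrincipalConnection F) : Set (TangentBundle (totalModel EG) F.AdBundle) :=
  {W | ∃ (g : G) (U : TangentBundle (totalModel EG) F.carrier), D₀.form U.1 U.2 = 0 ∧
    W = tangentMap (totalModel EG) (totalModel EG) (fun f => PrincipalBundle.AdBundle.mk F f g) U}

open PrincipalBundle

/-! ### Torsors under `F(G)` -/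

/-- A holomorphic (right) `F(G)`-torsor on `Y`. The action `act e γ` is only meaningful when `e`
and `γ` lie over the same point of `Y`, i.e. on the fibre product of `carrier` and `F(G)` over `Y`;
its holomorphy as a map on this submanifold of the product is `act_hol`. Locally on `Y`, the torsor
is isomorphic to `F(G)` acting on itself by right multiplication. -/
structure AdTorsor (F : PrincipalBundle.{u} EG G Y) where
  carrier : Type u
  [top : TopologicalSpace carrier]
  [charted : ChartedSpace (ModelProd ℂ EG) carrier]
  [manifold : IsManifold (totalModel EG) ω carrier]
  proj : carrier → Y
  proj_hol : ContMDiff (totalModel EG) 𝓘(ℂ, ℂ) ω proj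
  act : carrier → F.AdBundle → carrier
  act_hol : ContMDiffOn ((totalModel EG).prod (totalModel EG)) (totalModel EG) ω
    (fun p : carrier × F.AdBundle => act p.1 p.2) {p | proj p.1 = AdBundle.proj F p.2}
  proj_act : ∀ e γ, proj e = AdBundle.proj F γ → proj (act e γ) = proj e
  act_one : ∀ e, act e (AdBundle.one F (proj e)) = e
  act_mul : ∀ e γ γ', proj e = AdBundle.proj F γ → proj e = AdBundle.proj F γ' →
    act e (AdBundle.mul γ γ') = act (act e γ) γ'
  locally_trivial : ∀ y : Y, ∃ (U : Set Y) (t : OpenPartialHomeomorph carrier F.AdBundle),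
    IsOpen U ∧ y ∈ U ∧ t.source = proj ⁻¹' U ∧ t.target = AdBundle.proj F ⁻¹' U ∧
    ContMDiffOn (totalModel EG) (totalModel EG) ω t t.source ∧
    ContMDiffOn (totalModel EG) (totalModel EG) ω t.symm t.target ∧
    (∀ e ∈ t.source, AdBundle.proj F (t e) = proj e) ∧
    ∀ e ∈ t.source, ∀ γ, proj e = AdBundle.proj F γ → t (act e γ) = AdBundle.mul (t e) γ

attribute [instance] AdTorsor.top AdTorsor.charted AdTorsor.manifold

/-- A holomorphic connection on an `F(G)`-torsor `T`, relative to the connection `D₀` on `F`: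
a holomorphic homomorphism `β : TT → φ^* ad(F)` of vector bundles on `T`, where `φ : T → Y`.

The differential of the action, as a map on the tangent bundle of the fibre product of `T` and
`F(G)` over `Y`, is expressed through `mfderivWithin` along the fibre product; its value on a pair
`(v, w)` with `dφ v = dπ w`, i.e. on a tangent vector of the fibre product, does not depend on any
choice. Similarly `mfderivWithin` along a fibre of `F(G)` is the derivative of an orbit map. -/
structure AdTorsorConnection {F : PrincipalBundle.{u} EG G Y} (D₀ : PrincipalConnection F)
    (T : AdTorsor F) where
  form : ∀ e : T.carrier, TangentSpace (totalModel EG) e →L[ℂ] F.ad (T.proj e)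
  form_hol : ContMDiff (totalModel EG).tangent (totalModel EG).tangent ω
    (fun V : TangentBundle (totalModel EG) T.carrier =>
      (⟨AdBundle.one F (T.proj V.1), form V.1 V.2⟩ : TangentBundle (totalModel EG) F.AdBundle))
  /-- On vertical vectors `β` is inverse to the identification `φ^* ad(F) ≅ ker dφ` given by the
  action. -/
  form_vertical : ∀ (e : T.carrier) (ξ : F.ad (T.proj e)),
    (⟨AdBundle.one F (T.proj (T.act e (AdBundle.one F (T.proj e)))),
      form (T.act e (AdBundle.one F (T.proj e)))
        (mfderivWithin (totalModel EG) (totalModel EG) (fun γ => T.act e γ)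
          {γ | AdBundle.proj F γ = T.proj e} (AdBundle.one F (T.proj e)) ξ)⟩ :
      TangentBundle (totalModel EG) F.AdBundle) = ⟨AdBundle.one F (T.proj e), ξ⟩
  /-- The differential of the action maps pairs of horizontal vectors to horizontal vectors. -/
  form_act : ∀ (V : TangentBundle (totalModel EG) T.carrier)
    (W : TangentBundle (totalModel EG) F.AdBundle),
    tangentMap (totalModel EG) 𝓘(ℂ, ℂ) T.proj V =
      tangentMap (totalModel EG) 𝓘(ℂ, ℂ) (AdBundle.proj F) W →
    form V.1 V.2 = 0 → W ∈ D₀.adHorizontal →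
    form (T.act V.1 W.1)
      (mfderivWithin ((totalModel EG).prod (totalModel EG)) (totalModel EG)
        (fun p : T.carrier × F.AdBundle => T.act p.1 p.2)
        {p | T.proj p.1 = AdBundle.proj F p.2} (V.1, W.1) (V.2, W.2)) = 0

/-- The form of a connection on a torsor, as a map from the tangent bundle of the torsor to that of
`F(G)`, which contains `ad(F)`. -/
noncomputable def AdTorsorConnection.total {F : PrincipalBundle.{u} EG G Y}
    {D₀ : PrincipalConnection F} {T : AdTorsor F} (β : AdTorsorConnection D₀ T)
    (V : TangentBundle (totalModel EG) T.carrier) : TangentBundle (totalModel EG) F.AdBundle :=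
  ⟨AdBundle.one F (T.proj V.1), β.form V.1 V.2⟩

/-! ### The two categories -/

variable (EG G Y) in
/-- Principal `G`-bundles on `Y` equipped with a connection. -/
structure PrincipalBundleWithConnection where
  bundle : PrincipalBundle.{u} EG G Y
  conn : PrincipalConnection bundle

namespace PrincipalBundleWithConnection

/-- Isomorphisms of principal bundles that preserve the connections; a holomorphic `G`-equivariant
map over `Y` is automatically an isomorphism. -/
@[ext]
structure Hom (X X' : PrincipalBundleWithConnection.{u} EG G Y) where
  map : X.bundle.carrier → X'.bundle.carrier
  map_hol : ContMDiff (totalModel EG) (totalModel EG) ω map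
  proj_map : ∀ e, X'.bundle.proj (map e) = X.bundle.proj e
  map_act : ∀ e g, map (X.bundle.act e g) = X'.bundle.act (map e) g
  map_conn : ∀ e v, X'.conn.form (map e) (mfderiv (totalModel EG) (totalModel EG) map e v) =
    X.conn.form e v

noncomputable instance : Category (PrincipalBundleWithConnection.{u} EG G Y) where
  Hom := Hom
  id X :=
    { map := id
      map_hol := contMDiff_id
      proj_map := fun _ => rfl
      map_act := fun _ _ => rfl
      map_conn := fun e v => by rw [mfderiv_id]; rfl }
  comp {X X' X''} h k :=
    { map := k.map ∘ h.map
      map_hol := k.map_hol.comp h.map_hol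
      proj_map := fun e => (k.proj_map _).trans (h.proj_map e)
      map_act := fun e g => by simp only [Function.comp_apply, h.map_act, k.map_act]
      map_conn := fun e v => by
        rw [mfderiv_comp e ((k.map_hol.mdifferentiable (by simp)) _)
          ((h.map_hol.mdifferentiable (by simp)) _)]
        exact (k.map_conn _ _).trans (h.map_conn e v) }

end PrincipalBundleWithConnection

/-- `F(G)`-torsors on `Y` equipped with a connection relative to `D₀`. -/
structure AdTorsorWithConnection (F : PrincipalBundle.{u} EG G Y) (D₀ : PrincipalConnection F) where
  torsor : AdTorsor F
  conn : AdTorsorConnection D₀ torsor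

namespace AdTorsorWithConnection

variable {F : PrincipalBundle.{u} EG G Y} {D₀ : PrincipalConnection F}

/-- Isomorphisms of torsors that preserve the connections; a holomorphic `F(G)`-equivariant map
over `Y` is automatically an isomorphism. -/
@[ext]
structure Hom (T T' : AdTorsorWithConnection F D₀) where
  map : T.torsor.carrier → T'.torsor.carrier
  map_hol : ContMDiff (totalModel EG) (totalModel EG) ω map
  proj_map : ∀ e, T'.torsor.proj (map e) = T.torsor.proj e
  map_act : ∀ e γ, T.torsor.proj e = AdBundle.proj F γ →
    map (T.torsor.act e γ) = T'.torsor.act (map e) γ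
  map_conn : ∀ V, T'.conn.total (tangentMap (totalModel EG) (totalModel EG) map V) =
    T.conn.total V

noncomputable instance : Category (AdTorsorWithConnection F D₀) where
  Hom := Hom
  id T :=
    { map := id
      map_hol := contMDiff_id
      proj_map := fun _ => rfl
      map_act := fun _ _ _ => rfl
      map_conn := fun V => by rw [tangentMap_id]; rfl }
  comp {T T' T''} h k :=
    { map := k.map ∘ h.map
      map_hol := k.map_hol.comp h.map_hol
      proj_map := fun e => (k.proj_map _).trans (h.proj_map e)
      map_act := fun e γ hγ => by
        simp only [Function.comp_apply]
        rw [h.map_act e γ hγ, k.map_act _ γ ((h.proj_map e).trans hγ)]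
      map_conn := fun V => by
        rw [tangentMap_comp (k.map_hol.mdifferentiable (by simp))
          (h.map_hol.mdifferentiable (by simp))]
        exact (k.map_conn _).trans (h.map_conn V) }

end AdTorsorWithConnection

/-! ### Twisting by `F` -/

/-- The map `q`, restricted to the fibre product of `E` and `F` over `Y`, makes the `F(G)`-torsor
`T` the twist `E ×^G F^op`: as a complex manifold, `T` is the quotient of the fibre product by the
relation `(e, f) ∼ (e z, f z)`, and `F(G)` acts by `q (e, f) · [f, z] = q (e z, f)`. -/
structure IsTwist (F E : PrincipalBundle.{u} EG G Y) (T : AdTorsor F)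
    (q : E.carrier → F.carrier → T.carrier) : Prop where
  hol : ContMDiffOn ((totalModel EG).prod (totalModel EG)) (totalModel EG) ω
    (fun p : E.carrier × F.carrier => q p.1 p.2) {p | E.proj p.1 = F.proj p.2}
  proj_q : ∀ e f, E.proj e = F.proj f → T.proj (q e f) = F.proj f
  q_eq_iff : ∀ e f e' f', E.proj e = F.proj f → E.proj e' = F.proj f' →
    (q e f = q e' f' ↔ ∃ z : G, e' = E.act e z ∧ f' = F.act f z)
  /-- `q` has local holomorphic sections, hence is a surjective submersion. -/
  exists_section : ∀ τ : T.carrier, ∃ (U : Set T.carrier) (s : T.carrier → E.carrier × F.carrier),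
    IsOpen U ∧ τ ∈ U ∧
    ContMDiffOn (totalModel EG) ((totalModel EG).prod (totalModel EG)) ω s U ∧
    ∀ τ' ∈ U, E.proj (s τ').1 = F.proj (s τ').2 ∧ q (s τ').1 (s τ').2 = τ'
  q_act : ∀ e f (z : G), E.proj e = F.proj f →
    T.act (q e f) (AdBundle.mk F f z) = q (E.act e z) f

/-- The connection `β` on `T = E ×^G F^op` is the one induced by `D` on `E` and `D₀` on `F`: on the
fibre product of `E` and `F` its pullback along `q` is `(v, w) ↦ [f, D v - D₀ w]` for tangent
vectors `v` at `e` and `w` at `f` with the same image in the tangent bundle of `Y`. -/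
def IsTwistConnection {F E : PrincipalBundle.{u} EG G Y} (D₀ : PrincipalConnection F)
    (D : PrincipalConnection E) {T : AdTorsor F} (q : E.carrier → F.carrier → T.carrier)
    (β : AdTorsorConnection D₀ T) : Prop :=
  ∀ (V : TangentBundle (totalModel EG) E.carrier) (W : TangentBundle (totalModel EG) F.carrier),
    tangentMap (totalModel EG) 𝓘(ℂ, ℂ) E.proj V = tangentMap (totalModel EG) 𝓘(ℂ, ℂ) F.proj W →
    β.total ⟨q V.1 W.1,
      mfderivWithin ((totalModel EG).prod (totalModel EG)) (totalModel EG)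
        (fun p : E.carrier × F.carrier => q p.1 p.2)
        {p | E.proj p.1 = F.proj p.2} (V.1, W.1) (V.2, W.2)⟩ =
    adMk W.1 (D.form V.1 V.2 - D₀.form W.1 W.2)

end Setting

/-! ### Velocities of curves -/

/-! Twisting a connection. When a pair `(e, f)` in the fibre product of `E` and `F` is moved to `(e
z, f z)` along a curve `z` in `G`, both connections obey the same law `D (e z)' = Ad(z⁻¹) (D e') +
z⁻¹ z'`. The term `z⁻¹ z'` cancels in `D - D₀`, and the remaining `Ad(z⁻¹)` is absorbed by `[f z, X]
= [f, Ad(z) X]`. Hence `[f, D v - D₀ w]` depends only on the image of `(v, w)` in the twist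
(`IsTwist.adMk_eval_sub_eval_eq`), and it defines the connection there (`IsTwist.twistConnection`).

Untwisting a connection. The two axioms for `β` determine its value on every product curve `τ · [f,
g]`: if `β τ' = [f, X]`, the value is `[f, Ad(g⁻¹) (X + D₀ f') + g⁻¹ g' - D₀ f']`
(`AdTorsorConnection.total_velocity_act_mk`). So `X + D₀ f'` transforms like a principal connection.
Solving `[f, D v - D₀ w] = β (dq (v, w))` for `D v` therefore gives the same answer for every lift
`f` (`IsTwist.adMk_untwistEval`), and the solution is a connection on `E`
(`IsTwist.untwistConnection`).

Bundles and morphisms. The twist is the quotient of the fibre product by the diagonal action, with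
local coordinate `t(e) t'(f)⁻¹`. Conversely `E` is recovered from `T` as the quotient of `T ×_Y F`
by `(τ, f) ∼ (τ · [f, z⁻¹], f z)`. Both quotients become manifolds by gluing
(`exists_manifold_of_trivializations`). For fixed `f` the map `q(·, f)` is a bijection between
fibres of `E` and `T`, so the relation `k (q(e, f)) = q'(h e, f)` lets `h` and `k` determine each
other. This gives full faithfulness, and untwisting gives essential surjectivity.

Method. Every tangent vector is the velocity at `0` of a complex curve, and a tangent vector of a
fibre product is the velocity of a pair of curves inside it (`exists_diffCurve_pair`). All
identities are thus verified on curves by the chain rule and the product rule. -/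

section Curves

variable {E : Type*} [NormedAddCommGroup E] [NormedSpace ℂ E] {H : Type*} [TopologicalSpace H]
  {I : ModelWithCorners ℂ E H} {M : Type*} [TopologicalSpace M] [ChartedSpace H M]
  {E' : Type*} [NormedAddCommGroup E'] [NormedSpace ℂ E'] {H' : Type*} [TopologicalSpace H']
  {I' : ModelWithCorners ℂ E' H'} {M' : Type*} [TopologicalSpace M'] [ChartedSpace H' M']
  {E'' : Type*} [NormedAddCommGroup E''] [NormedSpace ℂ E''] {H'' : Type*} [TopologicalSpace H'']
  {I'' : ModelWithCorners ℂ E'' H''} {M'' : Type*} [TopologicalSpace M''] [ChartedSpace H'' M'']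

/-- A curve in a complex manifold that is differentiable at `0`. -/
def DiffCurve (I : ModelWithCorners ℂ E H) (c : ℂ → M) : Prop := MDifferentiableAt 𝓘(ℂ, ℂ) I c 0

/-- The velocity at `0` of a curve. -/
noncomputable def velocity (I : ModelWithCorners ℂ E H) (c : ℂ → M) : TangentBundle I M :=
  tangentMap 𝓘(ℂ, ℂ) I c ⟨0, (1 : ℂ)⟩

/-- The vector component of a tangent vector, in the model space. -/
def TangentBundle.vec (V : TangentBundle I M) : E := V.2

/-- `vec` forgets the base point, so tangent vectors whose base points agree only propositionally
can be compared and added in the model space. -/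
theorem TangentBundle.ext_vec {V W : TangentBundle I M} (h : V.1 = W.1)
    (h' : V.vec = W.vec) : V = W := by
  obtain ⟨a, v⟩ := V
  obtain ⟨b, w⟩ := W
  obtain rfl : a = b := h
  obtain rfl : v = w := h'
  rfl

variable (I I') in
/-- The derivative at a point, as a linear map between the model spaces. -/
noncomputable def vderiv (f : M → M') (a : M) : E →L[ℂ] E' := mfderiv I I' f a

theorem tangentMap_vec (f : M → M') (V : TangentBundle I M) :
    (tangentMap I I' f V).vec = vderiv I I' f V.1 V.vec := rfl

@[simp] theorem velocity_fst (c : ℂ → M) : (velocity I c).1 = c 0 := rfl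

theorem velocity_congr {c c' : ℂ → M} (h : c =ᶠ[𝓝 0] c') : velocity I c = velocity I c' := by
  refine TangentBundle.ext_vec h.eq_of_nhds ?_
  change mfderiv 𝓘(ℂ, ℂ) I c 0 (1 : ℂ) = mfderiv 𝓘(ℂ, ℂ) I c' 0 (1 : ℂ)
  rw [h.mfderiv_eq]; rfl

theorem DiffCurve.congr {c c' : ℂ → M} (hc : DiffCurve I c) (h : c' =ᶠ[𝓝 0] c) :
    DiffCurve I c' :=
  MDifferentiableAt.congr_of_eventuallyEq hc h

theorem DiffCurve.continuousAt {c : ℂ → M} (hc : DiffCurve I c) : ContinuousAt c 0 :=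
  MDifferentiableAt.continuousAt hc

theorem DiffCurve.eventually {c : ℂ → M} (hc : DiffCurve I c) {N : Set M} (h : N ∈ 𝓝 (c 0)) :
    ∀ᶠ s in 𝓝 0, c s ∈ N := hc.continuousAt h

theorem DiffCurve.const (a : M) : DiffCurve I (fun _ => a) := mdifferentiableAt_const

theorem velocity_const (a : M) : velocity I (fun _ => a) = ⟨a, (0 : E)⟩ := by
  refine TangentBundle.ext_vec rfl ?_
  change mfderiv 𝓘(ℂ, ℂ) I (fun _ => a) 0 (1 : ℂ) = 0
  rw [mfderiv_const]; rfl

theorem DiffCurve.comp {f : M → M'} {c : ℂ → M} (hc : DiffCurve I c)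
    (hf : MDifferentiableAt I I' f (c 0)) : DiffCurve I' (fun s => f (c s)) :=
  MDifferentiableAt.comp (0 : ℂ) hf hc

theorem DiffCurve.comp_within {f : M → M'} {c : ℂ → M} {S : Set M} (hc : DiffCurve I c)
    (hf : MDifferentiableWithinAt I I' f S (c 0)) (hS : ∀ᶠ s in 𝓝 0, c s ∈ S) :
    DiffCurve I' (fun s => f (c s)) := by
  have h1 : MDifferentiableWithinAt 𝓘(ℂ, ℂ) I' (f ∘ c) (c ⁻¹' S) 0 :=
    MDifferentiableWithinAt.comp (0 : ℂ) hf (MDifferentiableAt.mdifferentiableWithinAt hc)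
      (fun s hs => hs)
  exact h1.mdifferentiableAt hS

theorem velocity_comp {f : M → M'} {c : ℂ → M} (hc : DiffCurve I c)
    (hf : MDifferentiableAt I I' f (c 0)) :
    velocity I' (fun s => f (c s)) = tangentMap I I' f (velocity I c) :=
  tangentMap_comp_at (⟨0, (1 : ℂ)⟩ : TangentBundle 𝓘(ℂ, ℂ) ℂ) hf hc

/-- A derivative along `S` need not be unique, but its value on the velocity of a curve in `S` is
forced: the composite is differentiable at `0` in the ordinary sense. This is what gives
`mfderivWithin` along a fibre product a definite meaning. -/
theorem velocity_comp_within {f : M → M'} {c : ℂ → M} {S : Set M} (hc : DiffCurve I c)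
    (hf : MDifferentiableWithinAt I I' f S (c 0)) (hS : ∀ᶠ s in 𝓝 0, c s ∈ S) :
    velocity I' (fun s => f (c s)) =
      ⟨f (c 0), mfderivWithin I I' f S (c 0) (velocity I c).2⟩ := by
  refine TangentBundle.ext_vec rfl ?_
  have h1 := HasMFDerivWithinAt.comp (0 : ℂ) hf.hasMFDerivWithinAt
    (HasMFDerivAt.hasMFDerivWithinAt (s := c ⁻¹' S) (MDifferentiableAt.hasMFDerivAt hc))
    (fun s hs => hs)
  have h2 := (h1.hasMFDerivAt hS).mfderiv
  change mfderiv 𝓘(ℂ, ℂ) I' (f ∘ c) 0 (1 : ℂ) = _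
  rw [h2]; rfl

theorem velocity_comp_within' {f : M → M'} {c : ℂ → M} {S : Set M} (hc : DiffCurve I c)
    (hf : MDifferentiableWithinAt I I' f S (c 0)) (hS : ∀ᶠ s in 𝓝 0, c s ∈ S)
    {V : TangentBundle I M} (hV : velocity I c = V) :
    velocity I' (fun s => f (c s)) = ⟨f V.1, mfderivWithin I I' f S V.1 V.2⟩ := by
  subst hV
  exact velocity_comp_within hc hf hS

theorem DiffCurve.prodMk {c : ℂ → M} {c' : ℂ → M'} (hc : DiffCurve I c) (hc' : DiffCurve I' c') :
    DiffCurve (I.prod I') (fun s => (c s, c' s)) :=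
  MDifferentiableAt.prodMk hc hc'

theorem velocity_prodMk {c : ℂ → M} {c' : ℂ → M'} (hc : DiffCurve I c) (hc' : DiffCurve I' c') :
    (velocity (I.prod I') (fun s => (c s, c' s))).vec = ((velocity I c).vec, (velocity I' c').vec) := by
  have := (HasMFDerivAt.prodMk (MDifferentiableAt.hasMFDerivAt hc)
    (MDifferentiableAt.hasMFDerivAt hc')).mfderiv
  change mfderiv 𝓘(ℂ, ℂ) (I.prod I') (fun s => (c s, c' s)) 0 (1 : ℂ) = _
  rw [this]; rfl

/-- The product rule along the diagonal. -/
theorem velocity_diag {m : ℂ × ℂ → M}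
    (hm : MDifferentiableAt (𝓘(ℂ, ℂ).prod 𝓘(ℂ, ℂ)) I m (0, 0)) :
    (velocity I (fun s => m (s, s))).vec =
      (velocity I (fun s => m (s, 0))).vec + (velocity I (fun s => m (0, s))).vec := by
  have h0 : DiffCurve 𝓘(ℂ, ℂ) (fun s : ℂ => s) := mdifferentiableAt_id
  have hc : DiffCurve 𝓘(ℂ, ℂ) (fun _ : ℂ => (0 : ℂ)) := DiffCurve.const _
  rw [velocity_comp (h0.prodMk h0) hm, velocity_comp (h0.prodMk hc) hm,
    velocity_comp (hc.prodMk h0) hm]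
  rw [tangentMap_vec, tangentMap_vec, tangentMap_vec, velocity_prodMk h0 h0, velocity_prodMk h0 hc,
    velocity_prodMk hc h0, velocity_const]
  -- The three curves in the plane have velocities `(1, 1)`, `(1, 0)` and `(0, 1)`, and the
  -- derivative of `m` is additive.
  refine Eq.trans ?_ (map_add (vderiv (𝓘(ℂ, ℂ).prod 𝓘(ℂ, ℂ)) I m (0, 0)) _ _)
  congr 1
  refine Prod.ext ?_ ?_
  · exact (add_zero _).symm
  · exact (zero_add _).symm

/-- The product rule for a function of two variables. -/
theorem velocity_comp₂ {f : M × M' → M''} {c : ℂ → M} {c' : ℂ → M'}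
    (hc : DiffCurve I c) (hc' : DiffCurve I' c')
    (hf : MDifferentiableAt (I.prod I') I'' f (c 0, c' 0)) :
    (velocity I'' (fun s => f (c s, c' s))).vec =
      (velocity I'' (fun s => f (c s, c' 0))).vec + (velocity I'' (fun s => f (c 0, c' s))).vec :=
  velocity_diag (m := fun p => f (c p.1, c' p.2))
    (MDifferentiableAt.comp (I' := I.prod I') ((0 : ℂ), (0 : ℂ)) hf
      (MDifferentiableAt.prodMap hc hc'))

/-- The product rule for a function of two variables along a subset. -/
theorem velocity_comp₂_within {f : M × M' → M''} {S : Set (M × M')} {a : ℂ × ℂ → M}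
    {b : ℂ × ℂ → M'}
    (ha : MDifferentiableAt (𝓘(ℂ, ℂ).prod 𝓘(ℂ, ℂ)) I a (0, 0))
    (hb : MDifferentiableAt (𝓘(ℂ, ℂ).prod 𝓘(ℂ, ℂ)) I' b (0, 0))
    (hf : MDifferentiableWithinAt (I.prod I') I'' f S (a (0, 0), b (0, 0)))
    (hS : ∀ p, (a p, b p) ∈ S) :
    (velocity I'' (fun s => f (a (s, s), b (s, s)))).vec =
      (velocity I'' (fun s => f (a (s, 0), b (s, 0)))).vec +
      (velocity I'' (fun s => f (a (0, s), b (0, s)))).vec := by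
  refine velocity_diag (m := fun p => f (a p, b p)) ?_
  have := MDifferentiableWithinAt.comp (I' := I.prod I') (s := univ) ((0 : ℂ), (0 : ℂ)) hf
    (MDifferentiableAt.prodMk ha hb).mdifferentiableWithinAt (fun s _ => hS s)
  exact this.mdifferentiableAt Filter.univ_mem

/-- The curve is a straight line in the preferred chart at the base point; there the derivative of
the inverse chart is the identity. -/
theorem exists_diffCurve [I.Boundaryless] [IsManifold I 1 M] (V : TangentBundle I M) :
    ∃ c : ℂ → M, DiffCurve I c ∧ velocity I c = V := by
  obtain ⟨a, (v : E)⟩ := V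
  let l : ℂ → E := fun s => extChartAt I a a + s • v
  have hl : HasMFDerivAt 𝓘(ℂ, ℂ) 𝓘(ℂ, E) l 0 (ContinuousLinearMap.toSpanSingleton ℂ v) := by
    refine HasFDerivAt.hasMFDerivAt ?_
    have := ((ContinuousLinearMap.toSpanSingleton ℂ v).hasFDerivAt (x := (0 : ℂ))).const_add
      (extChartAt I a a)
    exact this
  have hl0 : l 0 = extChartAt I a a := by simp [l]
  have hs : MDifferentiableAt 𝓘(ℂ, E) I (extChartAt I a).symm (l 0) := by
    rw [hl0]
    have := mdifferentiableWithinAt_extChartAt_symm (I := I) (mem_extChartAt_target (I := I) a)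
    rw [I.range_eq_univ] at this
    exact this.mdifferentiableAt Filter.univ_mem
  have hc : DiffCurve I (fun s => (extChartAt I a).symm (l s)) :=
    MDifferentiableAt.comp (0 : ℂ) hs hl.mdifferentiableAt
  refine ⟨_, hc, ?_⟩
  have h0 : (extChartAt I a).symm (l 0) = a := by rw [hl0]; exact extChartAt_to_inv a
  refine TangentBundle.ext_vec h0 ?_
  have hv : velocity 𝓘(ℂ, E) l = ⟨extChartAt I a a, v⟩ := by
    refine TangentBundle.ext_vec hl0 ?_
    change mfderiv 𝓘(ℂ, ℂ) 𝓘(ℂ, E) l 0 (1 : ℂ) = v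
    rw [hl.mfderiv]
    exact one_smul _ _
  rw [velocity_comp (I := 𝓘(ℂ, E)) hl.mdifferentiableAt hs, hv, tangentMap_vec]
  change mfderiv 𝓘(ℂ, E) I (extChartAt I a).symm (extChartAt I a a) v = v
  have := mfderivWithin_range_extChartAt_symm (I := I) (x := a)
  rw [I.range_eq_univ, mfderivWithin_univ] at this
  rw [this]; rfl

end Curves

/-! ### Pairs of curves over the same curve in the base -/

section FibrePairs

variable {E : Type*} [NormedAddCommGroup E] [NormedSpace ℂ E] {H : Type*} [TopologicalSpace H]
  {I : ModelWithCorners ℂ E H} {M : Type*} [TopologicalSpace M] [ChartedSpace H M]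
  {EG : Type w} [NormedAddCommGroup EG] [NormedSpace ℂ EG]
  {M' : Type*} [TopologicalSpace M'] [ChartedSpace (ModelProd ℂ EG) M']
  {G : Type v} [TopologicalSpace G] [ChartedSpace EG G]
  {Y : Type x} [TopologicalSpace Y] [ChartedSpace ℂ Y]

variable (EG G) in
/-- A map to `Y` is locally trivial with fibre `G`, holomorphically. -/
def LocallyTrivialOver (π : M' → Y) : Prop :=
  ∀ y : Y, ∃ (U : Set Y) (φ : OpenPartialHomeomorph M' (Y × G)), IsOpen U ∧ y ∈ U ∧
    φ.source = π ⁻¹' U ∧ φ.target = U ×ˢ univ ∧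
    ContMDiffOn (totalModel EG) (totalModel EG) ω φ φ.source ∧
    ContMDiffOn (totalModel EG) (totalModel EG) ω φ.symm φ.target ∧
    ∀ x ∈ φ.source, (φ x).1 = π x

/-- A curve can be made to satisfy globally what it satisfies near `0`. -/
theorem exists_reparam {P : ℂ → Prop} (h : ∀ᶠ s in 𝓝 0, P s) :
    ∃ κ : ℂ → ℂ, κ =ᶠ[𝓝 0] id ∧ ∀ s, P (κ s) := by
  classical
  -- Only the germ at `0` matters, so `κ` may be discontinuous elsewhere.
  refine ⟨fun s => if P s then s else 0, ?_, ?_⟩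
  · filter_upwards [h] with s hs
    simp [hs]
  · intro s
    by_cases hs : P s
    · simp [hs]
    · simpa [hs] using h.self_of_nhds

/-- Curves with the given velocities need not lie over the same curve in `Y`. In a trivialization of
`π'` the base component of `c'` is replaced by `π ∘ c`; this keeps the velocity, because `V` and `W`
have the same image in the tangent bundle of `Y`. -/
theorem exists_diffCurve_pair [I.Boundaryless] [IsManifold I 1 M]
    [IsManifold (totalModel EG) 1 M'] {π : M → Y} {π' : M' → Y}
    (hπ : MDifferentiable I 𝓘(ℂ, ℂ) π) (hπ' : MDifferentiable (totalModel EG) 𝓘(ℂ, ℂ) π')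
    (ht : LocallyTrivialOver EG G π') (V : TangentBundle I M) (W : TangentBundle (totalModel EG) M')
    (h : tangentMap I 𝓘(ℂ, ℂ) π V = tangentMap (totalModel EG) 𝓘(ℂ, ℂ) π' W) :
    ∃ (c : ℂ → M) (c' : ℂ → M'), DiffCurve I c ∧ DiffCurve (totalModel EG) c' ∧
      velocity I c = V ∧ velocity (totalModel EG) c' = W ∧ ∀ s, π (c s) = π' (c' s) := by
  obtain ⟨c, hc, rfl⟩ := exists_diffCurve V
  obtain ⟨c', hc', rfl⟩ := exists_diffCurve W
  obtain ⟨U, φ, hU, hyU, hs, htgt, hφ, hφ', hfst⟩ := ht (π' (c' 0))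
  have h0 : π (c 0) = π' (c' 0) := congrArg Bundle.TotalSpace.proj h
  rw [← velocity_comp hc (hπ _), ← velocity_comp hc' (hπ' _)] at h
  have hb : c' 0 ∈ φ.source := by rw [hs]; exact hyU
  have hdφ : MDifferentiableAt (totalModel EG) (totalModel EG) φ (c' 0) :=
    (hφ.contMDiffAt (φ.open_source.mem_nhds hb)).mdifferentiableAt (by simp)
  have hdφ' : MDifferentiableAt (totalModel EG) (totalModel EG) φ.symm (φ (c' 0)) :=
    (hφ'.contMDiffAt (φ.open_target.mem_nhds (φ.map_source hb))).mdifferentiableAt (by simp)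
  have h1 : DiffCurve (totalModel EG) (fun s => φ (c' s)) := hc'.comp hdφ
  have h2 : DiffCurve 𝓘(ℂ, EG) (fun s => (φ (c' s)).2) :=
    DiffCurve.comp (I' := 𝓘(ℂ, EG)) h1 mdifferentiableAt_snd
  have hev : ∀ᶠ s in 𝓝 0, c' s ∈ φ.source := hc'.eventually (φ.open_source.mem_nhds hb)
  have hevc : ∀ᶠ s in 𝓝 0, c s ∈ π ⁻¹' U := hc.eventually
    ((hπ _).continuousAt.preimage_mem_nhds (hU.mem_nhds (by rw [h0]; exact hyU)))
  let d : ℂ → Y × G := fun s => (π (c s), (φ (c' s)).2)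
  have hd : DiffCurve (totalModel EG) d := (hc.comp (hπ _)).prodMk h2
  have hd0 : d 0 = φ (c' 0) := Prod.ext (by rw [hfst _ hb]; exact h0) rfl
  have hvel : velocity (totalModel EG) d = velocity (totalModel EG) (fun s => φ (c' s)) := by
    refine TangentBundle.ext_vec hd0 ?_
    rw [velocity_prodMk (hc.comp (hπ _)) h2, h,
      velocity_congr (c := fun s => φ (c' s)) (c' := fun s => (π' (c' s), (φ (c' s)).2)) ?_,
      velocity_prodMk (hc'.comp (hπ' _)) h2]
    filter_upwards [hev] with s hs
    exact Prod.ext (hfst _ hs) rfl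
  -- The base curve stays in `U` only near `0`; `κ` sends the other parameters back to `0`.
  obtain ⟨κ, hκ, hκP⟩ := exists_reparam hevc
  have hκ0 : κ 0 = 0 := hκ.eq_of_nhds
  have e1 : (fun s => c (κ s)) =ᶠ[𝓝 0] c := by
    filter_upwards [hκ] with s hs; rw [hs]; rfl
  have e2 : (fun s => φ.symm (d (κ s))) =ᶠ[𝓝 0] (fun s => φ.symm (d s)) := by
    filter_upwards [hκ] with s hs; rw [hs]; rfl
  have hsymm : DiffCurve (totalModel EG) (fun s => φ.symm (d s)) :=
    hd.comp (by rw [hd0]; exact hdφ')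
  refine ⟨fun s => c (κ s), fun s => φ.symm (d (κ s)), hc.congr e1, hsymm.congr e2,
    velocity_congr e1, ?_, fun s => ?_⟩
  · rw [velocity_congr e2, velocity_comp hd (by rw [hd0]; exact hdφ'), hvel,
      ← velocity_comp h1 hdφ']
    refine velocity_congr ?_
    filter_upwards [hev] with s hs
    exact φ.left_inv hs
  · have hm : d (κ s) ∈ φ.target := by rw [htgt]; exact ⟨hκP s, mem_univ _⟩
    rw [← hfst _ (φ.map_target hm), φ.right_inv hm]

end FibrePairs

/-! ### Curves in the group -/

section GroupCurves

variable {EG : Type w} [NormedAddCommGroup EG] [NormedSpace ℂ EG]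
  {G : Type v} [TopologicalSpace G] [ChartedSpace EG G] [Group G] [LieGroup 𝓘(ℂ, EG) ω G]

theorem DiffCurve.mul {a b : ℂ → G} (ha : DiffCurve 𝓘(ℂ, EG) a) (hb : DiffCurve 𝓘(ℂ, EG) b) :
    DiffCurve 𝓘(ℂ, EG) (fun s => a s * b s) :=
  (ha.prodMk hb).comp ((contMDiff_mul 𝓘(ℂ, EG) ω).mdifferentiable (by simp) _)

theorem DiffCurve.inv {a : ℂ → G} (ha : DiffCurve 𝓘(ℂ, EG) a) :
    DiffCurve 𝓘(ℂ, EG) (fun s => (a s)⁻¹) :=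
  ha.comp ((contMDiff_inv 𝓘(ℂ, EG) ω).mdifferentiable (by simp) _)

variable (EG) in
/-- The left logarithmic derivative at `0` of a curve in the group. -/
noncomputable def logDer (a : ℂ → G) : EG :=
  (velocity 𝓘(ℂ, EG) (fun s => (a 0)⁻¹ * a s)).vec

variable (EG) in
/-- The adjoint action of the group on its Lie algebra. -/
noncomputable def adjointAction (g : G) : EG →L[ℂ] EG :=
  vderiv 𝓘(ℂ, EG) 𝓘(ℂ, EG) (fun h : G => g * h * g⁻¹) 1

theorem contMDiff_conj (g : G) :
    ContMDiff 𝓘(ℂ, EG) 𝓘(ℂ, EG) ω (fun h : G => g * h * g⁻¹) :=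
  (contMDiff_const.mul contMDiff_id).mul contMDiff_const

theorem logDer_conj {a : ℂ → G} (ha : DiffCurve 𝓘(ℂ, EG) a) (g : G) :
    logDer EG (fun s => g * a s * g⁻¹) = adjointAction EG g (logDer EG a) := by
  have h1 : DiffCurve 𝓘(ℂ, EG) (fun s => (a 0)⁻¹ * a s) := (DiffCurve.const _).mul ha
  have h2 := velocity_comp h1 ((contMDiff_conj (EG := EG) g).mdifferentiable (by simp) _)
  have h3 := congrArg TangentBundle.vec h2
  rw [tangentMap_vec] at h3
  rw [logDer, adjointAction, logDer]
  convert h3 using 2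
  · congr 1; funext s; group
  · simp

/-- Translated to start at `1`, the product curve factors as `b(0)⁻¹ (a(0)⁻¹ a(s)) b(0)` times
`b(0)⁻¹ b(s)`. Both factors pass through `1`, so their velocities add. -/
theorem logDer_mul {a b : ℂ → G} (ha : DiffCurve 𝓘(ℂ, EG) a) (hb : DiffCurve 𝓘(ℂ, EG) b) :
    logDer EG (fun s => a s * b s) =
      adjointAction EG (b 0)⁻¹ (logDer EG a) + logDer EG b := by
  have h1 : DiffCurve 𝓘(ℂ, EG) (fun s => (b 0)⁻¹ * ((a 0)⁻¹ * a s) * (b 0)) :=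
    ((DiffCurve.const _).mul ((DiffCurve.const _).mul ha)).mul (DiffCurve.const _)
  have h2 : DiffCurve 𝓘(ℂ, EG) (fun s => (b 0)⁻¹ * b s) := (DiffCurve.const _).mul hb
  have h3 := velocity_comp₂ (f := fun p : G × G => p.1 * p.2) h1 h2
    ((contMDiff_mul 𝓘(ℂ, EG) ω).mdifferentiable (by simp) _)
  rw [← logDer_conj ha, logDer, logDer, logDer]
  convert h3 using 4
  all_goals first | (funext s; simp only; group) | (simp only; group)

theorem logDer_const (g : G) : logDer EG (fun _ : ℂ => g) = 0 := by
  rw [logDer, velocity_const]; rfl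

@[simp] theorem adjointAction_one (X : EG) : adjointAction EG (1 : G) X = X := by
  have h : (fun h : G => 1 * h * 1⁻¹) = id := by funext h; simp
  rw [adjointAction, h]
  exact congrArg (fun L : EG →L[ℂ] EG => L X) (mfderiv_id (I := 𝓘(ℂ, EG)) (x := (1 : G)))

-- Lie algebra elements are represented by curves through `1`, so that identities for `Ad` follow
-- from identities in the group.
variable (EG) in
theorem exists_logDer_eq (X : EG) :
    ∃ a : ℂ → G, DiffCurve 𝓘(ℂ, EG) a ∧ a 0 = 1 ∧ velocity 𝓘(ℂ, EG) a = ⟨1, X⟩ ∧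
      logDer EG a = X := by
  have : IsManifold 𝓘(ℂ, EG) ω G := ContMDiffMul.toIsManifold
  have : IsManifold 𝓘(ℂ, EG) 1 G := IsManifold.of_le (n := ω) le_top
  obtain ⟨a, ha, hv⟩ := exists_diffCurve (⟨1, X⟩ : TangentBundle 𝓘(ℂ, EG) G)
  have h0 : a 0 = 1 := congrArg Bundle.TotalSpace.proj hv
  refine ⟨a, ha, h0, hv, ?_⟩
  simp only [logDer, h0, inv_one, one_mul]
  exact congrArg TangentBundle.vec hv

theorem logDer_eq_of_velocity {a : ℂ → G} (h0 : a 0 = 1) :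
    logDer EG a = (velocity 𝓘(ℂ, EG) a).vec := by
  simp [logDer, h0]

theorem adjointAction_mul (g h : G) (X : EG) :
    adjointAction EG (g * h) X = adjointAction EG g (adjointAction EG h X) := by
  obtain ⟨a, ha, -, -, rfl⟩ := exists_logDer_eq EG (G := G) X
  rw [← logDer_conj ha, ← logDer_conj ha, ← logDer_conj]
  · congr 1; funext s; group
  · exact ((DiffCurve.const _).mul ha).mul (DiffCurve.const _)

@[simp] theorem adjointAction_inv_apply (g : G) (X : EG) :
    adjointAction EG g⁻¹ (adjointAction EG g X) = X := by
  rw [← adjointAction_mul, inv_mul_cancel, adjointAction_one]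

@[simp] theorem adjointAction_apply_inv (g : G) (X : EG) :
    adjointAction EG g (adjointAction EG g⁻¹ X) = X := by
  rw [← adjointAction_mul, mul_inv_cancel, adjointAction_one]

/-- The product rule applied to `a a⁻¹ = 1`. -/
theorem logDer_inv {a : ℂ → G} (ha : DiffCurve 𝓘(ℂ, EG) a) :
    logDer EG (fun s => (a s)⁻¹) = -adjointAction EG (a 0) (logDer EG a) := by
  have h := logDer_mul ha ha.inv
  simp only [mul_inv_cancel, logDer_const, inv_inv] at h
  exact (neg_eq_of_add_eq_zero_right h.symm).symm

end GroupCurves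

/-! ### Biholomorphic local homeomorphisms -/

section Charts

variable {E : Type*} [NormedAddCommGroup E] [NormedSpace ℂ E] {H : Type*} [TopologicalSpace H]
  {I : ModelWithCorners ℂ E H} {M : Type*} [TopologicalSpace M] [ChartedSpace H M]
  {N : Type*} [TopologicalSpace N] [ChartedSpace H N]

/-- A local homeomorphism that pulls charts back to charts is biholomorphic. -/
theorem contMDiffOn_of_trans_mem_atlas [IsManifold I ω M] [IsManifold I ω N]
    (φ : OpenPartialHomeomorph M N) (h : ∀ c ∈ atlas H N, φ.trans c ∈ atlas H M) :
    ContMDiffOn I I ω φ φ.source ∧ ContMDiffOn I I ω φ.symm φ.target := by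
  have key : ∀ x ∈ φ.source, ContMDiffAt I I ω φ x ∧ ContMDiffAt I I ω φ.symm (φ x) := by
    intro x hx
    let c := chartAt H (φ x)
    have hc : c ∈ IsManifold.maximalAtlas I ω N :=
      IsManifold.subset_maximalAtlas (chart_mem_atlas H (φ x))
    have hk : φ.trans c ∈ IsManifold.maximalAtlas I ω M :=
      IsManifold.subset_maximalAtlas (h c (chart_mem_atlas H (φ x)))
    have hxc : φ x ∈ c.source := mem_chart_source H (φ x)
    have hxk : x ∈ (φ.trans c).source := by
      rw [OpenPartialHomeomorph.trans_source]; exact ⟨hx, hxc⟩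
    have h1 : ContMDiffAt I I ω (φ.trans c) x := contMDiffAt_of_mem_maximalAtlas hk hxk
    have h2 : ContMDiffAt I I ω c (φ x) := contMDiffAt_of_mem_maximalAtlas hc hxc
    have h1' : ContMDiffAt I I ω c.symm ((φ.trans c) x) :=
      contMDiffAt_symm_of_mem_maximalAtlas hc (c.map_source hxc)
    have h2' : ContMDiffAt I I ω (φ.trans c).symm (c (φ x)) :=
      contMDiffAt_symm_of_mem_maximalAtlas hk ((φ.trans c).map_source hxk)
    constructor
    · refine (ContMDiffAt.comp x h1' h1).congr_of_eventuallyEq ?_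
      filter_upwards [(φ.trans c).open_source.mem_nhds hxk] with z hz
      rw [OpenPartialHomeomorph.trans_source] at hz
      exact (c.left_inv hz.2).symm
    · refine (ContMDiffAt.comp (φ x) h2' h2).congr_of_eventuallyEq ?_
      filter_upwards [c.open_source.mem_nhds hxc] with z hz
      change φ.symm z = φ.symm (c.symm (c z))
      rw [c.left_inv hz]
  refine ⟨fun x hx => (key x hx).1.contMDiffWithinAt, fun y hy => ?_⟩
  have := (key _ (φ.map_target hy)).2
  rw [φ.right_inv hy] at this
  exact this.contMDiffWithinAt

end Charts

/-! ### Principal bundles and the Leibniz rule for their connections -/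

section Bundles

variable {EG : Type w} [NormedAddCommGroup EG] [NormedSpace ℂ EG]
  {G : Type v} [TopologicalSpace G] [ChartedSpace EG G] [Group G] [LieGroup 𝓘(ℂ, EG) ω G]
  {Y : Type x} [TopologicalSpace Y] [ChartedSpace ℂ Y]

namespace PrincipalBundle

variable (F : PrincipalBundle.{u} EG G Y)

open Classical in
/-- The element `z` of the group with `f' = f z`, for `f` and `f'` in the same fibre. -/
noncomputable def div (f f' : F.carrier) : G :=
  if h : F.proj f = F.proj f' then (F.exists_act_eq h).choose else 1

theorem act_div {f f' : F.carrier} (h : F.proj f = F.proj f') : F.act f (F.div f f') = f' := by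
  rw [div, dif_pos h]; exact (F.exists_act_eq h).choose_spec.symm

theorem div_act (f : F.carrier) (z : G) : F.div f (F.act f z) = z :=
  F.act_injective f (F.act_div (F.proj_act f z).symm)

theorem act_act_inv (f : F.carrier) (z : G) : F.act (F.act f z) z⁻¹ = f := by
  rw [← F.act_mul, mul_inv_cancel, F.act_one]

theorem act_inv_act (f : F.carrier) (z : G) : F.act (F.act f z⁻¹) z = f := by
  rw [← F.act_mul, inv_mul_cancel, F.act_one]

theorem div_eq {t : Bundle.Trivialization G F.proj} (ht : F.IsTriv t) {f f' : F.carrier}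
    (hf : f ∈ t.source) (h : F.proj f = F.proj f') : F.div f f' = (t f).2⁻¹ * (t f').2 := by
  have h1 := ht.2.2 f hf (F.div f f')
  rw [F.act_div h] at h1
  rw [h1]; simp

theorem exists_isTriv (y : Y) : ∃ t : Bundle.Trivialization G F.proj, F.IsTriv t ∧ y ∈ t.baseSet :=
  let ⟨t, hy, ht⟩ := F.locally_trivial y
  ⟨t, ht, hy⟩

/-- On the fibre product `div f f' = t(f)⁻¹ t(f')` in a trivialization. The right-hand side is
holomorphic on a full neighbourhood, also where `div` takes its default value. -/
theorem contMDiffOn_div : ContMDiffOn ((totalModel EG).prod (totalModel EG)) 𝓘(ℂ, EG) ω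
    (fun p : F.carrier × F.carrier => F.div p.1 p.2) {p | F.proj p.1 = F.proj p.2} := by
  rintro ⟨f, f'⟩ hff
  obtain ⟨t, ht, hy⟩ := F.exists_isTriv (F.proj f)
  have hf : f ∈ t.source := t.mem_source.2 hy
  have hff' : F.proj f = F.proj f' := hff
  have hf' : f' ∈ t.source := t.mem_source.2 (hff' ▸ hy)
  have h1 : ContMDiffAt (totalModel EG) (totalModel EG) ω t f :=
    ht.1.contMDiffAt (t.open_source.mem_nhds hf)
  have h2 : ContMDiffAt (totalModel EG) (totalModel EG) ω t f' :=
    ht.1.contMDiffAt (t.open_source.mem_nhds hf')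
  have h3 : ContMDiffAt ((totalModel EG).prod (totalModel EG)) 𝓘(ℂ, EG) ω
      (fun p : F.carrier × F.carrier => (t p.1).2⁻¹ * (t p.2).2) (f, f') :=
    (contMDiffAt_snd.comp (f, f') (h1.comp (f, f') contMDiffAt_fst)).inv.mul
      (contMDiffAt_snd.comp (f, f') (h2.comp (f, f') contMDiffAt_snd))
  refine h3.contMDiffWithinAt.congr_of_eventuallyEq ?_ (F.div_eq ht hf hff)
  filter_upwards [self_mem_nhdsWithin,
    mem_nhdsWithin_of_mem_nhds ((t.open_source.preimage continuous_fst).mem_nhds hf)] with p hp hp'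
  exact F.div_eq ht hp' hp

/-- The section of `F` defined by a trivialization. -/
noncomputable def trivSection (t : Bundle.Trivialization G F.proj) (y : Y) : F.carrier :=
  t.toOpenPartialHomeomorph.symm (y, 1)

theorem proj_trivSection {t : Bundle.Trivialization G F.proj} {y : Y} (hy : y ∈ t.baseSet) :
    F.proj (F.trivSection t y) = y := t.proj_symm_apply' hy

theorem contMDiffOn_trivSection {t : Bundle.Trivialization G F.proj} (ht : F.IsTriv t) :
    ContMDiffOn 𝓘(ℂ, ℂ) (totalModel EG) ω (F.trivSection t) t.baseSet :=
  ht.2.1.comp (contMDiffOn_id.prodMk contMDiffOn_const) (fun _ hp => t.mem_target.2 hp)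

theorem triv_trivSection {t : Bundle.Trivialization G F.proj} {y : Y} (hy : y ∈ t.baseSet) :
    t (F.trivSection t y) = (y, 1) := t.apply_symm_apply' hy

theorem locallyTrivialOver : LocallyTrivialOver EG G F.proj := by
  intro y
  obtain ⟨t, ht, hy⟩ := F.exists_isTriv y
  exact ⟨t.baseSet, t.toOpenPartialHomeomorph, t.open_baseSet, hy, t.source_eq, t.target_eq,
    ht.1, ht.2.1, fun x hx => t.coe_fst hx⟩

theorem contMDiff_act_right (g : G) :
    ContMDiff (totalModel EG) (totalModel EG) ω (fun e => F.act e g) :=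
  F.act_hol.comp (contMDiff_id.prodMk contMDiff_const)

theorem contMDiff_act_left (e : F.carrier) :
    ContMDiff 𝓘(ℂ, EG) (totalModel EG) ω (fun g => F.act e g) :=
  F.act_hol.comp (contMDiff_const.prodMk contMDiff_id)

variable {F} in
theorem _root_.DiffCurve.act {e : ℂ → F.carrier} {z : ℂ → G} (he : DiffCurve (totalModel EG) e)
    (hz : DiffCurve 𝓘(ℂ, EG) z) : DiffCurve (totalModel EG) (fun s => F.act (e s) (z s)) :=
  (he.prodMk hz).comp (F.act_hol.mdifferentiable (by simp) _)

end PrincipalBundle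

namespace PrincipalConnection

variable {E : PrincipalBundle.{u} EG G Y} (D : PrincipalConnection E)

/-- The value of a connection on a tangent vector, in the model space of the group. -/
noncomputable def eval (V : TangentBundle (totalModel EG) E.carrier) : EG := D.form V.1 V.2

theorem eval_add {V V₁ V₂ : TangentBundle (totalModel EG) E.carrier} (h₁ : V₁.1 = V.1)
    (h₂ : V₂.1 = V.1) (h : V.vec = V₁.vec + V₂.vec) : D.eval V = D.eval V₁ + D.eval V₂ := by
  obtain ⟨a, v⟩ := V
  obtain ⟨b, v₁⟩ := V₁
  obtain ⟨c, v₂⟩ := V₂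
  obtain rfl : b = a := h₁
  obtain rfl : c = b := h₂
  obtain rfl : v = v₁ + v₂ := h
  exact map_add (D.form _) v₁ v₂

theorem eval_zero (e : E.carrier) :
    D.eval (⟨e, (0 : ℂ × EG)⟩ : TangentBundle (totalModel EG) E.carrier) = 0 :=
  map_zero (D.form e)

theorem eval_tangentMap_act (g : G) (V : TangentBundle (totalModel EG) E.carrier) :
    D.eval (tangentMap (totalModel EG) (totalModel EG) (fun e => E.act e g) V) =
      adjointAction EG g⁻¹ (D.eval V) := by
  have h := congrArg TangentBundle.vec (D.form_act V.1 g V.2)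
  rw [tangentMap_vec] at h
  rw [adjointAction, inv_inv]
  exact h

theorem eval_velocity_act_one {z : ℂ → G} (hz : DiffCurve 𝓘(ℂ, EG) z) (h0 : z 0 = 1)
    (e : E.carrier) :
    D.eval (velocity (totalModel EG) (fun s => E.act e (z s))) = logDer EG z := by
  have hact : MDifferentiableAt 𝓘(ℂ, EG) (totalModel EG) (fun g => E.act e g) (z 0) :=
    (E.contMDiff_act_left e).mdifferentiable (by simp) _
  rw [velocity_comp hz hact, logDer_eq_of_velocity h0]
  have h := D.form_vertical e (velocity 𝓘(ℂ, EG) z).vec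
  have h1 : velocity 𝓘(ℂ, EG) z = ⟨1, (velocity 𝓘(ℂ, EG) z).vec⟩ :=
    TangentBundle.ext_vec h0 rfl
  rw [h1]
  exact h

/-- The transformation law used throughout. With `z` frozen the velocity is moved by a fixed group
element, and equivariance applies; with `e` frozen it is vertical, and the form reproduces the
generator. -/
theorem eval_velocity_act {e : ℂ → E.carrier} {z : ℂ → G} (he : DiffCurve (totalModel EG) e)
    (hz : DiffCurve 𝓘(ℂ, EG) z) :
    D.eval (velocity (totalModel EG) (fun s => E.act (e s) (z s))) =
      adjointAction EG (z 0)⁻¹ (D.eval (velocity (totalModel EG) e)) + logDer EG z := by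
  have hm : MDifferentiableAt ((totalModel EG).prod 𝓘(ℂ, EG)) (totalModel EG)
      (fun p : E.carrier × G => E.act p.1 p.2) (e 0, z 0) :=
    E.act_hol.mdifferentiable (by simp) _
  have hv := velocity_comp₂ he hz hm
  rw [D.eval_add (V := velocity (totalModel EG) (fun s => E.act (e s) (z s)))
    (V₁ := velocity (totalModel EG) (fun s => E.act (e s) (z 0)))
    (V₂ := velocity (totalModel EG) (fun s => E.act (e 0) (z s))) rfl rfl hv]
  congr 1
  · rw [velocity_comp (f := fun e => E.act e (z 0)) he
      ((E.contMDiff_act_right (z 0)).mdifferentiable (by simp) _), D.eval_tangentMap_act]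
  -- The orbit curve is restarted at `e(0) z(0)`, so that the curve in the group passes through `1`.
  · have h : logDer EG z = logDer EG (fun s => (z 0)⁻¹ * z s) := by simp [logDer]
    rw [h, ← D.eval_velocity_act_one ((DiffCurve.const _).mul hz) (by simp) (E.act (e 0) (z 0))]
    congr 2; funext s
    rw [← E.act_mul]; simp

end PrincipalConnection

end Bundles

/-! ### Holomorphic maps into a fixed tangent space -/

section Charts

variable {E : Type*} [NormedAddCommGroup E] [NormedSpace ℂ E] {H : Type*} [TopologicalSpace H]
  {I : ModelWithCorners ℂ E H} {M : Type*} [TopologicalSpace M] [ChartedSpace H M]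
  {E' : Type*} [NormedAddCommGroup E'] [NormedSpace ℂ E'] {H' : Type*} [TopologicalSpace H']
  {I' : ModelWithCorners ℂ E' H'} {N : Type*} [TopologicalSpace N] [ChartedSpace H' N]
  [IsManifold I' ω N]

/-- Holomorphy of a map to a fixed tangent space. -/
theorem contMDiffAt_tangentBundle_const_iff {a : N} {φ : M → E'} {m : M} :
    ContMDiffAt I I'.tangent ω (fun m => (⟨a, φ m⟩ : TangentBundle I' N)) m ↔
      ContMDiffAt I 𝓘(ℂ, E') ω φ m := by
  have : IsManifold I' 1 N := IsManifold.of_le (n := ω) le_top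
  refine Bundle.contMDiffAt_totalSpace.trans ?_
  refine (and_iff_right contMDiffAt_const).trans ?_
  refine iff_of_eq ?_
  congr 1
  funext m'
  -- The trivialization of the tangent bundle centred at `a` is the identity on the fibre over `a`.
  exact (tangentBundleCore I' N).coordChange_self (achart H' a) a (mem_chart_source H' a) (φ m')

theorem contMDiff_tangentBundle_const_iff {a : N} {φ : M → E'} :
    ContMDiff I I'.tangent ω (fun m => (⟨a, φ m⟩ : TangentBundle I' N)) ↔
      ContMDiff I 𝓘(ℂ, E') ω φ :=
  forall_congr' fun _ => contMDiffAt_tangentBundle_const_iff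

end Charts

/-! ### The group bundle `F(G)` and its bundle of Lie algebras -/

section AdjointBundle

variable {EG : Type w} [NormedAddCommGroup EG] [NormedSpace ℂ EG]
  {G : Type v} [TopologicalSpace G] [ChartedSpace EG G] [Group G] [LieGroup 𝓘(ℂ, EG) ω G]
  {Y : Type x} [TopologicalSpace Y] [ChartedSpace ℂ Y] [IsManifold 𝓘(ℂ, ℂ) ω Y]

namespace PrincipalBundle

variable {F : PrincipalBundle.{u} EG G Y}

namespace AdBundle

theorem contMDiffOn_triv {t : Bundle.Trivialization G F.proj} (ht : F.IsTriv t) :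
    ContMDiffOn (totalModel EG) (totalModel EG) ω (triv t ht) (triv t ht).source ∧
    ContMDiffOn (totalModel EG) (totalModel EG) ω (triv t ht).symm (triv t ht).target :=
  contMDiffOn_of_trans_mem_atlas _ (fun c hc => ⟨t, ht, c, hc, rfl⟩)

theorem triv_fst {t : Bundle.Trivialization G F.proj} (ht : F.IsTriv t) {γ : F.AdBundle} :
    (triv t ht γ).1 = proj F γ := by
  obtain ⟨f, g, rfl⟩ := exists_rep γ
  rfl

variable (F) in
theorem contMDiff_proj : ContMDiff (totalModel EG) 𝓘(ℂ, ℂ) ω (proj F) := by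
  intro γ
  obtain ⟨t, ht, hy⟩ := F.exists_isTriv (proj F γ)
  have h1 := (contMDiffOn_triv ht).1.contMDiffAt ((triv t ht).open_source.mem_nhds (x := γ) hy)
  exact (contMDiffAt_fst.comp γ h1).congr_of_eventuallyEq (.of_forall fun _ => (triv_fst ht).symm)

theorem mk_eq_triv_symm {t : Bundle.Trivialization G F.proj} (ht : F.IsTriv t) {f : F.carrier}
    (hf : F.proj f ∈ t.baseSet) (g : G) :
    mk F f g = (triv t ht).symm (F.proj f, (t f).2 * g * (t f).2⁻¹) := by
  rw [← trivFun_mk t ht hf g]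
  exact ((triv t ht).left_inv (x := mk F f g) hf).symm

variable (F) in
theorem contMDiff_mk : ContMDiff ((totalModel EG).prod 𝓘(ℂ, EG)) (totalModel EG) ω
    (fun p : F.carrier × G => mk F p.1 p.2) := by
  rintro ⟨f, g⟩
  obtain ⟨t, ht, hy⟩ := F.exists_isTriv (F.proj f)
  have hf : f ∈ t.source := t.mem_source.2 hy
  have h1 : ContMDiffAt (totalModel EG) (totalModel EG) ω t f :=
    ht.1.contMDiffAt (t.open_source.mem_nhds hf)
  have h2 : ContMDiffAt ((totalModel EG).prod 𝓘(ℂ, EG)) 𝓘(ℂ, EG) ω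
      (fun p : F.carrier × G => (t p.1).2) (f, g) :=
    contMDiffAt_snd.comp (f, g) (h1.comp (f, g) contMDiffAt_fst)
  have h3 : ContMDiffAt ((totalModel EG).prod 𝓘(ℂ, EG)) (totalModel EG) ω
      (fun p : F.carrier × G => (F.proj p.1, (t p.1).2 * p.2 * (t p.1).2⁻¹)) (f, g) :=
    ((F.proj_hol f).comp (f, g) contMDiffAt_fst).prodMk ((h2.mul contMDiffAt_snd).mul h2.inv)
  have h4 := (contMDiffOn_triv ht).2.contMDiffAt
    ((triv t ht).open_target.mem_nhds (x := (F.proj f, (t f).2 * g * (t f).2⁻¹)) ⟨hy, mem_univ _⟩)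
  refine (ContMDiffAt.comp (f, g) h4 h3).congr_of_eventuallyEq ?_
  filter_upwards [(t.open_source.preimage continuous_fst).mem_nhds hf] with p hp
  exact mk_eq_triv_symm ht (t.mem_source.1 hp) _

open Classical in
/-- The element `g` of the group with `γ = [f, g]`, for `γ` in the fibre of `f`. -/
noncomputable def coord (f : F.carrier) (γ : F.AdBundle) : G :=
  if h : proj F γ = F.proj f then (exists_rep_of_proj_eq γ f h).choose else 1

theorem mk_coord {f : F.carrier} {γ : F.AdBundle} (h : F.proj f = proj F γ) :
    mk F f (coord f γ) = γ := by
  rw [coord, dif_pos h.symm]; exact (exists_rep_of_proj_eq γ f h.symm).choose_spec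

theorem coord_mk (f : F.carrier) (g : G) : coord f (mk F f g) = g :=
  mk_injective f (mk_coord rfl)

/-- Solves `triv [f, g] = (π f, t(f) g t(f)⁻¹)` for `g`. The resulting formula shows that `coord` is
holomorphic along the fibre product. -/
theorem coord_eq {t : Bundle.Trivialization G F.proj} (ht : F.IsTriv t) {f : F.carrier}
    (hf : f ∈ t.source) {γ : F.AdBundle} (h : F.proj f = proj F γ) :
    coord f γ = (t f).2⁻¹ * (triv t ht γ).2 * (t f).2 := by
  have h1 : triv t ht γ = (F.proj f, (t f).2 * coord f γ * (t f).2⁻¹) := by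
    conv_lhs => rw [← mk_coord h]
    exact trivFun_mk t ht (t.mem_source.1 hf) _
  rw [h1]; simp [mul_assoc]

variable (F) in
theorem contMDiffOn_coord : ContMDiffOn ((totalModel EG).prod (totalModel EG)) 𝓘(ℂ, EG) ω
    (fun p : F.carrier × F.AdBundle => coord p.1 p.2) {p | F.proj p.1 = proj F p.2} := by
  rintro ⟨f, γ⟩ hfγ
  obtain ⟨t, ht, hy⟩ := F.exists_isTriv (F.proj f)
  have hf : f ∈ t.source := t.mem_source.2 hy
  have hfγ' : F.proj f = proj F γ := hfγ
  have h1 : ContMDiffAt (totalModel EG) (totalModel EG) ω t f :=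
    ht.1.contMDiffAt (t.open_source.mem_nhds hf)
  have h2 : ContMDiffAt (totalModel EG) (totalModel EG) ω (triv t ht) γ :=
    (contMDiffOn_triv ht).1.contMDiffAt ((triv t ht).open_source.mem_nhds
      (by change proj F γ ∈ t.baseSet; rw [← hfγ']; exact hy))
  have h4 : ContMDiffAt ((totalModel EG).prod (totalModel EG)) 𝓘(ℂ, EG) ω
      (fun p : F.carrier × F.AdBundle => (t p.1).2) (f, γ) :=
    contMDiffAt_snd.comp (f, γ) (h1.comp (f, γ) contMDiffAt_fst)
  have h3 : ContMDiffAt ((totalModel EG).prod (totalModel EG)) 𝓘(ℂ, EG) ω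
      (fun p : F.carrier × F.AdBundle => (t p.1).2⁻¹ * (triv t ht p.2).2 * (t p.1).2) (f, γ) :=
    (h4.inv.mul (contMDiffAt_snd.comp (f, γ) (h2.comp (f, γ) contMDiffAt_snd))).mul h4
  refine h3.contMDiffWithinAt.congr_of_eventuallyEq ?_ (coord_eq ht hf hfγ')
  filter_upwards [self_mem_nhdsWithin,
    mem_nhdsWithin_of_mem_nhds ((t.open_source.preimage continuous_fst).mem_nhds hf)] with p hp hp'
  exact coord_eq ht hp' hp

theorem _root_.DiffCurve.adBundleMk {f : ℂ → F.carrier} {g : ℂ → G} (hf : DiffCurve (totalModel EG) f)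
    (hg : DiffCurve 𝓘(ℂ, EG) g) : DiffCurve (totalModel EG) (fun s => mk F (f s) (g s)) :=
  (hf.prodMk hg).comp ((contMDiff_mk F).mdifferentiable (by simp) _)

theorem one_eq {y : Y} {f : F.carrier} (h : F.proj f = y) : one F y = mk F f 1 := by
  rw [← h, one_proj]

theorem contMDiff_mk_left (g : G) :
    ContMDiff (totalModel EG) (totalModel EG) ω (fun f => mk F f g) :=
  (contMDiff_mk F).comp (contMDiff_id.prodMk contMDiff_const)

theorem contMDiff_mk_right (f : F.carrier) :
    ContMDiff 𝓘(ℂ, EG) (totalModel EG) ω (mk F f) :=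
  (contMDiff_mk F).comp (contMDiff_const.prodMk contMDiff_id)

theorem velocity_mk {g : ℂ → G} (hg : DiffCurve 𝓘(ℂ, EG) g) (h0 : g 0 = 1) (f : F.carrier) :
    velocity (totalModel EG) (fun s => mk F f (g s)) = adMk f (logDer EG g) := by
  rw [velocity_comp hg ((contMDiff_mk_right f).mdifferentiable (by simp) _),
    logDer_eq_of_velocity h0]
  have h1 : velocity 𝓘(ℂ, EG) g = ⟨1, (velocity 𝓘(ℂ, EG) g).vec⟩ :=
    TangentBundle.ext_vec h0 rfl
  rw [h1]; rfl

/-- The derivative of `[f z, g] = [f, z g z⁻¹]` along a curve `g` through `1`. -/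
theorem adMk_act (f : F.carrier) (z : G) (X : EG) :
    adMk (F.act f z) X = adMk f (adjointAction EG z X) := by
  obtain ⟨a, ha, h0, -, rfl⟩ := exists_logDer_eq EG (G := G) X
  rw [← logDer_conj ha, ← velocity_mk ha h0, ← velocity_mk]
  · simp only [mk_act]
  · exact ((DiffCurve.const _).mul ha).mul (DiffCurve.const _)
  · simp [h0]

/-- A section of `F` over an open set `U` identifies `F(G)` over `U` with `U × G`. -/
theorem contMDiffOn_coord_section {σ : Y → F.carrier} {U : Set Y}
    (hσ : ContMDiffOn 𝓘(ℂ, ℂ) (totalModel EG) ω σ U) (hσ' : ∀ y ∈ U, F.proj (σ y) = y) :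
    ContMDiffOn (totalModel EG) 𝓘(ℂ, EG) ω (fun γ => coord (σ (proj F γ)) γ) (proj F ⁻¹' U) :=
  (contMDiffOn_coord F).comp
    ((hσ.comp (contMDiff_proj F).contMDiffOn (fun _ h => h)).prodMk contMDiffOn_id)
    (fun _ hγ => hσ' _ hγ)

/-- Along a section, `coord` is a left inverse of `g ↦ [σ y, g]`. Its derivative therefore recovers
`X` from `[σ y, X]`, and does so holomorphically in `y`. -/
theorem tangentMap_coord_section {σ : Y → F.carrier} {U : Set Y} (hU : IsOpen U)
    (hσ : ContMDiffOn 𝓘(ℂ, ℂ) (totalModel EG) ω σ U) (hσ' : ∀ y ∈ U, F.proj (σ y) = y)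
    {y : Y} (hy : y ∈ U) (X : EG) :
    tangentMap (totalModel EG) 𝓘(ℂ, EG) (fun γ => coord (σ (proj F γ)) γ) (adMk (σ y) X) =
      ⟨1, X⟩ := by
  obtain ⟨a, ha, h0, hv, rfl⟩ := exists_logDer_eq EG (G := G) X
  have hc : DiffCurve (totalModel EG) (fun s => mk F (σ y) (a s)) := (DiffCurve.const _).adBundleMk ha
  have hm : mk F (σ y) (a 0) ∈ proj F ⁻¹' U := by
    change F.proj (σ y) ∈ U; rw [hσ' y hy]; exact hy
  have hd := ((contMDiffOn_coord_section hσ hσ').contMDiffAt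
    ((hU.preimage continuous_proj).mem_nhds hm)).mdifferentiableAt (by simp)
  rw [← velocity_mk ha h0, ← velocity_comp hc hd, ← hv]
  congr 1; funext s
  rw [proj_mk, hσ' y hy, coord_mk]

/-- For a point on a local section the derivative of `coord` is a left inverse. Any `f` is obtained
from such a point by an element of `G`, which changes `X` by an invertible `Ad`. -/
theorem adMk_injective (f : F.carrier) : Function.Injective (fun X : EG => adMk f X) := by
  intro X X' h
  obtain ⟨t, ht, hy⟩ := F.exists_isTriv (F.proj f)
  have hf : f = F.act (F.trivSection t (F.proj f)) (F.div (F.trivSection t (F.proj f)) f) :=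
    (F.act_div (F.proj_trivSection hy)).symm
  have key := tangentMap_coord_section t.open_baseSet (F.contMDiffOn_trivSection ht)
    (fun y hy => F.proj_trivSection hy) hy
  change adMk f X = adMk f X' at h
  rw [hf, adMk_act, adMk_act] at h
  have h2 := congrArg TangentBundle.vec ((key _).symm.trans ((congrArg _ h).trans (key _)))
  have h3 := congrArg (adjointAction EG (F.div (F.trivSection t (F.proj f)) f)⁻¹) h2
  exact ((adjointAction_inv_apply _ X).symm.trans h3).trans (adjointAction_inv_apply _ X')

variable (F) in
/-- The map `(f, X) ↦ [f, X]` is holomorphic. -/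
theorem contMDiff_adMk : ContMDiff ((totalModel EG).prod 𝓘(ℂ, EG)) (totalModel EG).tangent ω
    (fun p : F.carrier × EG => adMk p.1 p.2) := by
  have hG : IsManifold 𝓘(ℂ, EG) ω G := ContMDiffMul.toIsManifold
  have hG1 : IsManifold 𝓘(ℂ, EG) 1 G := IsManifold.of_le (n := ω) le_top
  have hF1 : IsManifold (totalModel EG) 1 F.carrier := IsManifold.of_le (n := ω) le_top
  -- `[f, X]` is the derivative of `(f, g) ↦ [f, g]` at `(f, 1)` applied to `(0, X)`, so the map is
  -- a tangent map composed with the zero section of `TF` and the inclusion of `T_1 G`.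
  have h1 : ContMDiff ((totalModel EG).prod 𝓘(ℂ, EG)) (totalModel EG).tangent ω
      (fun p : F.carrier × EG => (⟨p.1, (0 : ℂ × EG)⟩ : TangentBundle (totalModel EG) F.carrier)) :=
    (Bundle.contMDiff_zeroSection ℂ (TangentSpace (totalModel EG) (M := F.carrier))).comp
      contMDiff_fst
  have h2 : ContMDiff ((totalModel EG).prod 𝓘(ℂ, EG)) 𝓘(ℂ, EG).tangent ω
      (fun p : F.carrier × EG => (⟨1, p.2⟩ : TangentBundle 𝓘(ℂ, EG) G)) :=
    contMDiff_tangentBundle_const_iff.2 contMDiff_snd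
  have h3 := ((contMDiff_mk F).contMDiff_tangentMap (m := ω) le_rfl).comp
    (contMDiff_equivTangentBundleProd_symm.comp (h1.prodMk h2))
  convert h3 using 1
  funext p
  obtain ⟨a, ha, h0, hv, hX⟩ := exists_logDer_eq EG (G := G) p.2
  have hc : DiffCurve (totalModel EG) (fun _ : ℂ => p.1) := DiffCurve.const _
  rw [← hX, ← velocity_mk ha h0]
  refine (velocity_comp (f := fun q : F.carrier × G => mk F q.1 q.2) (hc.prodMk ha)
    ((contMDiff_mk F).mdifferentiable (by simp) _)).trans ?_
  refine congrArg (tangentMap _ _ _) (TangentBundle.ext_vec (Prod.ext rfl h0) ?_)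
  rw [velocity_prodMk hc ha, velocity_const, hv]
  rfl

/-- A curve through the unit is written as `[σ(y(s)), g(s)]` with a local section `σ` through `f`.
In the product rule the term with `g` frozen depends only on `y`, which has velocity zero as the
vector is vertical; the other term has the form `[f, X]`. -/
theorem exists_adMk_eq {f : F.carrier} {W : TangentBundle (totalModel EG) F.AdBundle}
    (hf : W.1 = mk F f 1) (hW : vderiv (totalModel EG) 𝓘(ℂ, ℂ) (proj F) W.1 W.vec = 0) :
    ∃ X : EG, W = adMk f X := by
  have : IsManifold (totalModel EG) 1 F.AdBundle := IsManifold.of_le (n := ω) le_top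
  obtain ⟨c, hc, rfl⟩ := exists_diffCurve W
  rw [velocity_fst] at hf hW
  obtain ⟨t, ht, hy⟩ := F.exists_isTriv (F.proj f)
  -- The section of the trivialization is translated so that it passes through `f`.
  let z := F.div (F.trivSection t (F.proj f)) f
  let σ : Y → F.carrier := fun y => F.act (F.trivSection t y) z
  have hσ : ContMDiffOn 𝓘(ℂ, ℂ) (totalModel EG) ω σ t.baseSet :=
    (F.contMDiff_act_right z).comp_contMDiffOn (F.contMDiffOn_trivSection ht)
  have hσ' : ∀ y ∈ t.baseSet, F.proj (σ y) = y := fun y hy =>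
    (F.proj_act _ _).trans (F.proj_trivSection hy)
  have hσf : σ (F.proj f) = f := F.act_div (F.proj_trivSection hy)
  have hpc : DiffCurve 𝓘(ℂ, ℂ) (fun s => proj F (c s)) :=
    hc.comp ((contMDiff_proj F).mdifferentiable (by simp) _)
  have hp0 : proj F (c 0) = F.proj f := by rw [hf]; rfl
  have hd : MDifferentiableAt 𝓘(ℂ, ℂ) (totalModel EG) σ (proj F (c 0)) := by
    rw [hp0]; exact (hσ.contMDiffAt (t.open_baseSet.mem_nhds hy)).mdifferentiableAt (by simp)
  have ha : DiffCurve (totalModel EG) (fun s => σ (proj F (c s))) := hpc.comp hd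
  have hg : DiffCurve 𝓘(ℂ, EG) (fun s => coord (σ (proj F (c s))) (c s)) := by
    refine hc.comp (f := fun γ => coord (σ (proj F γ)) γ)
      (((contMDiffOn_coord_section hσ hσ').contMDiffAt ?_).mdifferentiableAt (by simp))
    exact (t.open_baseSet.preimage continuous_proj).mem_nhds (by rw [mem_preimage, hp0]; exact hy)
  have hg0 : coord (σ (proj F (c 0))) (c 0) = 1 := by rw [hp0, hσf, hf, coord_mk]
  refine ⟨logDer EG (fun s => coord (σ (proj F (c s))) (c s)), ?_⟩
  rw [← velocity_mk hg hg0]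
  refine TangentBundle.ext_vec (by simp only [velocity_fst]; rw [hg0, hf]) ?_
  have hev : c =ᶠ[𝓝 0] (fun s => mk F (σ (proj F (c s))) (coord (σ (proj F (c s))) (c s))) := by
    have hN : proj F ⁻¹' t.baseSet ∈ 𝓝 (c 0) :=
      (t.open_baseSet.preimage continuous_proj).mem_nhds (by rw [mem_preimage, hp0]; exact hy)
    filter_upwards [hc.eventually hN] with s hs
    exact (mk_coord (hσ' _ hs)).symm
  have hv := velocity_comp₂ (f := fun q : F.carrier × G => mk F q.1 q.2) ha hg
    ((contMDiff_mk F).mdifferentiable (by simp) _)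
  rw [velocity_congr hev]
  refine hv.trans ?_
  have hz : (velocity (totalModel EG) (fun s => mk F (σ (proj F (c s)))
      (coord (σ (proj F (c 0))) (c 0)))).vec = 0 := by
    have hd' : MDifferentiableAt 𝓘(ℂ, ℂ) (totalModel EG)
        (fun y => mk F (σ y) (coord (σ (proj F (c 0))) (c 0))) (proj F (c 0)) :=
      MDifferentiableAt.comp (I' := totalModel EG) (proj F (c 0))
        (g := fun f => mk F f (coord (σ (proj F (c 0))) (c 0))) ((contMDiff_mk_left _).mdifferentiable (by simp) _) hd
    rw [velocity_comp hpc hd', velocity_comp hc ((contMDiff_proj F).mdifferentiable (by simp) _),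
      tangentMap_vec, tangentMap_vec]
    exact (congrArg _ hW).trans (map_zero _)
  simp only
  rw [hz, zero_add]
  simp only [hp0, hσf]

end AdBundle

end PrincipalBundle

end AdjointBundle

/-! ### Torsor connections evaluated on curves -/

section Torsors

variable {EG : Type w} [NormedAddCommGroup EG] [NormedSpace ℂ EG]
  {G : Type v} [TopologicalSpace G] [ChartedSpace EG G] [Group G] [LieGroup 𝓘(ℂ, EG) ω G]
  {Y : Type x} [TopologicalSpace Y] [ChartedSpace ℂ Y] [IsManifold 𝓘(ℂ, ℂ) ω Y]
  {F : PrincipalBundle.{u} EG G Y}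

open PrincipalBundle

theorem PrincipalBundle.AdBundle.adMk_add_vec (f : F.carrier) (X X' : EG) :
    (adMk f (X + X' : EG)).vec = (adMk f X).vec + (adMk f X').vec :=
  map_add (vderiv 𝓘(ℂ, EG) (totalModel EG) (AdBundle.mk F f) 1) X X'

theorem PrincipalBundle.AdBundle.adMk_zero_vec (f : F.carrier) : (adMk f (0 : EG)).vec = 0 :=
  map_zero (vderiv 𝓘(ℂ, EG) (totalModel EG) (AdBundle.mk F f) 1)

/-- The curve `s ↦ [f, a(s)]` lies over a constant curve in `Y`. -/
theorem PrincipalBundle.AdBundle.adMk_mem_ad {f : F.carrier} {y : Y} (h : F.proj f = y) (X : EG) :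
    ((adMk f X).vec : TangentSpace (totalModel EG) (AdBundle.one F y)) ∈ F.ad y := by
  subst h
  obtain ⟨a, ha, h0, -, rfl⟩ := exists_logDer_eq EG (G := G) X
  change vderiv (totalModel EG) 𝓘(ℂ, ℂ) (AdBundle.proj F) (AdBundle.one F (F.proj f)) _ = 0
  rw [AdBundle.one_proj]
  have h := velocity_comp ((DiffCurve.const f).adBundleMk ha)
    ((AdBundle.contMDiff_proj F).mdifferentiable (by simp) _)
  rw [AdBundle.velocity_mk ha h0] at h
  refine (tangentMap_vec (AdBundle.proj F) (adMk f (logDer EG a))).symm.trans ?_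
  rw [← h]
  exact congrArg TangentBundle.vec (velocity_const (I := 𝓘(ℂ, ℂ)) (F.proj f))

namespace AdTorsor

variable (T : AdTorsor F)

theorem act_mk_one {e : T.carrier} {f : F.carrier} (h : T.proj e = F.proj f) :
    T.act e (AdBundle.mk F f 1) = e := by
  rw [← AdBundle.one_eq h.symm, T.act_one]

theorem act_act_mk {e : T.carrier} {f : F.carrier} (h : T.proj e = F.proj f) (g g' : G) :
    T.act (T.act e (AdBundle.mk F f g)) (AdBundle.mk F f g') = T.act e (AdBundle.mk F f (g * g')) := by
  rw [← AdBundle.mk_mul_mk, T.act_mul _ _ _ h h]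

variable {T}

theorem _root_.DiffCurve.torsorAct {τ : ℂ → T.carrier} {γ : ℂ → F.AdBundle}
    (hτ : DiffCurve (totalModel EG) τ) (hγ : DiffCurve (totalModel EG) γ)
    (h : ∀ s, T.proj (τ s) = AdBundle.proj F (γ s)) :
    DiffCurve (totalModel EG) (fun s => T.act (τ s) (γ s)) :=
  (hτ.prodMk hγ).comp_within (f := fun p : T.carrier × F.AdBundle => T.act p.1 p.2)
    ((T.act_hol.mdifferentiableOn (by simp)) _ (h 0)) (.of_forall h)

end AdTorsor

namespace AdTorsorConnection

variable {D₀ : PrincipalConnection F} {T : AdTorsor F} (β : AdTorsorConnection D₀ T)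

@[simp] theorem total_fst (V : TangentBundle (totalModel EG) T.carrier) :
    (β.total V).1 = AdBundle.one F (T.proj V.1) := rfl

theorem total_add_vec {V V₁ V₂ : TangentBundle (totalModel EG) T.carrier} (h₁ : V₁.1 = V.1)
    (h₂ : V₂.1 = V.1) (h : V.vec = V₁.vec + V₂.vec) :
    (β.total V).vec = (β.total V₁).vec + (β.total V₂).vec := by
  obtain ⟨a, v⟩ := V
  obtain ⟨b, v₁⟩ := V₁
  obtain ⟨c, v₂⟩ := V₂
  obtain rfl : b = a := h₁
  obtain rfl : c = b := h₂
  obtain rfl : v = v₁ + v₂ := h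
  exact congrArg Subtype.val (map_add (β.form _) v₁ v₂)

theorem exists_total_eq {V : TangentBundle (totalModel EG) T.carrier} {f : F.carrier}
    (h : T.proj V.1 = F.proj f) : ∃ X : EG, β.total V = adMk f X :=
  AdBundle.exists_adMk_eq (AdBundle.one_eq h.symm) (β.form V.1 V.2).2

/-- The axiom `form_vertical` in terms of curves: `[f, z(s)]` stays in one fibre of `F(G)`, so the
derivative of the orbit map along that fibre applies to its velocity. -/
theorem total_velocity_act_mk_one {e : T.carrier} {f : F.carrier} (h : T.proj e = F.proj f)
    {z : ℂ → G} (hz : DiffCurve 𝓘(ℂ, EG) z) (h0 : z 0 = 1) :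
    β.total (velocity (totalModel EG) (fun s => T.act e (AdBundle.mk F f (z s)))) =
      adMk f (logDer EG z) := by
  have hc := (DiffCurve.const (I := totalModel EG) f).adBundleMk hz
  have hv := AdBundle.velocity_mk hz h0 f
  have h1 : AdBundle.mk F f 1 = AdBundle.one F (T.proj e) := (AdBundle.one_eq h.symm).symm
  let S : Set F.AdBundle := {γ | AdBundle.proj F γ = T.proj e}
  have hd : MDifferentiableWithinAt (totalModel EG) (totalModel EG) (fun γ => T.act e γ) S
      (AdBundle.mk F f (z 0)) := by
    have h2 := (T.act_hol.mdifferentiableOn (by simp)) (e, AdBundle.mk F f (z 0)) h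
    exact MDifferentiableWithinAt.comp (I' := (totalModel EG).prod (totalModel EG)) (s := S)
      (f := fun γ => (e, γ)) (AdBundle.mk F f (z 0)) h2
      (mdifferentiableWithinAt_const.prodMk mdifferentiableWithinAt_id) (fun γ hγ => hγ.symm)
  have hvel := velocity_comp_within' hc hd (.of_forall fun s => h.symm) hv
  rw [hvel]
  let ξ : F.ad (T.proj e) := ⟨(adMk f (logDer EG z)).vec, AdBundle.adMk_mem_ad h.symm _⟩
  have hξ : (⟨AdBundle.mk F f 1, (adMk f (logDer EG z)).2⟩ :
      TangentBundle (totalModel EG) F.AdBundle) = ⟨AdBundle.one F (T.proj e), ξ⟩ :=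
    TangentBundle.ext_vec h1 rfl
  have key := β.form_vertical e ξ
  refine Eq.trans ?_ (key.trans hξ.symm)
  change β.total ((fun W : TangentBundle (totalModel EG) F.AdBundle =>
    (⟨T.act e W.1, mfderivWithin (totalModel EG) (totalModel EG) (fun γ => T.act e γ) S W.1 W.2⟩ :
      TangentBundle (totalModel EG) T.carrier)) (adMk f (logDer EG z))) = _
  have hξ' : adMk f (logDer EG z) = ⟨AdBundle.one F (T.proj e), ξ⟩ := hξ
  rw [hξ']
  rfl

/-- Since `z` starts at `1`, the product rule splits the velocity into that of `τ` and a vertical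
one, to which `form_vertical` applies. -/
theorem total_velocity_act_mk_of_one {τ : ℂ → T.carrier} {f : ℂ → F.carrier} {z : ℂ → G}
    (hτ : DiffCurve (totalModel EG) τ) (hf : DiffCurve (totalModel EG) f)
    (hz : DiffCurve 𝓘(ℂ, EG) z) (h0 : z 0 = 1) (h : ∀ s, T.proj (τ s) = F.proj (f s)) {X : EG}
    (hX : β.total (velocity (totalModel EG) τ) = adMk (f 0) X) :
    β.total (velocity (totalModel EG) (fun s => T.act (τ s) (AdBundle.mk F (f s) (z s)))) =
      adMk (f 0) (X + logDer EG z) := by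
  refine TangentBundle.ext_vec ?_ ?_
  · rw [total_fst, velocity_fst, h0, T.act_mk_one (h 0)]
    exact AdBundle.one_eq (h 0).symm
  · have hfst : MDifferentiableAt (𝓘(ℂ, ℂ).prod 𝓘(ℂ, ℂ)) 𝓘(ℂ, ℂ) (Prod.fst : ℂ × ℂ → ℂ) (0, 0) :=
      mdifferentiableAt_fst
    have hsnd : MDifferentiableAt (𝓘(ℂ, ℂ).prod 𝓘(ℂ, ℂ)) 𝓘(ℂ, ℂ) (Prod.snd : ℂ × ℂ → ℂ) (0, 0) :=
      mdifferentiableAt_snd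
    have hf1 : MDifferentiableAt (𝓘(ℂ, ℂ).prod 𝓘(ℂ, ℂ)) (totalModel EG)
        (fun p : ℂ × ℂ => f p.1) (0, 0) :=
      MDifferentiableAt.comp (I' := 𝓘(ℂ, ℂ)) (g := f) ((0 : ℂ), (0 : ℂ)) hf hfst
    have hz2 : MDifferentiableAt (𝓘(ℂ, ℂ).prod 𝓘(ℂ, ℂ)) 𝓘(ℂ, EG)
        (fun p : ℂ × ℂ => z p.2) (0, 0) :=
      MDifferentiableAt.comp (I' := 𝓘(ℂ, ℂ)) (g := z) ((0 : ℂ), (0 : ℂ)) hz hsnd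
    have hv := velocity_comp₂_within (f := fun p : T.carrier × F.AdBundle => T.act p.1 p.2)
      (S := {p | T.proj p.1 = AdBundle.proj F p.2}) (a := fun p => τ p.1)
      (b := fun p => AdBundle.mk F (f p.1) (z p.2))
      (MDifferentiableAt.comp (I' := 𝓘(ℂ, ℂ)) ((0 : ℂ), (0 : ℂ)) hτ hfst)
      (MDifferentiableAt.comp (I' := (totalModel EG).prod 𝓘(ℂ, EG)) ((0 : ℂ), (0 : ℂ))
        ((AdBundle.contMDiff_mk F).mdifferentiable (by simp) (f 0, z 0))
        (hf1.prodMk hz2))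
      ((T.act_hol.mdifferentiableOn (by simp)) (τ 0, AdBundle.mk F (f 0) (z 0)) (h 0))
      (fun p => h p.1)
    have e1 : (fun s => T.act (τ s) (AdBundle.mk F (f s) (z 0))) = τ := by
      funext s; rw [h0, T.act_mk_one (h s)]
    have hsum := β.total_add_vec
      (V := velocity (totalModel EG) (fun s => T.act (τ s) (AdBundle.mk F (f s) (z s))))
      (V₁ := velocity (totalModel EG) (fun s => T.act (τ s) (AdBundle.mk F (f s) (z 0))))
      (V₂ := velocity (totalModel EG) (fun s => T.act (τ 0) (AdBundle.mk F (f 0) (z s))))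
      rfl rfl hv
    rw [hsum, e1, hX, β.total_velocity_act_mk_one (h 0) hz h0, AdBundle.adMk_add_vec]

/-- The axiom `form_act` in terms of curves: for constant `g` and horizontal `f` the curve `[f, g]`
is horizontal. -/
theorem total_velocity_act_mk_const {τ : ℂ → T.carrier} {f : ℂ → F.carrier}
    (hτ : DiffCurve (totalModel EG) τ) (hf : DiffCurve (totalModel EG) f)
    (h : ∀ s, T.proj (τ s) = F.proj (f s))
    (hX : β.total (velocity (totalModel EG) τ) = adMk (f 0) (0 : EG))
    (hf0 : D₀.eval (velocity (totalModel EG) f) = 0) (g : G) :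
    β.total (velocity (totalModel EG) (fun s => T.act (τ s) (AdBundle.mk F (f s) g))) =
      adMk (f 0) (0 : EG) := by
  have hm : DiffCurve (totalModel EG) (fun s => AdBundle.mk F (f s) g) :=
    hf.adBundleMk (DiffCurve.const g)
  have hvm : velocity (totalModel EG) (fun s => AdBundle.mk F (f s) g) =
      tangentMap (totalModel EG) (totalModel EG) (fun f => AdBundle.mk F f g)
        (velocity (totalModel EG) f) :=
    velocity_comp hf ((AdBundle.contMDiff_mk_left g).mdifferentiable (by simp) _)
  have hform : β.form (τ 0) (velocity (totalModel EG) τ).2 = 0 := by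
    refine Subtype.ext ?_
    exact (congrArg TangentBundle.vec hX).trans (AdBundle.adMk_zero_vec _)
  have hbase : tangentMap (totalModel EG) 𝓘(ℂ, ℂ) T.proj (velocity (totalModel EG) τ) =
      tangentMap (totalModel EG) 𝓘(ℂ, ℂ) (AdBundle.proj F)
        (velocity (totalModel EG) (fun s => AdBundle.mk F (f s) g)) := by
    rw [← velocity_comp hτ (T.proj_hol.mdifferentiable (by simp) _),
      ← velocity_comp hm ((AdBundle.contMDiff_proj F).mdifferentiable (by simp) _)]
    congr 1; funext s; exact h s
  have key := β.form_act _ _ hbase hform ⟨g, _, hf0, hvm⟩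
  have hv := velocity_comp_within (f := fun p : T.carrier × F.AdBundle => T.act p.1 p.2)
    (hτ.prodMk hm) ((T.act_hol.mdifferentiableOn (by simp)) (τ 0, AdBundle.mk F (f 0) g) (h 0))
    (.of_forall h)
  have hvv : (velocity ((totalModel EG).prod (totalModel EG))
      (fun s => (τ s, AdBundle.mk F (f s) g))).2 =
      ((velocity (totalModel EG) τ).2,
        (velocity (totalModel EG) (fun s => AdBundle.mk F (f s) g)).2) :=
    velocity_prodMk hτ hm
  rw [hvv] at hv
  rw [hv]
  refine TangentBundle.ext_vec ?_ ?_
  · rw [total_fst, T.proj_act _ _ (h 0)]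
    exact AdBundle.one_eq (h 0).symm
  · rw [AdBundle.adMk_zero_vec]
    exact congrArg Subtype.val key

/-- The value of the connection on the velocity of a product `τ · [f, g]`. -/
theorem total_velocity_act_mk {τ : ℂ → T.carrier} {f : ℂ → F.carrier} {g : ℂ → G}
    (hτ : DiffCurve (totalModel EG) τ) (hf : DiffCurve (totalModel EG) f)
    (hg : DiffCurve 𝓘(ℂ, EG) g) (h : ∀ s, T.proj (τ s) = F.proj (f s)) {X : EG}
    (hX : β.total (velocity (totalModel EG) τ) = adMk (f 0) X) :
    β.total (velocity (totalModel EG) (fun s => T.act (τ s) (AdBundle.mk F (f s) (g s)))) =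
      adMk (f 0) (adjointAction EG (g 0)⁻¹ (X + D₀.eval (velocity (totalModel EG) f)) +
        logDer EG g - D₀.eval (velocity (totalModel EG) f) : EG) := by
  -- The curves `a` and `b` make `f' = f a` and `τ' = τ · [f', b⁻¹]` horizontal at `0`. The constant
  -- `g(0)` can then be applied by `form_act`, leaving only a correction through `1`.
  obtain ⟨a, ha, ha0, -, hla⟩ :=
    exists_logDer_eq EG (G := G) (-D₀.eval (velocity (totalModel EG) f))
  obtain ⟨b, hb, hb0, -, hlb⟩ := exists_logDer_eq EG (G := G) X
  let f' : ℂ → F.carrier := fun s => F.act (f s) (a s)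
  have hf' : DiffCurve (totalModel EG) f' := hf.act ha
  have hf'0 : f' 0 = f 0 := by simp only [f', ha0, F.act_one]
  have hD : D₀.eval (velocity (totalModel EG) f') = 0 := by
    rw [D₀.eval_velocity_act hf ha, ha0, hla, inv_one, adjointAction_one, add_neg_cancel]
  have h' : ∀ s, T.proj (τ s) = F.proj (f' s) := fun s => (h s).trans (F.proj_act _ _).symm
  let τ' : ℂ → T.carrier := fun s => T.act (τ s) (AdBundle.mk F (f' s) (b s)⁻¹)
  have hτ' : DiffCurve (totalModel EG) τ' := hτ.torsorAct (hf'.adBundleMk hb.inv) h'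
  have hp' : ∀ s, T.proj (τ' s) = F.proj (f' s) := fun s => (T.proj_act _ _ (h' s)).trans (h' s)
  have hv' : β.total (velocity (totalModel EG) τ') = adMk (f' 0) (0 : EG) := by
    rw [β.total_velocity_act_mk_of_one hτ hf' hb.inv (by simp [hb0]) h' (hf'0.symm ▸ hX),
      logDer_inv hb, hb0, adjointAction_one, hlb, add_neg_cancel]
  let τ'' : ℂ → T.carrier := fun s => T.act (τ' s) (AdBundle.mk F (f' s) (g 0))
  have hτ'' : DiffCurve (totalModel EG) τ'' :=
    hτ'.torsorAct (hf'.adBundleMk (DiffCurve.const (g 0))) hp'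
  have hp'' : ∀ s, T.proj (τ'' s) = F.proj (f' s) := fun s => (T.proj_act _ _ (hp' s)).trans (hp' s)
  have hv'' := β.total_velocity_act_mk_const hτ' hf' hp' hv' hD (g 0)
  -- The correction: `[f, g] = [f', a⁻¹ g a]` and `τ'' = τ · [f', b⁻¹ g(0)]`, so the missing factor
  -- in the frame `f'` is `g(0)⁻¹ b a⁻¹ g a`, which is `1` at `0`.
  have hc : DiffCurve 𝓘(ℂ, EG) (fun s => (g 0)⁻¹ * b s * (a s)⁻¹ * g s * a s) :=
    ((((DiffCurve.const _).mul hb).mul ha.inv).mul hg).mul ha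
  have hfin := β.total_velocity_act_mk_of_one hτ'' hf' hc (by simp [ha0, hb0]) hp'' hv''
  have e : (fun s => T.act (τ s) (AdBundle.mk F (f s) (g s))) =
      fun s => T.act (τ'' s) (AdBundle.mk F (f' s) ((g 0)⁻¹ * b s * (a s)⁻¹ * g s * a s)) := by
    funext s
    simp only [τ'', τ']
    rw [T.act_act_mk (hp' s), T.act_act_mk (h' s), ← F.act_act_inv (f s) (a s), AdBundle.mk_act]
    congr 2
    group
  rw [e, hfin, hf'0, logDer_mul ((((DiffCurve.const _).mul hb).mul ha.inv).mul hg) ha,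
    logDer_mul (((DiffCurve.const _).mul hb).mul ha.inv) hg,
    logDer_mul ((DiffCurve.const _).mul hb) ha.inv, logDer_mul (DiffCurve.const _) hb,
    logDer_const, logDer_inv ha, ha0, hb0, hla, hlb]
  simp only [inv_one, adjointAction_one, zero_add, neg_neg, sub_eq_add_neg]

end AdTorsorConnection

end Torsors

/-! ### Tangent maps of locally holomorphic maps -/

section TangentMaps

variable {E : Type*} [NormedAddCommGroup E] [NormedSpace ℂ E] {H : Type*} [TopologicalSpace H]
  {I : ModelWithCorners ℂ E H} {M : Type*} [TopologicalSpace M] [ChartedSpace H M]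
  [IsManifold I ω M]
  {E' : Type*} [NormedAddCommGroup E'] [NormedSpace ℂ E'] {H' : Type*} [TopologicalSpace H']
  {I' : ModelWithCorners ℂ E' H'} {N : Type*} [TopologicalSpace N] [ChartedSpace H' N]
  [IsManifold I' ω N]

/-- The tangent map of a map that is holomorphic near a point is holomorphic. -/
theorem ContMDiffOn.contMDiffAt_tangentMap {f : M → N} {U : Set M} (hf : ContMDiffOn I I' ω f U)
    (hU : IsOpen U) {V : TangentBundle I M} (hV : V.1 ∈ U) :
    ContMDiffAt I.tangent I'.tangent ω (tangentMap I I' f) V := by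
  have : IsManifold I 1 M := IsManifold.of_le (n := ω) le_top
  have : IsManifold I' 1 N := IsManifold.of_le (n := ω) le_top
  have hN : Bundle.TotalSpace.proj ⁻¹' U ∈ 𝓝 V :=
    (hU.preimage (FiberBundle.continuous_proj E (TangentSpace I (M := M)))).mem_nhds hV
  refine ((hf.contMDiffOn_tangentMapWithin (m := ω) le_rfl hU.uniqueMDiffOn).contMDiffAt
    hN).congr_of_eventuallyEq ?_
  filter_upwards [hN] with W hW
  refine TangentBundle.ext_vec rfl ?_
  exact congrArg (fun L : E →L[ℂ] E' => L W.vec) (mfderivWithin_of_isOpen hU hW).symm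

end TangentMaps

/-! ### Lifting points and curves from the twist -/

section Twists

variable {EG : Type w} [NormedAddCommGroup EG] [NormedSpace ℂ EG]
  {G : Type v} [TopologicalSpace G] [ChartedSpace EG G] [Group G] [LieGroup 𝓘(ℂ, EG) ω G]
  {Y : Type x} [TopologicalSpace Y] [ChartedSpace ℂ Y] [IsManifold 𝓘(ℂ, ℂ) ω Y]
  {F E : PrincipalBundle.{u} EG G Y}

open PrincipalBundle

theorem PrincipalConnection.contMDiff_eval (D : PrincipalConnection E) :
    ContMDiff (totalModel EG).tangent 𝓘(ℂ, EG) ω D.eval := by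
  have : IsManifold 𝓘(ℂ, EG) ω G := ContMDiffMul.toIsManifold
  exact contMDiff_tangentBundle_const_iff.1 D.form_hol

variable (F) in
/-- A tangent vector of a manifold over `Y` is the velocity of a curve that lifts to `F`. -/
theorem PrincipalBundle.exists_diffCurve_over {M : Type*} [TopologicalSpace M]
    [ChartedSpace (ModelProd ℂ EG) M] [IsManifold (totalModel EG) ω M] {π : M → Y}
    (hπ : MDifferentiable (totalModel EG) 𝓘(ℂ, ℂ) π) (V : TangentBundle (totalModel EG) M) :
    ∃ (c : ℂ → M) (f : ℂ → F.carrier), DiffCurve (totalModel EG) c ∧ DiffCurve (totalModel EG) f ∧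
      velocity (totalModel EG) c = V ∧ ∀ s, π (c s) = F.proj (f s) := by
  have : IsManifold (totalModel EG) 1 M := IsManifold.of_le (n := ω) le_top
  obtain ⟨c, hc, rfl⟩ := exists_diffCurve V
  obtain ⟨t, ht, hy⟩ := F.exists_isTriv (π (c 0))
  have hev : ∀ᶠ s in 𝓝 0, c s ∈ π ⁻¹' t.baseSet := hc.eventually
    ((hπ _).continuousAt.preimage_mem_nhds (t.open_baseSet.mem_nhds hy))
  obtain ⟨κ, hκ, hP⟩ := exists_reparam hev
  have e1 : (fun s => c (κ s)) =ᶠ[𝓝 0] c := by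
    filter_upwards [hκ] with s hs; rw [hs]; rfl
  have hc' : DiffCurve (totalModel EG) (fun s => c (κ s)) := hc.congr e1
  have hσ : DiffCurve (totalModel EG) (fun s => F.trivSection t (π (c (κ s)))) :=
    DiffCurve.comp (I := 𝓘(ℂ, ℂ)) (hc'.comp (hπ _))
      (((F.contMDiffOn_trivSection ht).contMDiffAt
        (t.open_baseSet.mem_nhds (hP 0))).mdifferentiableAt (by simp))
  exact ⟨_, _, hc', hσ, velocity_congr e1, fun s => (F.proj_trivSection (hP s)).symm⟩

namespace IsTwist

variable {T : AdTorsor F} {q : E.carrier → F.carrier → T.carrier} (tw : IsTwist F E T q)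

include tw

theorem q_act_act {e : E.carrier} {f : F.carrier} (h : E.proj e = F.proj f) (z : G) :
    q (E.act e z) (F.act f z) = q e f :=
  ((tw.q_eq_iff _ _ _ _ h (by rw [E.proj_act, F.proj_act, h])).2 ⟨z, rfl, rfl⟩).symm

/-- As `(e, f z) ∼ (e z⁻¹, f)`, moving `f` in its fibre amounts to acting by `F(G)`. -/
theorem q_act_right {e : E.carrier} {f : F.carrier} (h : E.proj e = F.proj f) (z : G) :
    q e (F.act f z) = T.act (q e f) (AdBundle.mk F f z⁻¹) := by
  rw [tw.q_act e f z⁻¹ h, ← tw.q_act_act ((E.proj_act e z⁻¹).trans h) z, E.act_inv_act]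

/-- Any representative of `τ` can be translated diagonally until its second component is `f`. -/
theorem exists_lift {τ : T.carrier} {f : F.carrier} (h : T.proj τ = F.proj f) :
    ∃ e, E.proj e = F.proj f ∧ q e f = τ := by
  obtain ⟨U, s, -, hτ, -, hs⟩ := tw.exists_section τ
  obtain ⟨h1, h2⟩ := hs τ hτ
  have h3 : F.proj (s τ).2 = F.proj f := by rw [← h, ← h2, tw.proj_q _ _ h1, h2]
  refine ⟨E.act (s τ).1 (F.div (s τ).2 f), by rw [E.proj_act, h1, h3], ?_⟩
  nth_rewrite 2 [← F.act_div h3]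
  rw [tw.q_act_act h1, h2]

theorem q_left_injective {e e' : E.carrier} {f : F.carrier} (h : E.proj e = F.proj f)
    (h' : E.proj e' = F.proj f) (hq : q e f = q e' f) : e = e' := by
  obtain ⟨z, hz, hz'⟩ := (tw.q_eq_iff _ _ _ _ h h').1 hq
  have : z = 1 := F.act_injective f (by rw [← hz', F.act_one])
  rw [hz, this, E.act_one]

open Classical in
/-- The point `e` of `E` with `q e f = τ`. -/
noncomputable def lift (τ : T.carrier) (f : F.carrier) : E.carrier :=
  if h : T.proj τ = F.proj f then (tw.exists_lift h).choose
  -- Off the fibre product the value is irrelevant; a local section supplies some point of `E`.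
  else ((tw.exists_section τ).choose_spec.choose τ).1

theorem proj_lift {τ : T.carrier} {f : F.carrier} (h : T.proj τ = F.proj f) :
    E.proj (tw.lift τ f) = F.proj f := by
  rw [lift, dif_pos h]; exact (tw.exists_lift h).choose_spec.1

theorem q_lift {τ : T.carrier} {f : F.carrier} (h : T.proj τ = F.proj f) :
    q (tw.lift τ f) f = τ := by
  rw [lift, dif_pos h]; exact (tw.exists_lift h).choose_spec.2

theorem lift_eq {τ : T.carrier} {e : E.carrier} {f : F.carrier} (h : E.proj e = F.proj f)
    (hq : q e f = τ) : tw.lift τ f = e := by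
  subst hq
  have h' := tw.proj_q e f h
  exact tw.q_left_injective (tw.proj_lift h') h (tw.q_lift h')

/-- If `s = (s₁, s₂)` is a local section of the quotient map, then `lift τ f = s₁(τ) · div(s₂(τ),
f)`, a composite of holomorphic maps. -/
theorem contMDiffOn_lift : ContMDiffOn ((totalModel EG).prod (totalModel EG)) (totalModel EG) ω
    (fun p : T.carrier × F.carrier => tw.lift p.1 p.2) {p | T.proj p.1 = F.proj p.2} := by
  rintro ⟨τ, f⟩ hτf
  obtain ⟨U, s, hU, hτ, hs, hs'⟩ := tw.exists_section τ
  have hsa : ContMDiffAt (totalModel EG) ((totalModel EG).prod (totalModel EG)) ω s τ :=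
    hs.contMDiffAt (hU.mem_nhds hτ)
  have hs1 : ContMDiffAt ((totalModel EG).prod (totalModel EG)) (totalModel EG) ω
      (fun p : T.carrier × F.carrier => (s p.1).1) (τ, f) :=
    contMDiffAt_fst.comp (τ, f) (hsa.comp (τ, f) contMDiffAt_fst)
  have hs2 : ContMDiffAt ((totalModel EG).prod (totalModel EG)) (totalModel EG) ω
      (fun p : T.carrier × F.carrier => (s p.1).2) (τ, f) :=
    contMDiffAt_snd.comp (τ, f) (hsa.comp (τ, f) contMDiffAt_fst)
  have hpr : ∀ p : T.carrier × F.carrier, T.proj p.1 = F.proj p.2 → p.1 ∈ U →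
      F.proj (s p.1).2 = F.proj p.2 := by
    intro p hp hpU
    obtain ⟨h1, h2⟩ := hs' p.1 hpU
    rw [← hp, ← tw.proj_q _ _ h1, h2]
  have heq : ∀ p : T.carrier × F.carrier, T.proj p.1 = F.proj p.2 → p.1 ∈ U →
      tw.lift p.1 p.2 = E.act (s p.1).1 (F.div (s p.1).2 p.2) := by
    intro p hp hpU
    obtain ⟨h1, h2⟩ := hs' p.1 hpU
    refine tw.lift_eq (by rw [E.proj_act, h1, hpr p hp hpU]) ?_
    nth_rewrite 2 [← F.act_div (hpr p hp hpU)]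
    rw [tw.q_act_act h1, h2]
  have hN : {p : T.carrier × F.carrier | T.proj p.1 = F.proj p.2} ∩ Prod.fst ⁻¹' U ∈
      𝓝[{p : T.carrier × F.carrier | T.proj p.1 = F.proj p.2}] (τ, f) :=
    Filter.inter_mem self_mem_nhdsWithin
      (mem_nhdsWithin_of_mem_nhds ((hU.preimage continuous_fst).mem_nhds hτ))
  have hdiv : ContMDiffWithinAt ((totalModel EG).prod (totalModel EG)) 𝓘(ℂ, EG) ω
      (fun p : T.carrier × F.carrier => F.div (s p.1).2 p.2)
      ({p : T.carrier × F.carrier | T.proj p.1 = F.proj p.2} ∩ Prod.fst ⁻¹' U) (τ, f) :=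
    ContMDiffWithinAt.comp (I' := (totalModel EG).prod (totalModel EG))
      (g := fun p : F.carrier × F.carrier => F.div p.1 p.2)
      (f := fun p : T.carrier × F.carrier => ((s p.1).2, p.2)) (τ, f)
      (F.contMDiffOn_div ((s τ).2, f) (hpr (τ, f) hτf hτ))
      (hs2.prodMk contMDiffAt_snd).contMDiffWithinAt (fun p hp => hpr p hp.1 hp.2)
  have hact : ContMDiffWithinAt ((totalModel EG).prod (totalModel EG)) (totalModel EG) ω
      (fun p : T.carrier × F.carrier => E.act (s p.1).1 (F.div (s p.1).2 p.2))
      ({p : T.carrier × F.carrier | T.proj p.1 = F.proj p.2} ∩ Prod.fst ⁻¹' U) (τ, f) :=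
    (E.act_hol ((s τ).1, F.div (s τ).2 f)).comp_contMDiffWithinAt (τ, f)
      (hs1.contMDiffWithinAt.prodMk hdiv)
  refine (hact.mono_of_mem_nhdsWithin hN).congr_of_eventuallyEq ?_ (heq (τ, f) hτf hτ)
  filter_upwards [hN] with p hp
  exact heq p hp.1 hp.2

theorem diffCurve_q {e : ℂ → E.carrier} {f : ℂ → F.carrier} (he : DiffCurve (totalModel EG) e)
    (hf : DiffCurve (totalModel EG) f) (h : ∀ s, E.proj (e s) = F.proj (f s)) :
    DiffCurve (totalModel EG) (fun s => q (e s) (f s)) :=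
  (he.prodMk hf).comp_within (f := fun p : E.carrier × F.carrier => q p.1 p.2)
    ((tw.hol.mdifferentiableOn (by simp)) _ (h 0)) (.of_forall h)

theorem diffCurve_lift {τ : ℂ → T.carrier} {f : ℂ → F.carrier} (hτ : DiffCurve (totalModel EG) τ)
    (hf : DiffCurve (totalModel EG) f) (h : ∀ s, T.proj (τ s) = F.proj (f s)) :
    DiffCurve (totalModel EG) (fun s => tw.lift (τ s) (f s)) :=
  (hτ.prodMk hf).comp_within (f := fun p : T.carrier × F.carrier => tw.lift p.1 p.2)
    ((tw.contMDiffOn_lift.mdifferentiableOn (by simp)) _ (h 0)) (.of_forall h)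

/-- A tangent vector of the twist comes from a pair of curves in the fibre product. -/
theorem exists_curves (V : TangentBundle (totalModel EG) T.carrier) :
    ∃ (e : ℂ → E.carrier) (f : ℂ → F.carrier), DiffCurve (totalModel EG) e ∧
      DiffCurve (totalModel EG) f ∧ (∀ s, E.proj (e s) = F.proj (f s)) ∧
      velocity (totalModel EG) (fun s => q (e s) (f s)) = V := by
  obtain ⟨τ, f, hτ, hf, rfl, h⟩ := F.exists_diffCurve_over
    (T.proj_hol.mdifferentiable (by simp)) V
  refine ⟨_, f, tw.diffCurve_lift hτ hf h, hf, fun s => tw.proj_lift (h s), ?_⟩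
  congr 1; funext s; exact tw.q_lift (h s)

/-- The difference of two connections is invariant under the diagonal action. -/
theorem adMk_eval_sub_eval_eq (D : PrincipalConnection E) (D₀ : PrincipalConnection F)
    {e e' : ℂ → E.carrier} {f f' : ℂ → F.carrier} (he : DiffCurve (totalModel EG) e)
    (hf : DiffCurve (totalModel EG) f) (hf' : DiffCurve (totalModel EG) f')
    (h : ∀ s, E.proj (e s) = F.proj (f s))
    (h' : ∀ᶠ s in 𝓝 0, E.proj (e' s) = F.proj (f' s) ∧ q (e' s) (f' s) = q (e s) (f s)) :
    adMk (f' 0) (D.eval (velocity (totalModel EG) e') - D₀.eval (velocity (totalModel EG) f') : EG)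
      = adMk (f 0) (D.eval (velocity (totalModel EG) e) -
          D₀.eval (velocity (totalModel EG) f) : EG) := by
  have hpr : ∀ᶠ s in 𝓝 0, F.proj (f s) = F.proj (f' s) := by
    filter_upwards [h'] with s hs
    rw [← tw.proj_q _ _ (h s), ← hs.2, tw.proj_q _ _ hs.1]
  have hz : DiffCurve 𝓘(ℂ, EG) (fun s => F.div (f s) (f' s)) :=
    (hf.prodMk hf').comp_within (f := fun p : F.carrier × F.carrier => F.div p.1 p.2)
      ((F.contMDiffOn_div.mdifferentiableOn (by simp)) (f 0, f' 0) hpr.self_of_nhds) hpr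
  have ef : f' =ᶠ[𝓝 0] (fun s => F.act (f s) (F.div (f s) (f' s))) := by
    filter_upwards [hpr] with s hs
    exact (F.act_div hs).symm
  have ee : e' =ᶠ[𝓝 0] (fun s => E.act (e s) (F.div (f s) (f' s))) := by
    filter_upwards [h'] with s hs
    obtain ⟨z, hz, hz'⟩ := (tw.q_eq_iff _ _ _ _ (h s) hs.1).1 hs.2.symm
    rw [hz', F.div_act, hz]
  -- Both connections contribute the same `logDer` term, which cancels. The common `Ad(z(0)⁻¹)` is
  -- undone by `[f z, X] = [f, Ad(z) X]`.
  rw [velocity_congr ef, velocity_congr ee, D.eval_velocity_act he hz, D₀.eval_velocity_act hf hz,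
    ef.eq_of_nhds, AdBundle.adMk_act, ← ef.eq_of_nhds, add_sub_add_right_eq_sub, ← map_sub,
    adjointAction_apply_inv]

end IsTwist

end Twists

/-! ### The connection induced on the twist -/

section TwistConnection

variable {EG : Type w} [NormedAddCommGroup EG] [NormedSpace ℂ EG]
  {G : Type v} [TopologicalSpace G] [ChartedSpace EG G] [Group G] [LieGroup 𝓘(ℂ, EG) ω G]
  {Y : Type x} [TopologicalSpace Y] [ChartedSpace ℂ Y] [IsManifold 𝓘(ℂ, ℂ) ω Y]
  {F E : PrincipalBundle.{u} EG G Y}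

open PrincipalBundle

/-- A connection with the prescribed values on velocities of curves is the twist connection. -/
theorem isTwistConnection_of_curves {D₀ : PrincipalConnection F} {D : PrincipalConnection E}
    {T : AdTorsor F} {q : E.carrier → F.carrier → T.carrier} (tw : IsTwist F E T q)
    {β : AdTorsorConnection D₀ T}
    (h : ∀ (e : ℂ → E.carrier) (f : ℂ → F.carrier), DiffCurve (totalModel EG) e →
      DiffCurve (totalModel EG) f → (∀ s, E.proj (e s) = F.proj (f s)) →
      β.total (velocity (totalModel EG) (fun s => q (e s) (f s))) =
        adMk (f 0) (D.eval (velocity (totalModel EG) e) -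
          D₀.eval (velocity (totalModel EG) f) : EG)) :
    IsTwistConnection D₀ D q β := by
  intro V W hVW
  have : IsManifold (totalModel EG) 1 E.carrier := IsManifold.of_le (n := ω) le_top
  have : IsManifold (totalModel EG) 1 F.carrier := IsManifold.of_le (n := ω) le_top
  obtain ⟨e, f, he, hf, rfl, rfl, hef⟩ := exists_diffCurve_pair
    (E.proj_hol.mdifferentiable (by simp)) (F.proj_hol.mdifferentiable (by simp))
    F.locallyTrivialOver V W hVW
  have hv := velocity_comp_within (f := fun p : E.carrier × F.carrier => q p.1 p.2)
    (he.prodMk hf) ((tw.hol.mdifferentiableOn (by simp)) (e 0, f 0) (hef 0)) (.of_forall hef)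
  have hvv : (velocity ((totalModel EG).prod (totalModel EG)) (fun s => (e s, f s))).2 =
      ((velocity (totalModel EG) e).2, (velocity (totalModel EG) f).2) :=
    velocity_prodMk he hf
  rw [hvv] at hv
  exact (congrArg β.total hv.symm).trans (h e f he hf hef)

theorem IsTwistConnection.total_velocity {D₀ : PrincipalConnection F} {D : PrincipalConnection E}
    {T : AdTorsor F} {q : E.carrier → F.carrier → T.carrier} (tw : IsTwist F E T q)
    {β : AdTorsorConnection D₀ T} (h : IsTwistConnection D₀ D q β)
    {e : ℂ → E.carrier} {f : ℂ → F.carrier} (he : DiffCurve (totalModel EG) e)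
    (hf : DiffCurve (totalModel EG) f) (hef : ∀ s, E.proj (e s) = F.proj (f s)) :
    β.total (velocity (totalModel EG) (fun s => q (e s) (f s))) =
      adMk (f 0) (D.eval (velocity (totalModel EG) e) -
        D₀.eval (velocity (totalModel EG) f) : EG) := by
  have hv := velocity_comp_within (f := fun p : E.carrier × F.carrier => q p.1 p.2)
    (he.prodMk hf) ((tw.hol.mdifferentiableOn (by simp)) (e 0, f 0) (hef 0)) (.of_forall hef)
  have hvv : (velocity ((totalModel EG).prod (totalModel EG)) (fun s => (e s, f s))).2 =
      ((velocity (totalModel EG) e).2, (velocity (totalModel EG) f).2) :=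
    velocity_prodMk he hf
  rw [hvv] at hv
  refine (congrArg β.total hv).trans (h (velocity (totalModel EG) e) (velocity (totalModel EG) f) ?_)
  rw [← velocity_comp he (E.proj_hol.mdifferentiable (by simp) _),
    ← velocity_comp hf (F.proj_hol.mdifferentiable (by simp) _)]
  congr 1; funext s; exact hef s

namespace IsTwist

variable {T : AdTorsor F} {q : E.carrier → F.carrier → T.carrier} (tw : IsTwist F E T q)
  (D₀ : PrincipalConnection F) (D : PrincipalConnection E)

/-- A chosen local section of `E ×_Y F → T` near a point. -/
noncomputable def sectionAt (τ : T.carrier) : T.carrier → E.carrier × F.carrier :=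
  (tw.exists_section τ).choose_spec.choose

/-- The domain of the chosen local section. -/
def sectionDomain (τ : T.carrier) : Set T.carrier := (tw.exists_section τ).choose

theorem isOpen_sectionDomain (τ : T.carrier) : IsOpen (tw.sectionDomain τ) :=
  (tw.exists_section τ).choose_spec.choose_spec.1

theorem mem_sectionDomain (τ : T.carrier) : τ ∈ tw.sectionDomain τ :=
  (tw.exists_section τ).choose_spec.choose_spec.2.1

theorem contMDiffOn_sectionAt_fst (τ : T.carrier) : ContMDiffOn (totalModel EG) (totalModel EG) ω
    (fun τ' => (tw.sectionAt τ τ').1) (tw.sectionDomain τ) :=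
  contMDiff_fst.comp_contMDiffOn (tw.exists_section τ).choose_spec.choose_spec.2.2.1

theorem contMDiffOn_sectionAt_snd (τ : T.carrier) : ContMDiffOn (totalModel EG) (totalModel EG) ω
    (fun τ' => (tw.sectionAt τ τ').2) (tw.sectionDomain τ) :=
  contMDiff_snd.comp_contMDiffOn (tw.exists_section τ).choose_spec.choose_spec.2.2.1

theorem sectionAt_spec {τ τ' : T.carrier} (h : τ' ∈ tw.sectionDomain τ) :
    E.proj (tw.sectionAt τ τ').1 = F.proj (tw.sectionAt τ τ').2 ∧
      q (tw.sectionAt τ τ').1 (tw.sectionAt τ τ').2 = τ' :=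
  (tw.exists_section τ).choose_spec.choose_spec.2.2.2 τ' h

theorem proj_sectionAt_snd {τ τ' : T.carrier} (h : τ' ∈ tw.sectionDomain τ) :
    F.proj (tw.sectionAt τ τ').2 = T.proj τ' := by
  obtain ⟨h1, h2⟩ := tw.sectionAt_spec h
  rw [← tw.proj_q _ _ h1, h2]

/-- The `Lie(G)`-valued form `s^*(D - D₀)`, where `s` is the local section chosen at `τ₀`. -/
noncomputable def diffForm (τ₀ : T.carrier) (V : TangentBundle (totalModel EG) T.carrier) : EG :=
  D.eval (tangentMap (totalModel EG) (totalModel EG) (fun τ' => (tw.sectionAt τ₀ τ').1) V) -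
    D₀.eval (tangentMap (totalModel EG) (totalModel EG) (fun τ' => (tw.sectionAt τ₀ τ').2) V)

/-- The local section and the pair `(e, f)` provide two lifts of the same curve in `T`, so the
invariance under the diagonal action applies. In particular the value is independent of the section.
-/
theorem adMk_diffForm {τ₀ : T.carrier} {e : ℂ → E.carrier} {f : ℂ → F.carrier}
    (he : DiffCurve (totalModel EG) e) (hf : DiffCurve (totalModel EG) f)
    (hef : ∀ s, E.proj (e s) = F.proj (f s)) (h0 : q (e 0) (f 0) ∈ tw.sectionDomain τ₀) :
    adMk (tw.sectionAt τ₀ (q (e 0) (f 0))).2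
      (tw.diffForm D₀ D τ₀ (velocity (totalModel EG) (fun s => q (e s) (f s)))) =
      adMk (f 0) (D.eval (velocity (totalModel EG) e) -
        D₀.eval (velocity (totalModel EG) f) : EG) := by
  have hτ := tw.diffCurve_q he hf hef
  have hN := (tw.isOpen_sectionDomain τ₀).mem_nhds h0
  have h1 := ((tw.contMDiffOn_sectionAt_fst τ₀).contMDiffAt hN).mdifferentiableAt (by simp)
  have h2 := ((tw.contMDiffOn_sectionAt_snd τ₀).contMDiffAt hN).mdifferentiableAt (by simp)
  rw [diffForm, ← velocity_comp hτ h1, ← velocity_comp hτ h2]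
  refine tw.adMk_eval_sub_eval_eq D D₀ (e' := fun s => (tw.sectionAt τ₀ (q (e s) (f s))).1)
    (f' := fun s => (tw.sectionAt τ₀ (q (e s) (f s))).2) he hf (hτ.comp h2) hef ?_
  filter_upwards [hτ.eventually hN] with s hs
  exact tw.sectionAt_spec hs

/-- The `ad(F)`-valued form on the twist induced by the two connections, as a linear map. -/
noncomputable def twistForm (τ : T.carrier) :
    TangentSpace (totalModel EG) τ →L[ℂ] F.ad (T.proj τ) :=
  let D₁ : (ℂ × EG) →L[ℂ] EG := D.form (tw.sectionAt τ τ).1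
  let D₂ : (ℂ × EG) →L[ℂ] EG := D₀.form (tw.sectionAt τ τ).2
  let L : (ℂ × EG) →L[ℂ] (ℂ × EG) :=
    (vderiv 𝓘(ℂ, EG) (totalModel EG) (AdBundle.mk F (tw.sectionAt τ τ).2) 1).comp
      (D₁.comp (vderiv (totalModel EG) (totalModel EG) (fun τ' => (tw.sectionAt τ τ').1) τ) -
        D₂.comp (vderiv (totalModel EG) (totalModel EG) (fun τ' => (tw.sectionAt τ τ').2) τ))
  let p : Submodule ℂ (ℂ × EG) := F.ad (T.proj τ)
  L.codRestrict p
    (fun _ => AdBundle.adMk_mem_ad (tw.proj_sectionAt_snd (tw.mem_sectionDomain τ)) _)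

/-- The form on the twist, as a map of tangent bundles. -/
noncomputable def twistTotal (V : TangentBundle (totalModel EG) T.carrier) :
    TangentBundle (totalModel EG) F.AdBundle :=
  ⟨AdBundle.one F (T.proj V.1), tw.twistForm D₀ D V.1 V.2⟩

theorem twistTotal_eq (V : TangentBundle (totalModel EG) T.carrier) :
    tw.twistTotal D₀ D V = adMk (tw.sectionAt V.1 V.1).2 (tw.diffForm D₀ D V.1 V) :=
  TangentBundle.ext_vec (AdBundle.one_eq (tw.proj_sectionAt_snd (tw.mem_sectionDomain V.1))) rfl

theorem twistTotal_velocity {e : ℂ → E.carrier} {f : ℂ → F.carrier}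
    (he : DiffCurve (totalModel EG) e) (hf : DiffCurve (totalModel EG) f)
    (hef : ∀ s, E.proj (e s) = F.proj (f s)) :
    tw.twistTotal D₀ D (velocity (totalModel EG) (fun s => q (e s) (f s))) =
      adMk (f 0) (D.eval (velocity (totalModel EG) e) -
        D₀.eval (velocity (totalModel EG) f) : EG) :=
  (tw.twistTotal_eq D₀ D _).trans
    (tw.adMk_diffForm D₀ D he hf hef (tw.mem_sectionDomain _))

/-- At each point `twistForm` uses the section chosen at that point, and these choices vary without
regularity. By independence of the section, the one chosen at `V₀` may be used on a whole
neighbourhood. -/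
theorem contMDiff_twistTotal :
    ContMDiff (totalModel EG).tangent (totalModel EG).tangent ω (tw.twistTotal D₀ D) := by
  intro V₀
  have h1 := (tw.contMDiffOn_sectionAt_fst V₀.1).contMDiffAt_tangentMap
    (tw.isOpen_sectionDomain V₀.1) (tw.mem_sectionDomain V₀.1)
  have h2 := (tw.contMDiffOn_sectionAt_snd V₀.1).contMDiffAt_tangentMap
    (tw.isOpen_sectionDomain V₀.1) (tw.mem_sectionDomain V₀.1)
  have h3 : ContMDiffAt (totalModel EG).tangent 𝓘(ℂ, EG) ω (tw.diffForm D₀ D V₀.1) V₀ :=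
    (D.contMDiff_eval.contMDiffAt.comp V₀ h1).sub (D₀.contMDiff_eval.contMDiffAt.comp V₀ h2)
  have hp : ContMDiff (totalModel EG).tangent (totalModel EG) ω
      (fun V : TangentBundle (totalModel EG) T.carrier => V.1) :=
    Bundle.contMDiff_proj (TangentSpace (totalModel EG) (M := T.carrier))
  have h4 : ContMDiffAt (totalModel EG).tangent (totalModel EG) ω
      (fun V : TangentBundle (totalModel EG) T.carrier => (tw.sectionAt V₀.1 V.1).2) V₀ :=
    ((tw.contMDiffOn_sectionAt_snd V₀.1).contMDiffAt ((tw.isOpen_sectionDomain V₀.1).mem_nhds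
      (tw.mem_sectionDomain V₀.1))).comp V₀ hp.contMDiffAt
  refine ((AdBundle.contMDiff_adMk F).contMDiffAt.comp V₀ (h4.prodMk h3)).congr_of_eventuallyEq ?_
  have hN : Bundle.TotalSpace.proj ⁻¹' tw.sectionDomain V₀.1 ∈ 𝓝 V₀ :=
    hp.continuous.continuousAt.preimage_mem_nhds
      ((tw.isOpen_sectionDomain V₀.1).mem_nhds (tw.mem_sectionDomain V₀.1))
  filter_upwards [hN] with V hV
  obtain ⟨e, f, he, hf, hef, rfl⟩ := tw.exists_curves V
  exact (tw.twistTotal_velocity D₀ D he hf hef).trans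
    (tw.adMk_diffForm D₀ D he hf hef hV).symm

/-- The connection on the twist induced by the two connections. -/
noncomputable def twistConnection : AdTorsorConnection D₀ T where
  form := tw.twistForm D₀ D
  form_hol := tw.contMDiff_twistTotal D₀ D
  form_vertical := by
    intro τ ξ
    obtain ⟨f, hf⟩ := F.proj_surjective (T.proj τ)
    have hτf : T.proj τ = F.proj f := hf.symm
    obtain ⟨X, hX⟩ := AdBundle.exists_adMk_eq (F := F) (f := f)
      (W := ⟨AdBundle.one F (T.proj τ), ξ.1⟩) (AdBundle.one_eq hf) ξ.2
    obtain ⟨z, hz, h0, -, rfl⟩ := exists_logDer_eq EG (G := G) X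
    have hc := (DiffCurve.const (I := totalModel EG) f).adBundleMk hz
    let S : Set F.AdBundle := {γ | AdBundle.proj F γ = T.proj τ}
    have hd : MDifferentiableWithinAt (totalModel EG) (totalModel EG) (fun γ => T.act τ γ) S
        (AdBundle.mk F f (z 0)) := by
      have h2 := (T.act_hol.mdifferentiableOn (by simp)) (τ, AdBundle.mk F f (z 0)) hτf
      exact MDifferentiableWithinAt.comp (I' := (totalModel EG).prod (totalModel EG)) (s := S)
        (f := fun γ => (τ, γ)) (AdBundle.mk F f (z 0)) h2
        (mdifferentiableWithinAt_const.prodMk mdifferentiableWithinAt_id) (fun γ hγ => hγ.symm)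
    have hvel := velocity_comp_within' hc hd (.of_forall fun s => hf)
      ((AdBundle.velocity_mk hz h0 f).trans hX.symm)
    refine Eq.trans ?_ hX.symm
    refine (congrArg (tw.twistTotal D₀ D) hvel.symm).trans ?_
    have hpr := tw.proj_lift hτf
    -- A vertical curve in `T` lifts to a vertical curve in `E` with `f` fixed, where `D` reproduces
    -- the generator and `D₀` vanishes.
    have hcurve : (fun s => T.act τ (AdBundle.mk F f (z s))) =
        fun s => q (E.act (tw.lift τ f) (z s)) f := by
      funext s
      rw [← tw.q_act _ _ _ hpr, tw.q_lift hτf]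
    rw [hcurve, tw.twistTotal_velocity D₀ D ((DiffCurve.const _).act hz) (DiffCurve.const f)
      (fun s => (E.proj_act _ _).trans hpr), D.eval_velocity_act_one hz h0, velocity_const,
      D₀.eval_zero, sub_zero]
  form_act := by
    rintro V _ hVW hV ⟨g, U, hU, rfl⟩
    have hVU : tangentMap (totalModel EG) 𝓘(ℂ, ℂ) T.proj V =
        tangentMap (totalModel EG) 𝓘(ℂ, ℂ) F.proj U := by
      rw [hVW, ← tangentMap_comp_at U ((AdBundle.contMDiff_proj F).mdifferentiable (by simp) _)
        ((AdBundle.contMDiff_mk_left g).mdifferentiable (by simp) _)]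
      rfl
    have : IsManifold (totalModel EG) 1 T.carrier := IsManifold.of_le (n := ω) le_top
    have : IsManifold (totalModel EG) 1 F.carrier := IsManifold.of_le (n := ω) le_top
    obtain ⟨τ, f, hτ, hf, rfl, rfl, h⟩ := exists_diffCurve_pair
      (T.proj_hol.mdifferentiable (by simp)) (F.proj_hol.mdifferentiable (by simp))
      F.locallyTrivialOver V U hVU
    have he := tw.diffCurve_lift hτ hf h
    have hpr : ∀ s, E.proj (tw.lift (τ s) (f s)) = F.proj (f s) := fun s => tw.proj_lift (h s)
    have hm : DiffCurve (totalModel EG) (fun s => AdBundle.mk F (f s) g) :=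
      hf.adBundleMk (DiffCurve.const g)
    have hvm := velocity_comp hf
      ((AdBundle.contMDiff_mk_left (F := F) g).mdifferentiable (by simp) (f 0))
    have hτq : τ = fun s => q (tw.lift (τ s) (f s)) (f s) := funext fun s => (tw.q_lift (h s)).symm
    have hD₀ : D₀.eval (velocity (totalModel EG) f) = 0 := hU
    -- Since `β` and `D₀` vanish on the two velocities, `[f, D e'] = 0`, and `X ↦ [f, X]` is
    -- injective.
    have hD : D.eval (velocity (totalModel EG) (fun s => tw.lift (τ s) (f s))) = 0 := by
      have h1 := tw.twistTotal_velocity D₀ D he hf hpr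
      rw [← hτq, hD₀, sub_zero] at h1
      refine AdBundle.adMk_injective (f 0) ?_
      refine h1.symm.trans (TangentBundle.ext_vec (AdBundle.one_eq (h 0).symm) ?_)
      exact (congrArg Subtype.val hV).trans (AdBundle.adMk_zero_vec (f 0)).symm
    have hv := velocity_comp_within (f := fun p : T.carrier × F.AdBundle => T.act p.1 p.2)
      (hτ.prodMk hm) ((T.act_hol.mdifferentiableOn (by simp)) (τ 0, AdBundle.mk F (f 0) g) (h 0))
      (.of_forall h)
    have hvv : (velocity ((totalModel EG).prod (totalModel EG))
        (fun s => (τ s, AdBundle.mk F (f s) g))).2 =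
        ((velocity (totalModel EG) τ).2,
          (velocity (totalModel EG) (fun s => AdBundle.mk F (f s) g)).2) :=
      velocity_prodMk hτ hm
    rw [hvv] at hv
    -- Acting by `[f, g]` replaces the lift `e` by `e g`, which remains horizontal by equivariance
    -- of `D`.
    have hcurve : (fun s => T.act (τ s) (AdBundle.mk F (f s) g)) =
        fun s => q (E.act (tw.lift (τ s) (f s)) g) (f s) := by
      funext s
      rw [← tw.q_act _ _ _ (hpr s), tw.q_lift (h s)]
    have h2 := tw.twistTotal_velocity D₀ D (he.act (DiffCurve.const g)) hf
      (fun s => (E.proj_act _ _).trans (hpr s))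
    rw [D.eval_velocity_act he (DiffCurve.const g), hD, hD₀, logDer_const, map_zero, add_zero,
      sub_zero, ← hcurve] at h2
    refine Subtype.ext ?_
    have h3 := congrArg TangentBundle.vec ((congrArg (tw.twistTotal D₀ D) hv).symm.trans h2)
    rw [AdBundle.adMk_zero_vec] at h3
    rw [← hvm]
    exact h3

theorem isTwistConnection_twistConnection :
    IsTwistConnection D₀ D q (tw.twistConnection D₀ D) :=
  isTwistConnection_of_curves tw fun _ _ he hf hef => tw.twistTotal_velocity D₀ D he hf hef

end IsTwist

end TwistConnection

/-! ### From a connection on the twist to one on the principal bundle -/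

section UntwistConnection

variable {EG : Type w} [NormedAddCommGroup EG] [NormedSpace ℂ EG]
  {G : Type v} [TopologicalSpace G] [ChartedSpace EG G] [Group G] [LieGroup 𝓘(ℂ, EG) ω G]
  {Y : Type x} [TopologicalSpace Y] [ChartedSpace ℂ Y] [IsManifold 𝓘(ℂ, ℂ) ω Y]
  {F E : PrincipalBundle.{u} EG G Y}

open PrincipalBundle

theorem contMDiffOn_section_proj {t : Bundle.Trivialization G F.proj} (ht : F.IsTriv t) :
    ContMDiffOn (totalModel EG) (totalModel EG) ω
      (fun e : E.carrier => F.trivSection t (E.proj e)) (E.proj ⁻¹' t.baseSet) :=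
  (F.contMDiffOn_trivSection ht).comp E.proj_hol.contMDiffOn (fun _ h => h)

namespace IsTwist

variable {T : AdTorsor F} {q : E.carrier → F.carrier → T.carrier} (tw : IsTwist F E T q)
  {D₀ : PrincipalConnection F} (β : AdTorsorConnection D₀ T)

include tw

theorem contMDiffOn_q_section {t : Bundle.Trivialization G F.proj} (ht : F.IsTriv t) :
    ContMDiffOn (totalModel EG) (totalModel EG) ω
      (fun e => q e (F.trivSection t (E.proj e))) (E.proj ⁻¹' t.baseSet) :=
  ContMDiffOn.comp (I' := (totalModel EG).prod (totalModel EG))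
    (g := fun p : E.carrier × F.carrier => q p.1 p.2)
    (f := fun e => (e, F.trivSection t (E.proj e))) tw.hol
    (contMDiffOn_id.prodMk ((F.contMDiffOn_trivSection ht).comp E.proj_hol.contMDiffOn
      (fun _ h => h))) (fun _ he => (F.proj_trivSection he).symm)

end IsTwist

/-- The form on `E` defined by a connection on the twist of `E` and a local trivialization
of `F`. -/
noncomputable def untwistEval {T : AdTorsor F} (q : E.carrier → F.carrier → T.carrier)
    {D₀ : PrincipalConnection F} (β : AdTorsorConnection D₀ T)
    (t : Bundle.Trivialization G F.proj) (V : TangentBundle (totalModel EG) E.carrier) : EG :=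
  (tangentMap (totalModel EG) 𝓘(ℂ, EG)
    (fun γ => AdBundle.coord (F.trivSection t (AdBundle.proj F γ)) γ)
    (β.total (tangentMap (totalModel EG) (totalModel EG)
      (fun e => q e (F.trivSection t (E.proj e))) V))).vec +
  D₀.eval (tangentMap (totalModel EG) (totalModel EG) (fun e => F.trivSection t (E.proj e)) V)

/-- The form on `E` defined by a connection on the twist of `E`, as a linear map. -/
noncomputable def untwistForm {T : AdTorsor F} (q : E.carrier → F.carrier → T.carrier)
    {D₀ : PrincipalConnection F} (β : AdTorsorConnection D₀ T) (e : E.carrier) :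
    TangentSpace (totalModel EG) e →L[ℂ] GroupLieAlgebra 𝓘(ℂ, EG) G :=
  let t := AdBundle.trivAt F (E.proj e)
  let m : E.carrier → T.carrier := fun e => q e (F.trivSection t (E.proj e))
  let p : Submodule ℂ (ℂ × EG) := F.ad (T.proj (m e))
  let B : (ℂ × EG) →L[ℂ] p := β.form (m e)
  let C : (ℂ × EG) →L[ℂ] EG := D₀.form (F.trivSection t (E.proj e))
  let L : (ℂ × EG) →L[ℂ] EG :=
    (vderiv (totalModel EG) 𝓘(ℂ, EG)
        (fun γ => AdBundle.coord (F.trivSection t (AdBundle.proj F γ)) γ)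
        (AdBundle.one F (T.proj (m e)))).comp
      (p.subtypeL.comp (B.comp (vderiv (totalModel EG) (totalModel EG) m e))) +
    C.comp (vderiv (totalModel EG) (totalModel EG) (fun e => F.trivSection t (E.proj e)) e)
  L

namespace IsTwist

variable {T : AdTorsor F} {q : E.carrier → F.carrier → T.carrier} (tw : IsTwist F E T q)
  {D₀ : PrincipalConnection F} (β : AdTorsorConnection D₀ T)

include tw

/-- This relation characterizes the form on `E`, and it holds for every lift `f`, not only for the
section `σ` of the trivialization. For `f = σ(π e)` it is the definition. In general `f = σ(π e) z`,
the point of the twist is multiplied by `[σ(π e), z⁻¹]`, and `total_velocity_act_mk` gives the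
effect on `β`. -/
theorem adMk_untwistEval {t : Bundle.Trivialization G F.proj} (ht : F.IsTriv t)
    {e : ℂ → E.carrier} {f : ℂ → F.carrier} (he : DiffCurve (totalModel EG) e)
    (hf : DiffCurve (totalModel EG) f) (hef : ∀ s, E.proj (e s) = F.proj (f s))
    (h0 : E.proj (e 0) ∈ t.baseSet) :
    adMk (f 0) (untwistEval q β t (velocity (totalModel EG) e) -
        D₀.eval (velocity (totalModel EG) f) : EG) =
      β.total (velocity (totalModel EG) (fun s => q (e s) (f s))) := by
  -- Only germs at `0` enter, so the curve may be assumed to stay where the section of `F` is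
  -- defined.
  wlog hall : ∀ s, E.proj (e s) ∈ t.baseSet generalizing e f
  · have hN : E.proj ⁻¹' t.baseSet ∈ 𝓝 (e 0) :=
      (t.open_baseSet.preimage E.proj_hol.continuous).mem_nhds h0
    obtain ⟨κ, hκ, hP⟩ := exists_reparam (he.eventually hN)
    have e1 : (fun s => e (κ s)) =ᶠ[𝓝 0] e := by
      filter_upwards [hκ] with s hs; rw [hs]; rfl
    have e2 : (fun s => f (κ s)) =ᶠ[𝓝 0] f := by
      filter_upwards [hκ] with s hs; rw [hs]; rfl
    have e3 : (fun s => q (e (κ s)) (f (κ s))) =ᶠ[𝓝 0] (fun s => q (e s) (f s)) := by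
      filter_upwards [hκ] with s hs; rw [hs]; rfl
    have := this (he.congr e1) (hf.congr e2) (fun s => hef (κ s)) (hP 0) hP
    rwa [velocity_congr e1, velocity_congr e2, velocity_congr e3, e2.eq_of_nhds] at this
  have hopen : IsOpen (E.proj ⁻¹' t.baseSet) := t.open_baseSet.preimage E.proj_hol.continuous
  have hN := hopen.mem_nhds h0
  have hdm := ((tw.contMDiffOn_q_section ht).contMDiffAt hN).mdifferentiableAt (by simp)
  have hdσ := ((contMDiffOn_section_proj (E := E) ht).contMDiffAt hN).mdifferentiableAt (by simp)
  let f' : ℂ → F.carrier := fun s => F.trivSection t (E.proj (e s))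
  have hf' : DiffCurve (totalModel EG) f' := he.comp hdσ
  have hef' : ∀ s, E.proj (e s) = F.proj (f' s) := fun s => (F.proj_trivSection (hall s)).symm
  have hff : ∀ s, F.proj (f' s) = F.proj (f s) := fun s => (hef' s).symm.trans (hef s)
  have hτ' : DiffCurve (totalModel EG) (fun s => q (e s) (f' s)) := tw.diffCurve_q he hf' hef'
  have hpτ : ∀ s, T.proj (q (e s) (f' s)) = F.proj (f' s) := fun s => tw.proj_q _ _ (hef' s)
  obtain ⟨X, hX⟩ := β.exists_total_eq (V := velocity (totalModel EG) (fun s => q (e s) (f' s)))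
    (hpτ 0)
  have hev : untwistEval q β t (velocity (totalModel EG) e) =
      X + D₀.eval (velocity (totalModel EG) f') := by
    rw [untwistEval, ← velocity_comp he hdm, ← velocity_comp he hdσ]
    change (tangentMap _ _ _ (β.total (velocity (totalModel EG) (fun s => q (e s) (f' s))))).vec +
      D₀.eval (velocity (totalModel EG) f') = _
    rw [hX]
    congr 1
    exact congrArg TangentBundle.vec (AdBundle.tangentMap_coord_section t.open_baseSet
      (F.contMDiffOn_trivSection ht) (fun y hy => F.proj_trivSection hy) h0 X)
  have hz : DiffCurve 𝓘(ℂ, EG) (fun s => F.div (f' s) (f s)) :=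
    (hf'.prodMk hf).comp_within (f := fun p : F.carrier × F.carrier => F.div p.1 p.2)
      ((F.contMDiffOn_div.mdifferentiableOn (by simp)) (f' 0, f 0) (hff 0)) (.of_forall hff)
  have ef : f = fun s => F.act (f' s) (F.div (f' s) (f s)) := funext fun s => (F.act_div (hff s)).symm
  have eq' : (fun s => q (e s) (f s)) =
      fun s => T.act (q (e s) (f' s)) (AdBundle.mk F (f' s) (F.div (f' s) (f s))⁻¹) := by
    funext s
    rw [← tw.q_act_right (hef' s), F.act_div (hff s)]
  have hvf : D₀.eval (velocity (totalModel EG) f) = adjointAction EG (F.div (f' 0) (f 0))⁻¹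
      (D₀.eval (velocity (totalModel EG) f')) + logDer EG (fun s => F.div (f' s) (f s)) := by
    rw [← D₀.eval_velocity_act hf' hz, ← ef]
  -- With `f = f' z`, both sides become `[f', Ad(z) (X + D₀ v) - Ad(z) (logDer z) - D₀ v]`, where
  -- `v` is the velocity of `f'`.
  rw [hev, eq', β.total_velocity_act_mk hτ' hf' hz.inv hpτ hX, logDer_inv hz, hvf, inv_inv]
  conv_lhs => rw [← F.act_div (hff 0)]
  have hadj : adjointAction EG (F.div (f' 0) (f 0)) (adjointAction EG (F.div (f' 0) (f 0))⁻¹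
      (D₀.eval (velocity (totalModel EG) f')) + logDer EG (fun s => F.div (f' s) (f s))) =
      D₀.eval (velocity (totalModel EG) f') + adjointAction EG (F.div (f' 0) (f 0))
        (logDer EG (fun s => F.div (f' s) (f s))) := by
    rw [map_add, adjointAction_apply_inv]
  rw [AdBundle.adMk_act, F.div_act, map_sub, hadj]
  congr 1
  abel

/-- Both values satisfy the relation of `adMk_untwistEval` for one and the same lift `f`, and `X ↦
[f, X]` is injective. -/
theorem untwistEval_congr {t t' : Bundle.Trivialization G F.proj} (ht : F.IsTriv t)
    (ht' : F.IsTriv t') {V : TangentBundle (totalModel EG) E.carrier}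
    (hV : E.proj V.1 ∈ t.baseSet) (hV' : E.proj V.1 ∈ t'.baseSet) :
    untwistEval q β t V = untwistEval q β t' V := by
  obtain ⟨e, f, he, hf, rfl, hef⟩ := F.exists_diffCurve_over
    (E.proj_hol.mdifferentiable (by simp)) V
  exact sub_left_injective (AdBundle.adMk_injective (f 0)
    ((tw.adMk_untwistEval β ht he hf hef hV).trans (tw.adMk_untwistEval β ht' he hf hef hV').symm))

theorem contMDiffAt_untwistEval {t : Bundle.Trivialization G F.proj} (ht : F.IsTriv t)
    {V₀ : TangentBundle (totalModel EG) E.carrier} (hV : E.proj V₀.1 ∈ t.baseSet) :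
    ContMDiffAt (totalModel EG).tangent 𝓘(ℂ, EG) ω (untwistEval q β t) V₀ := by
  have : IsManifold 𝓘(ℂ, EG) ω G := ContMDiffMul.toIsManifold
  have hopen : IsOpen (E.proj ⁻¹' t.baseSet) := t.open_baseSet.preimage E.proj_hol.continuous
  have h1 := (tw.contMDiffOn_q_section ht).contMDiffAt_tangentMap hopen hV
  have h2 := (contMDiffOn_section_proj (E := E) ht).contMDiffAt_tangentMap hopen hV
  have hp : ContMDiff (totalModel EG).tangent (totalModel EG) ω
      (fun V : TangentBundle (totalModel EG) E.carrier => V.1) :=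
    Bundle.contMDiff_proj (TangentSpace (totalModel EG) (M := E.carrier))
  have hbase : ∀ e : E.carrier, E.proj e ∈ t.baseSet →
      T.proj (q e (F.trivSection t (E.proj e))) = E.proj e := fun e he => by
    rw [tw.proj_q _ _ (F.proj_trivSection he).symm, F.proj_trivSection he]
  have h3 := (AdBundle.contMDiffOn_coord_section (F.contMDiffOn_trivSection ht)
    (fun y (hy : y ∈ t.baseSet) => F.proj_trivSection hy)).contMDiffAt_tangentMap
    (t.open_baseSet.preimage AdBundle.continuous_proj)
    (V := β.total (tangentMap (totalModel EG) (totalModel EG)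
      (fun e => q e (F.trivSection t (E.proj e))) V₀)) (by
        change AdBundle.proj F (AdBundle.one F (T.proj (q V₀.1 (F.trivSection t (E.proj V₀.1))))) ∈
          t.baseSet
        rw [AdBundle.proj_one, hbase _ hV]; exact hV)
  have h4 := h3.comp V₀ (β.form_hol.contMDiffAt.comp V₀ h1)
  refine ContMDiffAt.add (contMDiffAt_tangentBundle_const_iff (I' := 𝓘(ℂ, EG)) (a := (1 : G)).1 ?_)
    (D₀.contMDiff_eval.contMDiffAt.comp V₀ h2)
  refine h4.congr_of_eventuallyEq ?_
  filter_upwards [hp.continuous.continuousAt.preimage_mem_nhds (hopen.mem_nhds hV)] with V hV'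
  -- The base points are the units `[σ(y), 1]`, where `coord` is constantly `1`; the vector
  -- component thus lies in the fixed space `T_1 G`.
  refine TangentBundle.ext_vec ?_ rfl
  change 1 = AdBundle.coord (F.trivSection t (AdBundle.proj F (AdBundle.one F
    (T.proj (q V.1 (F.trivSection t (E.proj V.1))))))) (AdBundle.one F
    (T.proj (q V.1 (F.trivSection t (E.proj V.1)))))
  rw [AdBundle.proj_one, hbase _ hV', AdBundle.one_eq (F.proj_trivSection hV'), AdBundle.coord_mk]

theorem adMk_untwistForm {e : ℂ → E.carrier} {f : ℂ → F.carrier}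
    (he : DiffCurve (totalModel EG) e) (hf : DiffCurve (totalModel EG) f)
    (hef : ∀ s, E.proj (e s) = F.proj (f s)) :
    adMk (f 0) (untwistEval q β (AdBundle.trivAt F (E.proj (e 0))) (velocity (totalModel EG) e) -
        D₀.eval (velocity (totalModel EG) f) : EG) =
      β.total (velocity (totalModel EG) (fun s => q (e s) (f s))) :=
  tw.adMk_untwistEval β (AdBundle.isTriv_trivAt _) he hf hef (AdBundle.mem_trivAt _)

/-- The connection on `E` induced by a connection on the twist of `E`. -/
noncomputable def untwistConnection : PrincipalConnection E where
  form := untwistForm q β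
  form_hol := by
    have : IsManifold 𝓘(ℂ, EG) ω G := ContMDiffMul.toIsManifold
    refine contMDiff_tangentBundle_const_iff.2 fun V₀ => ?_
    have ht := AdBundle.isTriv_trivAt (F := F) (E.proj V₀.1)
    have hV := AdBundle.mem_trivAt (F := F) (E.proj V₀.1)
    -- The trivialization attached to each point may be replaced near `V₀` by the one attached to
    -- `V₀`.
    refine (tw.contMDiffAt_untwistEval β ht hV).congr_of_eventuallyEq ?_
    have hp : ContMDiff (totalModel EG).tangent (totalModel EG) ω
        (fun V : TangentBundle (totalModel EG) E.carrier => V.1) :=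
      Bundle.contMDiff_proj (TangentSpace (totalModel EG) (M := E.carrier))
    filter_upwards [hp.continuous.continuousAt.preimage_mem_nhds
      (((AdBundle.trivAt F (E.proj V₀.1)).open_baseSet.preimage
        E.proj_hol.continuous).mem_nhds hV)] with V hV'
    exact tw.untwistEval_congr β (AdBundle.isTriv_trivAt _) ht (AdBundle.mem_trivAt _) hV'
  form_vertical := by
    intro e X
    obtain ⟨z, hz, h0, hv, rfl⟩ := exists_logDer_eq EG (G := G) X
    obtain ⟨f, hf⟩ := F.proj_surjective (E.proj e)
    have hvel := velocity_comp hz ((E.contMDiff_act_left e).mdifferentiable (by simp) _)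
    rw [hv] at hvel
    have key := tw.adMk_untwistForm β ((DiffCurve.const e).act hz) (DiffCurve.const f)
      (fun s => (E.proj_act _ _).trans hf.symm)
    have hcurve : (fun s => q (E.act e (z s)) f) =
        fun s => T.act (q e f) (AdBundle.mk F f (z s)) :=
      funext fun s => (tw.q_act _ _ _ hf.symm).symm
    rw [hcurve, β.total_velocity_act_mk_one (tw.proj_q _ _ hf.symm) hz h0, velocity_const,
      D₀.eval_zero, sub_zero, hvel, h0] at key
    exact AdBundle.adMk_injective f key
  form_act := by
    intro e g v
    obtain ⟨c, f, hc, hf, hv, hcf⟩ := F.exists_diffCurve_over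
      (E.proj_hol.mdifferentiable (by simp)) (⟨e, v⟩ : TangentBundle (totalModel EG) E.carrier)
    have h1 := tw.adMk_untwistForm β hc hf hcf
    have h2 := tw.adMk_untwistForm β (hc.act (DiffCurve.const g)) (hf.act (DiffCurve.const g))
      (fun s => by rw [E.proj_act, F.proj_act, hcf s])
    -- The pairs `(c, f)` and `(c g, f g)` define the same curve in the twist. Comparing the
    -- relations for both gives the equivariance.
    have hcurve : (fun s => q (E.act (c s) g) (F.act (f s) g)) = fun s => q (c s) (f s) :=
      funext fun s => tw.q_act_act (hcf s) g
    have hvel := velocity_comp hc ((E.contMDiff_act_right g).mdifferentiable (by simp) _)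
    rw [hcurve, ← h1, D₀.eval_velocity_act hf (DiffCurve.const g), logDer_const, add_zero,
      AdBundle.adMk_act, hvel, hv, map_sub, adjointAction_apply_inv,
      show c 0 = e from congrArg Bundle.TotalSpace.proj hv] at h2
    have h3 : adjointAction EG g _ = untwistForm q β e v :=
      sub_left_inj.1 (AdBundle.adMk_injective (f 0) h2)
    refine TangentBundle.ext_vec (by simp) ?_
    rw [tangentMap_vec]
    change _ = vderiv 𝓘(ℂ, EG) 𝓘(ℂ, EG) (fun h : G => g⁻¹ * h * g) 1 (untwistForm q β e v)
    rw [← h3]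
    have h4 := adjointAction_inv_apply (EG := EG) g
    simp only [adjointAction, inv_inv] at h4 ⊢
    exact (h4 _).symm

theorem isTwistConnection_untwistConnection :
    IsTwistConnection D₀ (tw.untwistConnection β) q β :=
  isTwistConnection_of_curves tw fun _ _ he hf hef => (tw.adMk_untwistForm β he hf hef).symm

end IsTwist

end UntwistConnection

/-! ### Morphisms of bundles and of their twists -/

section Morphisms

variable {EG : Type w} [NormedAddCommGroup EG] [NormedSpace ℂ EG]
  {G : Type v} [TopologicalSpace G] [ChartedSpace EG G] [Group G] [LieGroup 𝓘(ℂ, EG) ω G]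
  {Y : Type x} [TopologicalSpace Y] [ChartedSpace ℂ Y] [IsManifold 𝓘(ℂ, ℂ) ω Y]
  {F : PrincipalBundle.{u} EG G Y} {D₀ : PrincipalConnection F}

open PrincipalBundle

theorem PrincipalBundleWithConnection.Hom.eval_velocity
    {X X' : PrincipalBundleWithConnection.{u} EG G Y} (h : Hom X X') {e : ℂ → X.bundle.carrier}
    (he : DiffCurve (totalModel EG) e) :
    X'.conn.eval (velocity (totalModel EG) (fun s => h.map (e s))) =
      X.conn.eval (velocity (totalModel EG) e) := by
  rw [velocity_comp he (h.map_hol.mdifferentiable (by simp) _)]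
  exact h.map_conn _ _

/-- A morphism of principal bundles with connection induces one of the twists. -/
theorem exists_twistMap {X X' : PrincipalBundleWithConnection.{u} EG G Y}
    {T T' : AdTorsorWithConnection F D₀} {q : X.bundle.carrier → F.carrier → T.torsor.carrier}
    {q' : X'.bundle.carrier → F.carrier → T'.torsor.carrier}
    (tw : IsTwist F X.bundle T.torsor q) (tw' : IsTwist F X'.bundle T'.torsor q')
    (tc : IsTwistConnection D₀ X.conn q T.conn) (tc' : IsTwistConnection D₀ X'.conn q' T'.conn)
    (h : PrincipalBundleWithConnection.Hom X X') :
    ∃ k : AdTorsorWithConnection.Hom T T', ∀ e f, X.bundle.proj e = F.proj f →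
      k.map (q e f) = q' (h.map e) f := by
  -- The map is defined by a chosen representative of `τ`; `map_q` shows that every representative
  -- gives the same value.
  let map : T.torsor.carrier → T'.torsor.carrier := fun τ =>
    q' (h.map (tw.sectionAt τ τ).1) (tw.sectionAt τ τ).2
  have map_q : ∀ e f, X.bundle.proj e = F.proj f → map (q e f) = q' (h.map e) f := by
    intro e f hef
    obtain ⟨h1, h2⟩ := tw.sectionAt_spec (tw.mem_sectionDomain (q e f))
    obtain ⟨z, hz, hz'⟩ := (tw.q_eq_iff _ _ _ _ hef h1).1 h2.symm
    change q' (h.map (tw.sectionAt (q e f) (q e f)).1) (tw.sectionAt (q e f) (q e f)).2 = _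
    rw [hz, hz', h.map_act, tw'.q_act_act ((h.proj_map e).trans hef)]
  have hol : ContMDiff (totalModel EG) (totalModel EG) ω map := by
    intro τ₀
    have h1 := (tw.contMDiffOn_sectionAt_fst τ₀)
    have h2 := (tw.contMDiffOn_sectionAt_snd τ₀)
    have h3 : ContMDiffOn (totalModel EG) (totalModel EG) ω
        (fun τ => q' (h.map (tw.sectionAt τ₀ τ).1) (tw.sectionAt τ₀ τ).2) (tw.sectionDomain τ₀) :=
      ContMDiffOn.comp (I' := (totalModel EG).prod (totalModel EG))
        (g := fun p : X'.bundle.carrier × F.carrier => q' p.1 p.2)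
        (f := fun τ => (h.map (tw.sectionAt τ₀ τ).1, (tw.sectionAt τ₀ τ).2)) tw'.hol
        ((h.map_hol.comp_contMDiffOn h1).prodMk h2)
        (fun τ hτ => (h.proj_map _).trans (tw.sectionAt_spec hτ).1)
    have hN := (tw.isOpen_sectionDomain τ₀).mem_nhds (tw.mem_sectionDomain τ₀)
    refine (h3.contMDiffAt hN).congr_of_eventuallyEq ?_
    filter_upwards [hN] with τ hτ
    obtain ⟨h4, h5⟩ := tw.sectionAt_spec hτ
    rw [← map_q _ _ h4, h5]
  have rep : ∀ τ, ∃ e f, X.bundle.proj e = F.proj f ∧ q e f = τ := fun τ =>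
    ⟨_, _, tw.sectionAt_spec (tw.mem_sectionDomain τ)⟩
  refine ⟨⟨map, hol, ?_, ?_, ?_⟩, map_q⟩
  · intro τ
    obtain ⟨e, f, hef, rfl⟩ := rep τ
    rw [map_q e f hef, tw'.proj_q _ _ ((h.proj_map e).trans hef), tw.proj_q _ _ hef]
  · intro τ γ hγ
    obtain ⟨e, f, hef, rfl⟩ := rep τ
    rw [tw.proj_q _ _ hef] at hγ
    rw [← AdBundle.mk_coord hγ, tw.q_act _ _ _ hef, map_q e f hef,
      map_q _ f ((X.bundle.proj_act _ _).trans hef), h.map_act,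
      tw'.q_act _ _ _ ((h.proj_map e).trans hef)]
  · intro V
    obtain ⟨e, f, he, hf, hef, rfl⟩ := tw.exists_curves V
    rw [← velocity_comp (tw.diffCurve_q he hf hef) (hol.mdifferentiable (by simp) _)]
    have he' : DiffCurve (totalModel EG) (fun s => h.map (e s)) :=
      he.comp (h.map_hol.mdifferentiable (by simp) _)
    have hcurve : (fun s => map (q (e s) (f s))) = fun s => q' (h.map (e s)) (f s) :=
      funext fun s => map_q _ _ (hef s)
    rw [hcurve, tc'.total_velocity tw' he' hf (fun s => (h.proj_map _).trans (hef s)),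
      tc.total_velocity tw he hf hef, h.eval_velocity he]

/-- A morphism of the twists is induced by a morphism of principal bundles with connection. -/
theorem exists_untwistMap {X X' : PrincipalBundleWithConnection.{u} EG G Y}
    {T T' : AdTorsorWithConnection F D₀} {q : X.bundle.carrier → F.carrier → T.torsor.carrier}
    {q' : X'.bundle.carrier → F.carrier → T'.torsor.carrier}
    (tw : IsTwist F X.bundle T.torsor q) (tw' : IsTwist F X'.bundle T'.torsor q')
    (tc : IsTwistConnection D₀ X.conn q T.conn) (tc' : IsTwistConnection D₀ X'.conn q' T'.conn)
    (k : AdTorsorWithConnection.Hom T T') :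
    ∃ h : PrincipalBundleWithConnection.Hom X X', ∀ e f, X.bundle.proj e = F.proj f →
      k.map (q e f) = q' (h.map e) f := by
  let pt : X.bundle.carrier → F.carrier := fun e => (F.proj_surjective (X.bundle.proj e)).choose
  have hpt : ∀ e, X.bundle.proj e = F.proj (pt e) := fun e =>
    (F.proj_surjective (X.bundle.proj e)).choose_spec.symm
  -- `map e` solves `q'(map e, f) = k (q(e, f))` for a chosen `f`. Equivariance of `k` makes the
  -- solution valid for every `f` in the fibre.
  let map : X.bundle.carrier → X'.bundle.carrier := fun e => tw'.lift (k.map (q e (pt e))) (pt e)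
  have hkp : ∀ e f, X.bundle.proj e = F.proj f → T'.torsor.proj (k.map (q e f)) = F.proj f :=
    fun e f hef => (k.proj_map _).trans (tw.proj_q _ _ hef)
  have hproj : ∀ e, X'.bundle.proj (map e) = X.bundle.proj e := fun e =>
    (tw'.proj_lift (hkp e _ (hpt e))).trans (hpt e).symm
  have map_q : ∀ e f, X.bundle.proj e = F.proj f → k.map (q e f) = q' (map e) f := by
    intro e f hef
    have hpf : F.proj (pt e) = F.proj f := (hpt e).symm.trans hef
    rw [← F.act_div hpf, tw.q_act_right (hpt e), tw'.q_act_right ((hproj e).trans (hpt e)),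
      k.map_act _ _ (tw.proj_q _ _ (hpt e)), tw'.q_lift (hkp e _ (hpt e))]
  have map_eq : ∀ e f, X.bundle.proj e = F.proj f → map e = tw'.lift (k.map (q e f)) f :=
    fun e f hef => (tw'.lift_eq ((hproj e).trans hef) (map_q e f hef).symm).symm
  have hol : ContMDiff (totalModel EG) (totalModel EG) ω map := by
    intro e₀
    obtain ⟨t, ht, hy⟩ := F.exists_isTriv (X.bundle.proj e₀)
    have h1 := tw.contMDiffOn_q_section ht
    have h2 := contMDiffOn_section_proj (E := X.bundle) ht
    have h3 : ContMDiffOn (totalModel EG) (totalModel EG) ω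
        (fun e => tw'.lift (k.map (q e (F.trivSection t (X.bundle.proj e))))
          (F.trivSection t (X.bundle.proj e))) (X.bundle.proj ⁻¹' t.baseSet) :=
      ContMDiffOn.comp (I' := (totalModel EG).prod (totalModel EG))
        (g := fun p : T'.torsor.carrier × F.carrier => tw'.lift p.1 p.2)
        (f := fun e => (k.map (q e (F.trivSection t (X.bundle.proj e))),
          F.trivSection t (X.bundle.proj e))) tw'.contMDiffOn_lift
        ((k.map_hol.comp_contMDiffOn h1).prodMk h2)
        (fun e he => hkp e _ (F.proj_trivSection he).symm)
    have hN := (t.open_baseSet.preimage X.bundle.proj_hol.continuous).mem_nhds hy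
    refine (h3.contMDiffAt hN).congr_of_eventuallyEq ?_
    filter_upwards [hN] with e he
    exact map_eq e _ (F.proj_trivSection he).symm
  refine ⟨⟨map, hol, hproj, ?_, ?_⟩, map_q⟩
  · intro e g
    have h1 : X.bundle.proj (X.bundle.act e g) = F.proj (pt e) :=
      (X.bundle.proj_act _ _).trans (hpt e)
    have h2 : X'.bundle.proj (map e) = F.proj (pt e) := (hproj e).trans (hpt e)
    -- `q'(·, f)` is injective on the fibre, so equivariance may be tested in the twist.
    refine tw'.q_left_injective ((hproj _).trans h1) ((X'.bundle.proj_act _ _).trans h2) ?_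
    rw [← map_q _ _ h1, ← tw.q_act _ _ _ (hpt e), ← tw'.q_act _ _ _ h2, ← map_q _ _ (hpt e),
      k.map_act _ _ (tw.proj_q _ _ (hpt e))]
  · intro e v
    obtain ⟨c, f, hc, hf, hv, hcf⟩ := F.exists_diffCurve_over
      (X.bundle.proj_hol.mdifferentiable (by simp))
      (⟨e, v⟩ : TangentBundle (totalModel EG) X.bundle.carrier)
    have hc' : DiffCurve (totalModel EG) (fun s => map (c s)) :=
      hc.comp (hol.mdifferentiable (by simp) _)
    have h1 := tc.total_velocity tw hc hf hcf
    have h2 := tc'.total_velocity tw' hc' hf (fun s => (hproj _).trans (hcf s))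
    have hcurve : (fun s => q' (map (c s)) (f s)) = fun s => k.map (q (c s) (f s)) :=
      funext fun s => (map_q _ _ (hcf s)).symm
    -- The two twist connections take the same value, so `D' - D₀` and `D - D₀` agree after `X ↦ [f,
    -- X]`, and `D₀` cancels.
    rw [hcurve, velocity_comp (tw.diffCurve_q hc hf hcf) (k.map_hol.mdifferentiable (by simp) _),
      k.map_conn, h1, velocity_comp hc (hol.mdifferentiable (by simp) _), hv] at h2
    exact (sub_left_inj.1 (AdBundle.adMk_injective (f 0) h2)).symm

/-- The points `q e f` exhaust the twist. -/
theorem twistMap_unique {X : PrincipalBundleWithConnection.{u} EG G Y}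
    {T T' : AdTorsorWithConnection F D₀} {q : X.bundle.carrier → F.carrier → T.torsor.carrier}
    (tw : IsTwist F X.bundle T.torsor q) {k k' : AdTorsorWithConnection.Hom T T'}
    (h : ∀ e f, X.bundle.proj e = F.proj f → k.map (q e f) = k'.map (q e f)) : k = k' := by
  refine AdTorsorWithConnection.Hom.ext (funext fun τ => ?_)
  obtain ⟨h1, h2⟩ := tw.sectionAt_spec (tw.mem_sectionDomain τ)
  rw [← h2, h _ _ h1]

end Morphisms

/-! ### Complex structures from local trivializations -/

section Gluing

variable {EG : Type w} [NormedAddCommGroup EG] [NormedSpace ℂ EG]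
  {G : Type v} [TopologicalSpace G] [ChartedSpace EG G] [IsManifold 𝓘(ℂ, EG) ω G]
  {Y : Type x} [TopologicalSpace Y] [ChartedSpace ℂ Y] [IsManifold 𝓘(ℂ, ℂ) ω Y]

/-- A set over `Y` with local trivializations whose transition maps are holomorphic is a complex
manifold, and the trivializations are biholomorphic. -/
theorem exists_manifold_of_trivializations {X : Type u} {ι : Type*} (π : X → Y) (base : ι → Set Y)
    (hbase : ∀ i, IsOpen (base i)) (hcov : ∀ y, ∃ i, y ∈ base i)
    (e : ι → PartialEquiv X (Y × G)) (hs : ∀ i, (e i).source = π ⁻¹' base i)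
    (ht : ∀ i, (e i).target = base i ×ˢ univ) (hfst : ∀ i x, (e i x).1 = π x)
    (htrans : ∀ i j, ContMDiffOn (totalModel EG) (totalModel EG) ω (fun p => e j ((e i).symm p))
      ((base i ∩ base j) ×ˢ univ)) :
    ∃ (_ : TopologicalSpace X) (_ : ChartedSpace (ModelProd ℂ EG) X)
      (_ : IsManifold (totalModel EG) ω X) (φ : ι → OpenPartialHomeomorph X (Y × G)),
      (∀ i, (φ i).toPartialEquiv = e i) ∧ ∀ i,
        ContMDiffOn (totalModel EG) (totalModel EG) ω (φ i) (φ i).source ∧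
        ContMDiffOn (totalModel EG) (totalModel EG) ω (φ i).symm (φ i).target := by
  have hsrc : ∀ i j, ((e i).symm.trans (e j)).source = (base i ∩ base j) ×ˢ univ := by
    intro i j
    ext p
    rw [PartialEquiv.trans_source, PartialEquiv.symm_source, ht]
    constructor
    · rintro ⟨⟨h1, -⟩, h2⟩
      have h3 : π ((e i).symm p) = p.1 := by
        rw [← hfst i, (e i).right_inv (by rw [ht]; exact ⟨h1, mem_univ _⟩)]
      rw [mem_preimage, hs, mem_preimage, h3] at h2
      exact ⟨⟨h1, h2⟩, mem_univ _⟩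
    · rintro ⟨⟨h1, h2⟩, -⟩
      have h3 : π ((e i).symm p) = p.1 := by
        rw [← hfst i, (e i).right_inv (by rw [ht]; exact ⟨h1, mem_univ _⟩)]
      refine ⟨⟨h1, mem_univ _⟩, ?_⟩
      rw [mem_preimage, hs, mem_preimage, h3]; exact h2
  choose idx hidx using hcov
  -- The trivializations serve as charts modelled on `Y × G`; composing them with the charts of `Y ×
  -- G` gives the complex charts.
  let core : ChartedSpaceCore (Y × G) X :=
    { atlas := range e
      chartAt := fun a => e (idx (π a))
      mem_chart_source := fun a => by rw [hs]; exact hidx _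
      chart_mem_atlas := fun a => mem_range_self _
      open_source := by
        rintro _ _ ⟨i, rfl⟩ ⟨j, rfl⟩
        rw [hsrc]
        exact ((hbase i).inter (hbase j)).prod isOpen_univ
      continuousOn_toFun := by
        rintro _ _ ⟨i, rfl⟩ ⟨j, rfl⟩
        rw [hsrc]
        exact (htrans i j).continuousOn }
  let top : TopologicalSpace X := core.toTopologicalSpace
  let ch' : ChartedSpace (Y × G) X := core.toChartedSpace
  let ch : ChartedSpace (ModelProd ℂ EG) X := ChartedSpace.comp (ModelProd ℂ EG) (Y × G) X
  let φ : ι → OpenPartialHomeomorph X (Y × G) := fun i =>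
    core.openPartialHomeomorph (e i) (mem_range_self i)
  have hatlas : ∀ c ∈ atlas (ModelProd ℂ EG) X, ∃ i, ∃ c' ∈ atlas (ModelProd ℂ EG) (Y × G),
      c = (φ i).trans c' := by
    rintro _ ⟨a, ha, c', hc', rfl⟩
    obtain ⟨_, ⟨_, rfl⟩, _, ⟨⟨i, rfl⟩, rfl⟩, ha⟩ := ha
    exact ⟨i, c', hc', by rw [mem_singleton_iff.1 ha]⟩
  have hmem : ∀ i, φ i ∈ atlas (Y × G) X := fun i =>
    mem_iUnion.2 ⟨e i, mem_iUnion.2 ⟨mem_range_self i, rfl⟩⟩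
  have hman : IsManifold (totalModel EG) ω X := by
    refine isManifold_of_contDiffOn _ _ _ ?_
    intro c₁ c₂ hc₁ hc₂
    obtain ⟨i, c, hc, rfl⟩ := hatlas c₁ hc₁
    obtain ⟨j, c', hc', rfl⟩ := hatlas c₂ hc₂
    rw [← contMDiffOn_iff_contDiffOn]
    have hc1 := contMDiffOn_symm_of_mem_maximalAtlas
      (IsManifold.subset_maximalAtlas (I := totalModel EG) (n := ω) hc)
    have hc2 := contMDiffOn_of_mem_maximalAtlas
      (IsManifold.subset_maximalAtlas (I := totalModel EG) (n := ω) hc')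
    have htr : ContMDiffOn (totalModel EG) (totalModel EG) ω ((φ i).symm.trans (φ j))
        ((φ i).symm.trans (φ j)).source := by
      have h := htrans i j
      rw [← hsrc i j] at h
      exact h
    have key : ContMDiffOn (totalModel EG) (totalModel EG) ω
        (((φ i).trans c).symm.trans ((φ j).trans c'))
        (((φ i).trans c).symm.trans ((φ j).trans c')).source := by
      have h := hc2.comp (t := c'.source)
        (s := (((φ i).trans c).symm.trans ((φ j).trans c')).source)
        (htr.comp (hc1.mono (fun p hp => hp.1.1))
          (fun p hp => ⟨hp.1.2, hp.2.1⟩)) (fun p hp => hp.2.2)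
      exact h
    exact ((totalModel EG).contMDiff).comp_contMDiffOn
      (key.comp (((totalModel EG).contMDiffOn_symm).mono inter_subset_right) (fun p hp => hp.1))
  exact ⟨top, ch, hman, φ, fun i => rfl, fun i =>
    contMDiffOn_of_trans_mem_atlas (φ i) (fun c hc => ⟨φ i, hmem i, c, hc, rfl⟩)⟩

end Gluing

/-! ### The set underlying a twist -/

section TwistExistence

variable {EG : Type w} [NormedAddCommGroup EG] [NormedSpace ℂ EG]
  {G : Type v} [TopologicalSpace G] [ChartedSpace EG G] [Group G] [LieGroup 𝓘(ℂ, EG) ω G]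
  {Y : Type x} [TopologicalSpace Y] [ChartedSpace ℂ Y]

namespace PrincipalBundle

theorem triv_symm_act (E : PrincipalBundle.{u} EG G Y) {t : Bundle.Trivialization G E.proj}
    (ht : E.IsTriv t) {y : Y} (hy : y ∈ t.baseSet) (a g : G) :
    E.act (t.toOpenPartialHomeomorph.symm (y, a)) g =
      t.toOpenPartialHomeomorph.symm (y, a * g) := by
  have h1 : t.toOpenPartialHomeomorph.symm (y, a) ∈ t.source := t.map_target (t.mem_target.2 hy)
  have h2 : E.act (t.toOpenPartialHomeomorph.symm (y, a)) g ∈ t.source :=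
    t.mem_source.2 (by rw [E.proj_act]; exact t.mem_source.1 h1)
  have h3 := ht.2.2 _ h1 g
  rw [t.apply_symm_apply' hy] at h3
  have h4 := t.left_inv h2
  exact h4.symm.trans (congrArg t.toOpenPartialHomeomorph.symm h3)

theorem triv_symm_snd (E : PrincipalBundle.{u} EG G Y) {t : Bundle.Trivialization G E.proj}
    {e : E.carrier} (he : E.proj e ∈ t.baseSet) :
    t.toOpenPartialHomeomorph.symm (E.proj e, (t e).2) = e := by
  have he' : e ∈ t.source := t.mem_source.2 he
  have h : (E.proj e, (t e).2) = t e := Prod.ext (t.coe_fst he').symm rfl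
  rw [h]
  exact t.left_inv he'

/-- The quotient of the fibre product of two principal bundles by the diagonal action. -/
theorem exists_quotient (E F : PrincipalBundle.{u} EG G Y) :
    ∃ (X : Type u) (q : E.carrier → F.carrier → X),
      (∀ x, ∃ e f, E.proj e = F.proj f ∧ q e f = x) ∧
      ∀ e f e' f', E.proj e = F.proj f → E.proj e' = F.proj f' →
        (q e f = q e' f' ↔ ∃ z : G, e' = E.act e z ∧ f' = F.act f z) := by
  classical
  let P := {p : E.carrier × F.carrier // E.proj p.1 = F.proj p.2}
  let r : Setoid P :=
    { r := fun p p' => ∃ z : G, p'.1.1 = E.act p.1.1 z ∧ p'.1.2 = F.act p.1.2 z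
      iseqv :=
        { refl := fun p => ⟨1, (E.act_one _).symm, (F.act_one _).symm⟩
          symm := by
            rintro p p' ⟨z, h1, h2⟩
            exact ⟨z⁻¹, by rw [h1, E.act_act_inv], by rw [h2, F.act_act_inv]⟩
          trans := by
            rintro p p' p'' ⟨z, h1, h2⟩ ⟨z', h3, h4⟩
            exact ⟨z * z', by rw [h3, h1, E.act_mul], by rw [h4, h2, F.act_mul]⟩ } }
  -- A default class, since `q` has to be defined off the fibre product too.
  let pt : ∀ e : E.carrier, P := fun e =>
    ⟨(e, (F.proj_surjective (E.proj e)).choose), (F.proj_surjective (E.proj e)).choose_spec.symm⟩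
  let q : E.carrier → F.carrier → Quotient r := fun e f =>
    if h : E.proj e = F.proj f then Quotient.mk r ⟨(e, f), h⟩ else Quotient.mk r (pt e)
  have hq : ∀ e f (h : E.proj e = F.proj f), q e f = Quotient.mk r ⟨(e, f), h⟩ :=
    fun e f h => dif_pos h
  refine ⟨Quotient r, q, fun x => ?_, fun e f e' f' h h' => ?_⟩
  · obtain ⟨⟨⟨e, f⟩, h⟩, rfl⟩ := Quotient.exists_rep x
    exact ⟨e, f, h, hq e f h⟩
  · rw [hq e f h, hq e' f' h']
    exact Quotient.eq

end PrincipalBundle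

end TwistExistence

/-! ### Existence of the twist -/

section TwistTorsor

variable {EG : Type w} [NormedAddCommGroup EG] [NormedSpace ℂ EG]
  {G : Type v} [TopologicalSpace G] [ChartedSpace EG G] [Group G] [LieGroup 𝓘(ℂ, EG) ω G]
  {Y : Type x} [TopologicalSpace Y] [ChartedSpace ℂ Y] [IsManifold 𝓘(ℂ, ℂ) ω Y]

open PrincipalBundle

namespace PrincipalBundle

theorem AdBundle.triv_mk {F : PrincipalBundle.{u} EG G Y} {t : Bundle.Trivialization G F.proj}
    (ht : F.IsTriv t) {f : F.carrier} (hf : F.proj f ∈ t.baseSet) (g : G) :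
    AdBundle.triv t ht (AdBundle.mk F f g) = (F.proj f, (t f).2 * g * (t f).2⁻¹) :=
  AdBundle.trivFun_mk t ht hf g

theorem AdBundle.proj_triv_symm {F : PrincipalBundle.{u} EG G Y}
    {t : Bundle.Trivialization G F.proj} (ht : F.IsTriv t) {p : Y × G} (hp : p.1 ∈ t.baseSet) :
    AdBundle.proj F ((AdBundle.triv t ht).symm p) = p.1 := by
  rw [← AdBundle.triv_fst ht, (AdBundle.triv t ht).right_inv (x := p) ⟨hp, mem_univ _⟩]

theorem AdBundle.triv_mul {F : PrincipalBundle.{u} EG G Y} {t : Bundle.Trivialization G F.proj}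
    (ht : F.IsTriv t) {γ γ' : F.AdBundle} (hγ : AdBundle.proj F γ ∈ t.baseSet)
    (h : AdBundle.proj F γ = AdBundle.proj F γ') :
    AdBundle.triv t ht (AdBundle.mul γ γ') =
      (AdBundle.proj F γ, (AdBundle.triv t ht γ).2 * (AdBundle.triv t ht γ').2) := by
  obtain ⟨f, g, rfl⟩ := AdBundle.exists_rep γ
  rw [← AdBundle.mk_coord h, AdBundle.mk_mul_mk, AdBundle.triv_mk ht hγ, AdBundle.triv_mk ht hγ,
    AdBundle.triv_mk ht hγ]
  refine Prod.ext rfl ?_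
  simp only
  group

theorem AdBundle.proj_mul {F : PrincipalBundle.{u} EG G Y} {γ γ' : F.AdBundle}
    (h : AdBundle.proj F γ = AdBundle.proj F γ') :
    AdBundle.proj F (AdBundle.mul γ γ') = AdBundle.proj F γ := by
  obtain ⟨f, g, rfl⟩ := AdBundle.exists_rep γ
  rw [← AdBundle.mk_coord h, AdBundle.mk_mul_mk]
  rfl

/-- The twist of a principal bundle `E` by `F` exists. -/
theorem exists_isTwist (F E : PrincipalBundle.{u} EG G Y) :
    ∃ (T : AdTorsor F) (q : E.carrier → F.carrier → T.carrier), IsTwist F E T q := by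
  have hG : IsManifold 𝓘(ℂ, EG) ω G := ContMDiffMul.toIsManifold
  obtain ⟨X, q, hrep, q_eq_iff⟩ := exists_quotient E F
  choose rE rF hr hrq using hrep
  let π : X → Y := fun a => F.proj (rF a)
  have rep_q : ∀ {e f}, E.proj e = F.proj f → ∃ z, rE (q e f) = E.act e z ∧
      rF (q e f) = F.act f z := fun {e f} h => (q_eq_iff _ _ _ _ h (hr _)).1 (hrq _).symm
  have π_q : ∀ {e f}, E.proj e = F.proj f → π (q e f) = F.proj f := by
    intro e f h
    obtain ⟨z, -, hz⟩ := rep_q h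
    change F.proj (rF (q e f)) = _
    rw [hz, F.proj_act]
  have q_act_act : ∀ {e f} (z : G), E.proj e = F.proj f → q (E.act e z) (F.act f z) = q e f :=
    fun {e f} z h =>
      ((q_eq_iff _ _ _ _ h (by rw [E.proj_act, F.proj_act, h])).2 ⟨z, rfl, rfl⟩).symm
  let ι := {p : Bundle.Trivialization G E.proj × Bundle.Trivialization G F.proj //
    E.IsTriv p.1 ∧ F.IsTriv p.2}
  let base : ι → Set Y := fun i => i.1.1.baseSet ∩ i.1.2.baseSet
  -- The expression `t(e) t'(f)⁻¹` is invariant under `(e, f) ↦ (e z, f z)`, hence a coordinate on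
  -- the quotient.
  let κ : ι → X → G := fun i a => (i.1.1 (rE a)).2 * (i.1.2 (rF a)).2⁻¹
  have κ_q : ∀ (i : ι) {e f}, E.proj e = F.proj f → F.proj f ∈ base i →
      κ i (q e f) = (i.1.1 e).2 * (i.1.2 f).2⁻¹ := by
    intro i e f h hf
    obtain ⟨z, hz, hz'⟩ := rep_q h
    change (i.1.1 (rE (q e f))).2 * (i.1.2 (rF (q e f))).2⁻¹ = _
    rw [hz, hz', i.2.1.2.2 e (i.1.1.mem_source.2 (h ▸ hf.1)),
      i.2.2.2.2 f (i.1.2.mem_source.2 hf.2)]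
    simp
  -- The representative with `f` on the section of `F`, where `t'(f) = 1`.
  let inv : ι → Y × G → X := fun i p =>
    q (i.1.1.toOpenPartialHomeomorph.symm p) (F.trivSection i.1.2 p.1)
  have hinv : ∀ (i : ι) (p : Y × G), p.1 ∈ base i →
      E.proj (i.1.1.toOpenPartialHomeomorph.symm p) = F.proj (F.trivSection i.1.2 p.1) ∧
      F.proj (F.trivSection i.1.2 p.1) = p.1 := by
    intro i p hp
    have h1 := F.proj_trivSection hp.2
    exact ⟨(i.1.1.proj_symm_apply' hp.1).trans h1.symm, h1⟩
  have inv_q : ∀ (i : ι) {e f}, E.proj e = F.proj f → F.proj f ∈ base i →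
      inv i (F.proj f, (i.1.1 e).2 * (i.1.2 f).2⁻¹) = q e f := by
    intro i e f h hf
    refine (q_eq_iff _ _ _ _ (hinv i _ hf).1 h).2 ⟨(i.1.2 f).2, ?_, ?_⟩
    · rw [E.triv_symm_act i.2.1 hf.1, inv_mul_cancel_right, ← h, E.triv_symm_snd (h ▸ hf.1)]
    · rw [trivSection, F.triv_symm_act i.2.2 hf.2, one_mul, F.triv_symm_snd hf.2]
  have κ_inv : ∀ (i j : ι) (p : Y × G), p.1 ∈ base i → p.1 ∈ base j →
      κ j (inv i p) = (j.1.1 (i.1.1.toOpenPartialHomeomorph.symm p)).2 *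
        (j.1.2 (F.trivSection i.1.2 p.1)).2⁻¹ := fun i j p hi hj =>
    κ_q j (hinv i p hi).1 (by rw [(hinv i p hi).2]; exact hj)
  let e : ι → PartialEquiv X (Y × G) := fun i =>
    { toFun := fun a => (π a, κ i a)
      invFun := inv i
      source := π ⁻¹' base i
      target := base i ×ˢ univ
      map_source' := fun a ha => ⟨ha, mem_univ _⟩
      map_target' := fun p hp => by
        rw [mem_preimage, π_q (hinv i p hp.1).1, (hinv i p hp.1).2]; exact hp.1
      left_inv' := fun a ha => by
        conv_rhs => rw [← hrq a]
        exact inv_q i (hr a) ha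
      right_inv' := fun p hp => by
        refine Prod.ext ((π_q (hinv i p hp.1).1).trans (hinv i p hp.1).2) ?_
        refine (κ_inv i i p hp.1 hp.1).trans ?_
        have h1 : i.1.1 (i.1.1.toOpenPartialHomeomorph.symm p) = p :=
          i.1.1.apply_symm_apply' (x := p.2) hp.1.1
        rw [h1, F.triv_trivSection hp.1.2, inv_one, mul_one] }
  obtain ⟨top, ch, man, φ, hφe, hφ⟩ := exists_manifold_of_trivializations π base
    (fun i => i.1.1.open_baseSet.inter i.1.2.open_baseSet)
    (fun y => by
      obtain ⟨t, ht, hy⟩ := E.exists_isTriv y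
      obtain ⟨t', ht', hy'⟩ := F.exists_isTriv y
      exact ⟨⟨(t, t'), ht, ht'⟩, hy, hy'⟩)
    e (fun i => rfl) (fun i => rfl) (fun i a => rfl)
    (fun i j => by
      have h1 : ContMDiffOn (totalModel EG) (totalModel EG) ω
          (fun p : Y × G => j.1.1 (i.1.1.toOpenPartialHomeomorph.symm p))
          ((base i ∩ base j) ×ˢ univ) :=
        j.2.1.1.comp (i.2.1.2.1.mono (fun p hp => i.1.1.mem_target.2 hp.1.1.1))
          (fun p hp => j.1.1.mem_source.2 (by
            rw [i.1.1.proj_symm_apply' (x := p.2) hp.1.1.1]; exact hp.1.2.1))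
      have h2 : ContMDiffOn (totalModel EG) (totalModel EG) ω
          (fun p : Y × G => j.1.2 (F.trivSection i.1.2 p.1)) ((base i ∩ base j) ×ˢ univ) :=
        j.2.2.1.comp ((F.contMDiffOn_trivSection i.2.2).comp contMDiffOn_fst
          (fun p hp => hp.1.1.2)) (fun p hp => j.1.2.mem_source.2 (by
            rw [F.proj_trivSection hp.1.1.2]; exact hp.1.2.2))
      refine (contMDiffOn_fst.prodMk ((contMDiff_snd.comp_contMDiffOn h1).mul
        (contMDiff_snd.comp_contMDiffOn h2).inv)).congr fun p hp => ?_
      exact Prod.ext ((π_q (hinv i p hp.1.1).1).trans (hinv i p hp.1.1).2)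
        (κ_inv i j p hp.1.1 hp.1.2))
  have hcov : ∀ y, ∃ i, y ∈ base i := fun y => by
    obtain ⟨t, ht, hy⟩ := E.exists_isTriv y
    obtain ⟨t', ht', hy'⟩ := F.exists_isTriv y
    exact ⟨⟨(t, t'), ht, ht'⟩, hy, hy'⟩
  have φ_src : ∀ i, (φ i).source = π ⁻¹' base i := fun i => by
    rw [hφe]
  have φ_tgt : ∀ i, (φ i).target = base i ×ˢ univ := fun i => by
    rw [hφe]
  have φ_apply : ∀ i a, φ i a = (π a, κ i a) := fun i a => by
    change (φ i).toPartialEquiv a = _; rw [hφe]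
  have φ_symm : ∀ i p, (φ i).symm p = inv i p := fun i p => by
    change (φ i).toPartialEquiv.symm p = _; rw [hφe]; rfl
  have q_eq : ∀ (i : ι) {e f}, E.proj e = F.proj f → F.proj f ∈ base i →
      q e f = (φ i).symm (F.proj f, (i.1.1 e).2 * (i.1.2 f).2⁻¹) := fun i {e f} h hf => by
    rw [φ_symm, inv_q i h hf]
  have φ_at : ∀ (i : ι) (a : X), π a ∈ base i → ContMDiffAt (totalModel EG) (totalModel EG) ω
      (φ i) a := fun i a ha => (hφ i).1.contMDiffAt ((φ i).open_source.mem_nhds (by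
        rw [φ_src]; exact ha))
  have φ_symm_at : ∀ (i : ι) (p : Y × G), p.1 ∈ base i →
      ContMDiffAt (totalModel EG) (totalModel EG) ω (φ i).symm p := fun i p hp =>
    (hφ i).2.contMDiffAt ((φ i).open_target.mem_nhds (by rw [φ_tgt]; exact ⟨hp, mem_univ _⟩))
  have π_hol : ContMDiff (totalModel EG) 𝓘(ℂ, ℂ) ω π := by
    intro a
    obtain ⟨i, hi⟩ := hcov (π a)
    refine (contMDiffAt_fst.comp a (φ_at i a hi)).congr_of_eventuallyEq (.of_forall fun b => ?_)
    exact (congrArg Prod.fst (φ_apply i b)).symm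
  let act : X → F.AdBundle → X := fun a γ =>
    q (E.act (rE a) (AdBundle.coord (rF a) γ)) (rF a)
  have act_q : ∀ {e f} (z : G), E.proj e = F.proj f →
      act (q e f) (AdBundle.mk F f z) = q (E.act e z) f := by
    intro e f z h
    obtain ⟨w, hw, hw'⟩ := rep_q h
    change q (E.act (rE (q e f)) (AdBundle.coord (rF (q e f)) _)) (rF (q e f)) = _
    have h1 : AdBundle.mk F f z = AdBundle.mk F (F.act f w) (w⁻¹ * z * w) := by
      rw [AdBundle.mk_act]; congr 1; group
    rw [hw, hw', h1, AdBundle.coord_mk, ← E.act_mul]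
    have h2 : w * (w⁻¹ * z * w) = z * w := by group
    rw [h2, E.act_mul, q_act_act w ((E.proj_act _ _).trans h)]
  have rep : ∀ a, ∃ e f, E.proj e = F.proj f ∧ q e f = a := fun a => ⟨_, _, hr a, hrq a⟩
  -- In coordinates `F(G)` acts by right multiplication, because `t(e) g t'(f)⁻¹ = (t(e) t'(f)⁻¹)
  -- (t'(f) g t'(f)⁻¹)`. Holomorphy and local triviality both rest on this.
  have act_eq : ∀ (i : ι) (a : X) (γ : F.AdBundle), π a = AdBundle.proj F γ → π a ∈ base i →
      act a γ = (φ i).symm (π a, κ i a * (AdBundle.triv i.1.2 i.2.2 γ).2) := by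
    intro i a γ h ha
    obtain ⟨e, f, hef, rfl⟩ := rep a
    rw [π_q hef] at h ha ⊢
    rw [← AdBundle.mk_coord h, act_q _ hef, AdBundle.triv_mk i.2.2 ha.2, κ_q i hef ha,
      q_eq i ((E.proj_act _ _).trans hef) ha, i.2.1.2.2 e (i.1.1.mem_source.2 (hef ▸ ha.1))]
    congr 2
    simp only
    group
  have π_act : ∀ a γ, π a = AdBundle.proj F γ → π (act a γ) = π a := by
    intro a γ h
    obtain ⟨e, f, hef, rfl⟩ := rep a
    rw [π_q hef] at h ⊢
    rw [← AdBundle.mk_coord h, act_q _ hef, π_q ((E.proj_act _ _).trans hef)]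
  let T : AdTorsor F :=
    { carrier := X
      proj := π
      proj_hol := π_hol
      act := act
      act_hol := by
        rintro ⟨a, γ⟩ h
        obtain ⟨i, hi⟩ := hcov (π a)
        have h1 : ContMDiffAt ((totalModel EG).prod (totalModel EG)) (totalModel EG) ω
            (fun p : X × F.AdBundle => φ i p.1) (a, γ) := (φ_at i a hi).comp (a, γ) contMDiffAt_fst
        have h2 : ContMDiffAt ((totalModel EG).prod (totalModel EG)) (totalModel EG) ω
            (fun p : X × F.AdBundle => AdBundle.triv i.1.2 i.2.2 p.2) (a, γ) :=
          ContMDiffAt.comp (a, γ) ((AdBundle.contMDiffOn_triv i.2.2).1.contMDiffAt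
            ((AdBundle.triv i.1.2 i.2.2).open_source.mem_nhds (by
              change AdBundle.proj F γ ∈ i.1.2.baseSet
              rw [← show π a = AdBundle.proj F γ from h]; exact hi.2))) contMDiffAt_snd
        have h3 : ContMDiffAt ((totalModel EG).prod (totalModel EG)) (totalModel EG) ω
            (fun p : X × F.AdBundle => ((φ i p.1).1, (φ i p.1).2 *
              (AdBundle.triv i.1.2 i.2.2 p.2).2)) (a, γ) :=
          (contMDiffAt_fst.comp (a, γ) h1).prodMk
            ((contMDiffAt_snd.comp (a, γ) h1).mul (contMDiffAt_snd.comp (a, γ) h2))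
        have h4 := (φ_symm_at i ((φ i a).1, (φ i a).2 * (AdBundle.triv i.1.2 i.2.2 γ).2) (by
          rw [φ_apply]; exact hi)).comp (a, γ) h3
        refine h4.contMDiffWithinAt.congr_of_eventuallyEq ?_ ?_
        · filter_upwards [self_mem_nhdsWithin, mem_nhdsWithin_of_mem_nhds
            (((i.1.1.open_baseSet.inter i.1.2.open_baseSet).preimage
              (π_hol.continuous.comp continuous_fst)).mem_nhds hi)] with p hp hp'
          exact (act_eq i p.1 p.2 hp hp').trans (by rw [Function.comp_apply, φ_apply])
        · exact (act_eq i a γ h hi).trans (by rw [Function.comp_apply, φ_apply])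
      proj_act := π_act
      act_one := by
        intro a
        obtain ⟨e, f, hef, rfl⟩ := rep a
        rw [AdBundle.one_eq (π_q hef).symm, act_q _ hef, E.act_one]
      act_mul := by
        intro a γ γ' h h'
        obtain ⟨e, f, hef, rfl⟩ := rep a
        rw [π_q hef] at h h'
        rw [← AdBundle.mk_coord h, ← AdBundle.mk_coord h', AdBundle.mk_mul_mk, act_q _ hef,
          act_q _ hef, act_q _ ((E.proj_act _ _).trans hef), E.act_mul]
      locally_trivial := by
        intro y
        obtain ⟨i, hi⟩ := hcov y
        -- The coordinates in `U × G` are read as points of `F(G)` by the trivialization of `F(G)`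
        -- coming from that of `F`.
        have hsrc : ((φ i).trans (AdBundle.triv i.1.2 i.2.2).symm).source = π ⁻¹' base i := by
          rw [OpenPartialHomeomorph.trans_source, φ_src]
          refine inter_eq_left.2 fun a ha => ?_
          refine ⟨?_, mem_univ _⟩
          rw [φ_apply]; exact ha.2
        have hproj : ∀ a ∈ π ⁻¹' base i,
            AdBundle.proj F ((AdBundle.triv i.1.2 i.2.2).symm (φ i a)) = π a := by
          intro a ha
          rw [AdBundle.proj_triv_symm i.2.2 (by rw [φ_apply]; exact ha.2), φ_apply]
        refine ⟨base i, (φ i).trans (AdBundle.triv i.1.2 i.2.2).symm,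
          i.1.1.open_baseSet.inter i.1.2.open_baseSet, hi, hsrc, ?_, ?_, ?_, ?_, ?_⟩
        · rw [OpenPartialHomeomorph.trans_target, φ_tgt]
          ext γ
          constructor
          · rintro ⟨-, h2, -⟩
            have h3 : (AdBundle.triv i.1.2 i.2.2 γ).1 ∈ base i := h2
            rwa [AdBundle.triv_fst] at h3
          · intro h
            refine ⟨h.2, ?_, mem_univ _⟩
            change (AdBundle.triv i.1.2 i.2.2 γ).1 ∈ base i
            rw [AdBundle.triv_fst]; exact h
        · rw [OpenPartialHomeomorph.trans_source]
          exact (AdBundle.contMDiffOn_triv i.2.2).2.comp ((hφ i).1.mono inter_subset_left)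
            (fun _ h => h.2)
        · rw [OpenPartialHomeomorph.trans_target]
          exact (hφ i).2.comp ((AdBundle.contMDiffOn_triv i.2.2).1.mono inter_subset_left)
            (fun _ h => h.2)
        · intro a ha
          rw [hsrc] at ha
          exact hproj a ha
        · intro a ha γ h
          rw [hsrc] at ha
          have hγ : AdBundle.proj F ((AdBundle.triv i.1.2 i.2.2).symm (φ i a)) =
              AdBundle.proj F γ := (hproj a ha).trans h
          have hb : AdBundle.proj F ((AdBundle.triv i.1.2 i.2.2).symm (φ i a)) ∈
              i.1.2.baseSet := by rw [hproj a ha]; exact ha.2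
          have ha' : π (act a γ) ∈ base i := by rw [π_act a γ h]; exact ha
          have hr : ∀ b : X, π b ∈ base i →
              AdBundle.triv i.1.2 i.2.2 ((AdBundle.triv i.1.2 i.2.2).symm (φ i b)) = φ i b :=
            fun b hb => (AdBundle.triv i.1.2 i.2.2).right_inv (x := φ i b)
              ⟨by rw [φ_apply]; exact hb.2, mem_univ _⟩
          refine (AdBundle.triv i.1.2 i.2.2).injOn (x₁ := (AdBundle.triv i.1.2 i.2.2).symm
            (φ i (act a γ))) ?_ ?_ ?_
          · change AdBundle.proj F _ ∈ i.1.2.baseSet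
            rw [hproj _ ha']; exact ha'.2
          · change AdBundle.proj F (AdBundle.mul ((AdBundle.triv i.1.2 i.2.2).symm (φ i a)) γ) ∈
              i.1.2.baseSet
            rw [AdBundle.proj_mul hγ]; exact hb
          · rw [hr _ ha']
            refine Eq.trans ?_ (AdBundle.triv_mul i.2.2 hb hγ).symm
            rw [hr a ha, hproj a ha, act_eq i a γ h ha, (φ i).right_inv (by
              rw [φ_tgt]; exact ⟨ha, mem_univ _⟩), φ_apply] }
  refine ⟨T, q, ?_, ?_, q_eq_iff, ?_, ?_⟩
  · rintro ⟨e, f⟩ h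
    obtain ⟨i, hi⟩ := hcov (F.proj f)
    have h' : E.proj e = F.proj f := h
    have h1 : ContMDiffAt ((totalModel EG).prod (totalModel EG)) (totalModel EG) ω
        (fun p : E.carrier × F.carrier => i.1.1 p.1) (e, f) :=
      ContMDiffAt.comp (e, f) (i.2.1.1.contMDiffAt (i.1.1.open_source.mem_nhds
        (i.1.1.mem_source.2 (h' ▸ hi.1)))) contMDiffAt_fst
    have h2 : ContMDiffAt ((totalModel EG).prod (totalModel EG)) (totalModel EG) ω
        (fun p : E.carrier × F.carrier => i.1.2 p.2) (e, f) :=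
      ContMDiffAt.comp (e, f) (i.2.2.1.contMDiffAt (i.1.2.open_source.mem_nhds
        (i.1.2.mem_source.2 hi.2))) contMDiffAt_snd
    have h3 : ContMDiffAt ((totalModel EG).prod (totalModel EG)) (totalModel EG) ω
        (fun p : E.carrier × F.carrier => (F.proj p.2, (i.1.1 p.1).2 * (i.1.2 p.2).2⁻¹)) (e, f) :=
      ((F.proj_hol f).comp (e, f) contMDiffAt_snd).prodMk
        ((contMDiffAt_snd.comp (e, f) h1).mul (contMDiffAt_snd.comp (e, f) h2).inv)
    have h4 := (φ_symm_at i (F.proj f, (i.1.1 e).2 * (i.1.2 f).2⁻¹) hi).comp (e, f) h3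
    refine h4.contMDiffWithinAt.congr_of_eventuallyEq ?_ (q_eq i h' hi)
    filter_upwards [self_mem_nhdsWithin, mem_nhdsWithin_of_mem_nhds
      (((i.1.1.open_baseSet.inter i.1.2.open_baseSet).preimage
        (F.proj_hol.continuous.comp continuous_snd)).mem_nhds hi)] with p hp hp'
    exact q_eq i hp hp'
  · exact fun e f h => π_q h
  · intro a
    obtain ⟨i, hi⟩ := hcov (π a)
    refine ⟨π ⁻¹' base i, fun b => (i.1.1.toOpenPartialHomeomorph.symm (φ i b),
      F.trivSection i.1.2 (φ i b).1), (i.1.1.open_baseSet.inter i.1.2.open_baseSet).preimage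
        π_hol.continuous, hi, ?_, ?_⟩
    · have h1 : ContMDiffOn (totalModel EG) (totalModel EG) ω (φ i) (π ⁻¹' base i) := by
        rw [← φ_src]; exact (hφ i).1
      refine (i.2.1.2.1.comp h1 fun b hb => i.1.1.mem_target.2 ?_).prodMk
        ((F.contMDiffOn_trivSection i.2.2).comp (contMDiff_fst.comp_contMDiffOn h1) fun b hb => ?_)
      · rw [φ_apply]; exact hb.1
      · change (φ i b).1 ∈ i.1.2.baseSet
        rw [φ_apply]; exact hb.2
    · intro b hb
      have hb' : (φ i b).1 ∈ base i := by rw [φ_apply]; exact hb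
      refine ⟨(hinv i _ hb').1, ?_⟩
      change inv i (φ i b) = b
      rw [← φ_symm, (φ i).left_inv (by rw [φ_src]; exact hb)]
  · exact fun e f z h => act_q z h

end PrincipalBundle

end TwistTorsor

/-! ### Recovering a principal bundle from a torsor -/

section UntwistBundle

variable {EG : Type w} [NormedAddCommGroup EG] [NormedSpace ℂ EG]
  {G : Type v} [TopologicalSpace G] [ChartedSpace EG G] [Group G] [LieGroup 𝓘(ℂ, EG) ω G]
  {Y : Type x} [TopologicalSpace Y] [ChartedSpace ℂ Y] [IsManifold 𝓘(ℂ, ℂ) ω Y]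
  {F : PrincipalBundle.{u} EG G Y}

open PrincipalBundle

theorem PrincipalBundle.AdBundle.contMDiff_one :
    ContMDiff 𝓘(ℂ, ℂ) (totalModel EG) ω (AdBundle.one F) := by
  intro y
  obtain ⟨t, ht, hy⟩ := F.exists_isTriv y
  have h := (AdBundle.contMDiff_mk_left (F := F) 1).comp_contMDiffOn (F.contMDiffOn_trivSection ht)
  refine (h.contMDiffAt (t.open_baseSet.mem_nhds hy)).congr_of_eventuallyEq ?_
  filter_upwards [t.open_baseSet.mem_nhds hy] with y' hy'
  exact AdBundle.one_eq (F.proj_trivSection hy')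

namespace AdTorsor

/-- A holomorphic `F(G)`-equivariant local trivialization of a torsor over `U`. -/
def IsTriv (T : AdTorsor F) (U : Set Y) (t : OpenPartialHomeomorph T.carrier F.AdBundle) : Prop :=
  IsOpen U ∧ t.source = T.proj ⁻¹' U ∧ t.target = AdBundle.proj F ⁻¹' U ∧
    ContMDiffOn (totalModel EG) (totalModel EG) ω t t.source ∧
    ContMDiffOn (totalModel EG) (totalModel EG) ω t.symm t.target ∧
    (∀ e ∈ t.source, AdBundle.proj F (t e) = T.proj e) ∧
    ∀ e ∈ t.source, ∀ γ, T.proj e = AdBundle.proj F γ → t (T.act e γ) = AdBundle.mul (t e) γ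

variable (T : AdTorsor F)

theorem act_mk_act {e : T.carrier} {f : F.carrier} (h : T.proj e = F.proj f) (g z g' : G) :
    T.act (T.act e (AdBundle.mk F f g)) (AdBundle.mk F (F.act f z) g') =
      T.act e (AdBundle.mk F f (g * (z * g' * z⁻¹))) := by
  rw [AdBundle.mk_act, T.act_act_mk h]

/-- The quotient of the fibre product of a torsor and `F` by the relation
`(τ, f) ∼ (τ · [f, z⁻¹], f z)`. -/
theorem exists_quotient :
    ∃ (X : Type u) (r : T.carrier → F.carrier → X),
      (∀ x, ∃ τ f, T.proj τ = F.proj f ∧ r τ f = x) ∧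
      ∀ τ f τ' f', T.proj τ = F.proj f → T.proj τ' = F.proj f' →
        (r τ f = r τ' f' ↔ ∃ z : G, τ' = T.act τ (AdBundle.mk F f z⁻¹) ∧ f' = F.act f z) := by
  classical
  let P := {p : T.carrier × F.carrier // T.proj p.1 = F.proj p.2}
  -- If `τ = q(e, f)`, then `q(e, f z) = τ · [f, z⁻¹]`: equivalent pairs are those that determine
  -- the same point `e` of the bundle sought.
  let r : Setoid P :=
    { r := fun p p' => ∃ z : G, p'.1.1 = T.act p.1.1 (AdBundle.mk F p.1.2 z⁻¹) ∧
        p'.1.2 = F.act p.1.2 z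
      iseqv :=
        { refl := fun p => ⟨1, by rw [inv_one, T.act_mk_one p.2], (F.act_one _).symm⟩
          symm := by
            rintro p p' ⟨z, h1, h2⟩
            refine ⟨z⁻¹, ?_, by rw [h2, F.act_act_inv]⟩
            rw [h1, h2, T.act_mk_act p.2]
            simp [T.act_mk_one p.2]
          trans := by
            rintro p p' p'' ⟨z, h1, h2⟩ ⟨z', h3, h4⟩
            refine ⟨z * z', ?_, by rw [h4, h2, F.act_mul]⟩
            rw [h3, h1, h2, T.act_mk_act p.2]
            congr 2
            group } }
  let pt : ∀ τ : T.carrier, P := fun τ =>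
    ⟨(τ, (F.proj_surjective (T.proj τ)).choose), (F.proj_surjective (T.proj τ)).choose_spec.symm⟩
  let q : T.carrier → F.carrier → Quotient r := fun τ f =>
    if h : T.proj τ = F.proj f then Quotient.mk r ⟨(τ, f), h⟩ else Quotient.mk r (pt τ)
  have hq : ∀ τ f (h : T.proj τ = F.proj f), q τ f = Quotient.mk r ⟨(τ, f), h⟩ :=
    fun τ f h => dif_pos h
  refine ⟨Quotient r, q, fun x => ?_, fun τ f τ' f' h h' => ?_⟩
  · obtain ⟨⟨⟨τ, f⟩, h⟩, rfl⟩ := Quotient.exists_rep x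
    exact ⟨τ, f, h, hq τ f h⟩
  · rw [hq τ f h, hq τ' f' h']
    exact Quotient.eq

/-- Every torsor is the twist of a principal bundle. -/
theorem exists_isTwist :
    ∃ (E : PrincipalBundle.{u} EG G Y) (q : E.carrier → F.carrier → T.carrier),
      IsTwist F E T q := by
  have hG : IsManifold 𝓘(ℂ, EG) ω G := ContMDiffMul.toIsManifold
  obtain ⟨X, r, hrep, r_eq_iff⟩ := T.exists_quotient
  choose rT rF hr hrr using hrep
  let π : X → Y := fun a => F.proj (rF a)
  have rep : ∀ a, ∃ τ f, T.proj τ = F.proj f ∧ r τ f = a := fun a => ⟨_, _, hr a, hrr a⟩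
  have rep_r : ∀ {τ f}, T.proj τ = F.proj f → ∃ z, rT (r τ f) = T.act τ (AdBundle.mk F f z⁻¹) ∧
      rF (r τ f) = F.act f z := fun {τ f} h => (r_eq_iff _ _ _ _ h (hr _)).1 (hrr _).symm
  have π_r : ∀ {τ f}, T.proj τ = F.proj f → π (r τ f) = F.proj f := by
    intro τ f h
    obtain ⟨z, -, hz⟩ := rep_r h
    change F.proj (rF (r τ f)) = _
    rw [hz, F.proj_act]
  have proj_act_mk : ∀ {τ f} (z : G), T.proj τ = F.proj f →
      T.proj (T.act τ (AdBundle.mk F f z)) = F.proj f := fun {τ f} z h =>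
    (T.proj_act τ (AdBundle.mk F f z) h).trans h
  have r_act_act : ∀ {τ f} (z : G), T.proj τ = F.proj f →
      r (T.act τ (AdBundle.mk F f z⁻¹)) (F.act f z) = r τ f := fun {τ f} z h =>
    ((r_eq_iff _ _ _ _ h (by rw [proj_act_mk _ h, F.proj_act])).2 ⟨z, rfl, rfl⟩).symm
  let ι := {p : (Set Y × OpenPartialHomeomorph T.carrier F.AdBundle) ×
    Bundle.Trivialization G F.proj // T.IsTriv p.1.1 p.1.2 ∧ F.IsTriv p.2}
  let base : ι → Set Y := fun i => i.1.1.1 ∩ i.1.2.baseSet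
  have hbase : ∀ i, IsOpen (base i) := fun i => i.2.1.1.inter i.1.2.open_baseSet
  have hcov : ∀ y, ∃ i, y ∈ base i := fun y => by
    obtain ⟨U, t, hU, hy, ht⟩ := T.locally_trivial y
    obtain ⟨t', ht', hy'⟩ := F.exists_isTriv y
    exact ⟨⟨((U, t), t'), ⟨hU, ht⟩, ht'⟩, hy, hy'⟩
  have src : ∀ (i : ι) {τ}, T.proj τ ∈ i.1.1.1 → τ ∈ i.1.1.2.source := fun i {τ} h => by
    rw [i.2.1.2.1]; exact h
  have tgt : ∀ (i : ι) {γ}, AdBundle.proj F γ ∈ i.1.1.1 → γ ∈ i.1.1.2.target := fun i {γ} h => by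
    rw [i.2.1.2.2.1]; exact h
  have t_proj : ∀ (i : ι) {τ}, T.proj τ ∈ i.1.1.1 → AdBundle.proj F (i.1.1.2 τ) = T.proj τ :=
    fun i {τ} h => i.2.1.2.2.2.2.2.1 τ (src i h)
  have t_act : ∀ (i : ι) {τ f} (g : G), T.proj τ = F.proj f → F.proj f ∈ i.1.1.1 →
      i.1.1.2 (T.act τ (AdBundle.mk F f g)) =
        AdBundle.mk F f (AdBundle.coord f (i.1.1.2 τ) * g) := by
    intro i τ f g h hf
    have h1 : T.proj τ ∈ i.1.1.1 := h ▸ hf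
    rw [i.2.1.2.2.2.2.2.2 τ (src i h1) (AdBundle.mk F f g) h, ← AdBundle.mk_mul_mk,
      AdBundle.mk_coord (h.symm.trans (t_proj i h1).symm)]
  let unit : ι → Y → T.carrier := fun i y => i.1.1.2.symm (AdBundle.one F y)
  have t_unit : ∀ (i : ι) {y}, y ∈ i.1.1.1 → i.1.1.2 (unit i y) = AdBundle.one F y :=
    fun i {y} hy => i.1.1.2.right_inv (tgt i (by rw [AdBundle.proj_one]; exact hy))
  have proj_unit : ∀ (i : ι) {y}, y ∈ i.1.1.1 → T.proj (unit i y) = y := by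
    intro i y hy
    have h1 : unit i y ∈ i.1.1.2.source :=
      i.1.1.2.map_target (tgt i (by rw [AdBundle.proj_one]; exact hy))
    rw [← i.2.1.2.2.2.2.2.1 _ h1, t_unit i hy, AdBundle.proj_one]
  -- With `c = coord f (t τ)`, passing to `(τ · [f, z⁻¹], f z)` turns `t'(f)` into `t'(f) z` and `c`
  -- into `z⁻¹ c`, so `t'(f) c` is well defined on the quotient.
  let κ : ι → X → G := fun i a => (i.1.2 (rF a)).2 * AdBundle.coord (rF a) (i.1.1.2 (rT a))
  have κ_r : ∀ (i : ι) {τ f}, T.proj τ = F.proj f → F.proj f ∈ base i →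
      κ i (r τ f) = (i.1.2 f).2 * AdBundle.coord f (i.1.1.2 τ) := by
    intro i τ f h hf
    obtain ⟨z, hz, hz'⟩ := rep_r h
    change (i.1.2 (rF (r τ f))).2 * AdBundle.coord (rF (r τ f)) (i.1.1.2 (rT (r τ f))) = _
    have h1 : AdBundle.mk F f (AdBundle.coord f (i.1.1.2 τ) * z⁻¹) =
        AdBundle.mk F (F.act f z) (z⁻¹ * AdBundle.coord f (i.1.1.2 τ)) := by
      rw [AdBundle.mk_act]; congr 1; group
    rw [hz, hz', t_act i _ h hf.1, h1, AdBundle.coord_mk,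
      i.2.2.2.2 f (i.1.2.mem_source.2 hf.2), mul_assoc, mul_inv_cancel_left]
  -- The representative with `τ` on the unit section of `T`, where `c = 1`.
  let inv : ι → Y × G → X := fun i p => r (unit i p.1) (i.1.2.toOpenPartialHomeomorph.symm p)
  have hinv : ∀ (i : ι) (p : Y × G), p.1 ∈ base i →
      T.proj (unit i p.1) = F.proj (i.1.2.toOpenPartialHomeomorph.symm p) ∧
      F.proj (i.1.2.toOpenPartialHomeomorph.symm p) = p.1 := by
    intro i p hp
    have h1 := i.1.2.proj_symm_apply' (x := p.2) hp.2
    exact ⟨(proj_unit i hp.1).trans h1.symm, h1⟩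
  have inv_r : ∀ (i : ι) {τ f}, T.proj τ = F.proj f → F.proj f ∈ base i →
      inv i (F.proj f, (i.1.2 f).2 * AdBundle.coord f (i.1.1.2 τ)) = r τ f := by
    intro i τ f h hf
    refine ((r_eq_iff _ _ _ _ h (hinv i _ hf).1).2 ⟨AdBundle.coord f (i.1.1.2 τ), ?_, ?_⟩).symm
    · have h1 := t_act i (AdBundle.coord f (i.1.1.2 τ))⁻¹ h hf.1
      rw [mul_inv_cancel, ← AdBundle.one_proj] at h1
      have h2 := i.1.1.2.left_inv (src i (τ := T.act τ (AdBundle.mk F f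
        (AdBundle.coord f (i.1.1.2 τ))⁻¹)) (by rw [proj_act_mk _ h]; exact hf.1))
      rw [h1] at h2
      exact h2
    · rw [← F.triv_symm_act i.2.2 hf.2, F.triv_symm_snd hf.2]
  have κ_inv : ∀ (i j : ι) (p : Y × G), p.1 ∈ base i → p.1 ∈ base j →
      κ j (inv i p) = (j.1.2 (i.1.2.toOpenPartialHomeomorph.symm p)).2 *
        AdBundle.coord (i.1.2.toOpenPartialHomeomorph.symm p) (j.1.1.2 (unit i p.1)) :=
    fun i j p hi hj => κ_r j (hinv i p hi).1 (by rw [(hinv i p hi).2]; exact hj)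
  have unit_at : ∀ (i : ι) {y}, y ∈ i.1.1.1 →
      ContMDiffAt 𝓘(ℂ, ℂ) (totalModel EG) ω (unit i) y := fun i {y} hy =>
    (i.2.1.2.2.2.2.1.contMDiffAt (i.1.1.2.open_target.mem_nhds
      (tgt i (by rw [AdBundle.proj_one]; exact hy)))).comp y (AdBundle.contMDiff_one y)
  let e : ι → PartialEquiv X (Y × G) := fun i =>
    { toFun := fun a => (π a, κ i a)
      invFun := inv i
      source := π ⁻¹' base i
      target := base i ×ˢ univ
      map_source' := fun a ha => ⟨ha, mem_univ _⟩
      map_target' := fun p hp => by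
        rw [mem_preimage, π_r (hinv i p hp.1).1, (hinv i p hp.1).2]; exact hp.1
      left_inv' := fun a ha => by
        conv_rhs => rw [← hrr a]
        exact inv_r i (hr a) ha
      right_inv' := fun p hp => by
        refine Prod.ext ((π_r (hinv i p hp.1).1).trans (hinv i p hp.1).2) ?_
        refine (κ_inv i i p hp.1 hp.1).trans ?_
        have h1 : i.1.2 (i.1.2.toOpenPartialHomeomorph.symm p) = p :=
          i.1.2.apply_symm_apply' (x := p.2) hp.1.2
        rw [h1, t_unit i hp.1.1, AdBundle.one_eq (hinv i p hp.1).2, AdBundle.coord_mk, mul_one] }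
  obtain ⟨top, ch, man, φ, hφe, hφ⟩ := exists_manifold_of_trivializations π base hbase hcov
    e (fun i => rfl) (fun i => rfl) (fun i a => rfl)
    (fun i j => by
      have h1 : ContMDiffOn (totalModel EG) (totalModel EG) ω
          (fun p : Y × G => i.1.2.toOpenPartialHomeomorph.symm p) ((base i ∩ base j) ×ˢ univ) :=
        i.2.2.2.1.mono (fun p hp => i.1.2.mem_target.2 hp.1.1.2)
      have h2 : ContMDiffOn (totalModel EG) (totalModel EG) ω
          (fun p : Y × G => j.1.2 (i.1.2.toOpenPartialHomeomorph.symm p))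
          ((base i ∩ base j) ×ˢ univ) :=
        j.2.2.1.comp h1 (fun p hp => j.1.2.mem_source.2 (by
            rw [(hinv i p hp.1.1).2]; exact hp.1.2.2))
      have h3 : ContMDiffOn (totalModel EG) (totalModel EG) ω
          (fun p : Y × G => j.1.1.2 (unit i p.1)) ((base i ∩ base j) ×ˢ univ) :=
        j.2.1.2.2.2.1.comp (fun p hp => ((unit_at i hp.1.1.1).comp p
          contMDiffAt_fst).contMDiffWithinAt)
          (fun p hp => src j (by rw [proj_unit i hp.1.1.1]; exact hp.1.2.1))
      have h4 : ContMDiffOn (totalModel EG) 𝓘(ℂ, EG) ω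
          (fun p : Y × G => AdBundle.coord (i.1.2.toOpenPartialHomeomorph.symm p)
            (j.1.1.2 (unit i p.1))) ((base i ∩ base j) ×ˢ univ) :=
        (AdBundle.contMDiffOn_coord F).comp (h1.prodMk h3) (fun p hp => by
          change F.proj _ = AdBundle.proj F _
          rw [t_proj j (by rw [proj_unit i hp.1.1.1]; exact hp.1.2.1), (hinv i p hp.1.1).1])
      refine (contMDiffOn_fst.prodMk ((contMDiff_snd.comp_contMDiffOn h2).mul h4)).congr
        fun p hp => ?_
      exact Prod.ext ((π_r (hinv i p hp.1.1).1).trans (hinv i p hp.1.1).2)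
        (κ_inv i j p hp.1.1 hp.1.2))
  have φ_src : ∀ i, (φ i).source = π ⁻¹' base i := fun i => by rw [hφe]
  have φ_tgt : ∀ i, (φ i).target = base i ×ˢ univ := fun i => by rw [hφe]
  have φ_apply : ∀ i a, φ i a = (π a, κ i a) := fun i a => by
    change (φ i).toPartialEquiv a = _; rw [hφe]
  have φ_symm : ∀ i p, (φ i).symm p = inv i p := fun i p => by
    change (φ i).toPartialEquiv.symm p = _; rw [hφe]; rfl
  have φ_at : ∀ (i : ι) (a : X), π a ∈ base i → ContMDiffAt (totalModel EG) (totalModel EG) ω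
      (φ i) a := fun i a ha => (hφ i).1.contMDiffAt ((φ i).open_source.mem_nhds (by
        rw [φ_src]; exact ha))
  have φ_symm_at : ∀ (i : ι) (p : Y × G), p.1 ∈ base i →
      ContMDiffAt (totalModel EG) (totalModel EG) ω (φ i).symm p := fun i p hp =>
    (hφ i).2.contMDiffAt ((φ i).open_target.mem_nhds (by rw [φ_tgt]; exact ⟨hp, mem_univ _⟩))
  have π_hol : ContMDiff (totalModel EG) 𝓘(ℂ, ℂ) ω π := by
    intro a
    obtain ⟨i, hi⟩ := hcov (π a)
    refine (contMDiffAt_fst.comp a (φ_at i a hi)).congr_of_eventuallyEq (.of_forall fun b => ?_)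
    exact (congrArg Prod.fst (φ_apply i b)).symm
  -- As `q(e z, f z) = q(e, f)` has to hold, the action moves `f` and keeps `τ`.
  let act : X → G → X := fun a z => r (rT a) (F.act (rF a) z)
  have act_r : ∀ {τ f} (z : G), T.proj τ = F.proj f → act (r τ f) z = r τ (F.act f z) := by
    intro τ f z h
    obtain ⟨w, hw, hw'⟩ := rep_r h
    change r (rT (r τ f)) (F.act (rF (r τ f)) z) = _
    have h1 : AdBundle.mk F f w⁻¹ = AdBundle.mk F (F.act f z) (z⁻¹ * w * z)⁻¹ := by
      rw [AdBundle.mk_act]; congr 1; group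
    have h2 : F.act (F.act f w) z = F.act (F.act f z) (z⁻¹ * w * z) := by
      rw [← F.act_mul, ← F.act_mul]; congr 1; group
    rw [hw, hw', h1, h2, r_act_act _ (h.trans (F.proj_act _ _).symm)]
  have π_act : ∀ a z, π (act a z) = π a := by
    intro a z
    obtain ⟨τ, f, h, rfl⟩ := rep a
    rw [act_r z h, π_r (h.trans (F.proj_act _ _).symm), π_r h, F.proj_act]
  have κ_act : ∀ (i : ι) (a : X) (z : G), π a ∈ base i → κ i (act a z) = κ i a * z := by
    intro i a z ha
    obtain ⟨τ, f, h, rfl⟩ := rep a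
    rw [π_r h] at ha
    have h' : T.proj τ = F.proj (F.act f z) := h.trans (F.proj_act _ _).symm
    rw [act_r z h, κ_r i h ha, κ_r i h' (by rw [F.proj_act]; exact ha),
      i.2.2.2.2 f (i.1.2.mem_source.2 ha.2)]
    have h1 : AdBundle.mk F f (AdBundle.coord f (i.1.1.2 τ)) = i.1.1.2 τ :=
      AdBundle.mk_coord (h.symm.trans (t_proj i (h ▸ ha.1)).symm)
    have h2 : AdBundle.mk F f (AdBundle.coord f (i.1.1.2 τ)) =
        AdBundle.mk F (F.act f z) (z⁻¹ * AdBundle.coord f (i.1.1.2 τ) * z) := by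
      rw [AdBundle.mk_act]; congr 1; group
    have h3 : AdBundle.coord (F.act f z) (i.1.1.2 τ) =
        z⁻¹ * AdBundle.coord f (i.1.1.2 τ) * z := by
      conv_lhs => rw [← h1, h2]
      exact AdBundle.coord_mk _ _
    rw [h3]
    group
  have act_eq : ∀ (i : ι) (a : X) (z : G), π a ∈ base i →
      act a z = (φ i).symm (π a, κ i a * z) := by
    intro i a z ha
    rw [← κ_act i a z ha, ← π_act a z, ← φ_apply, (φ i).left_inv]
    rw [φ_src, mem_preimage, π_act]; exact ha
  let E : PrincipalBundle.{u} EG G Y :=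
    { carrier := X
      proj := π
      proj_hol := π_hol
      act := act
      act_hol := by
        rintro ⟨a, z⟩
        obtain ⟨i, hi⟩ := hcov (π a)
        have h1 : ContMDiffAt ((totalModel EG).prod 𝓘(ℂ, EG)) (totalModel EG) ω
            (fun p : X × G => φ i p.1) (a, z) := (φ_at i a hi).comp (a, z) contMDiffAt_fst
        have h3 : ContMDiffAt ((totalModel EG).prod 𝓘(ℂ, EG)) (totalModel EG) ω
            (fun p : X × G => ((φ i p.1).1, (φ i p.1).2 * p.2)) (a, z) :=
          (contMDiffAt_fst.comp (a, z) h1).prodMk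
            ((contMDiffAt_snd.comp (a, z) h1).mul contMDiffAt_snd)
        have h4 := (φ_symm_at i ((φ i a).1, (φ i a).2 * z) (by
          rw [φ_apply]; exact hi)).comp (a, z) h3
        refine h4.congr_of_eventuallyEq ?_
        filter_upwards [((hbase i).preimage
          (π_hol.continuous.comp continuous_fst)).mem_nhds hi] with p hp
        exact (act_eq i p.1 p.2 hp).trans (by rw [Function.comp_apply, φ_apply])
      act_one := by
        intro a
        obtain ⟨τ, f, h, rfl⟩ := rep a
        rw [act_r _ h, F.act_one]
      act_mul := by
        intro a g z
        obtain ⟨τ, f, h, rfl⟩ := rep a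
        rw [act_r _ h, act_r _ h, act_r _ (h.trans (F.proj_act _ _).symm), F.act_mul]
      proj_act := π_act
      locally_trivial := by
        intro y
        obtain ⟨i, hi⟩ := hcov y
        refine ⟨{ toOpenPartialHomeomorph := φ i
                  baseSet := base i
                  open_baseSet := hbase i
                  source_eq := φ_src i
                  target_eq := φ_tgt i
                  proj_toFun := fun a _ => congrArg Prod.fst (φ_apply i a) },
          hi, (hφ i).1, (hφ i).2, fun a ha g => ?_⟩
        have ha' : π a ∈ base i := by
          have : a ∈ (φ i).source := ha
          rw [φ_src] at this; exact this
        change φ i (act a g) = ((φ i a).1, (φ i a).2 * g)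
        rw [φ_apply, φ_apply, π_act, κ_act i a g ha'] }
  -- `q(a, f)` is the `τ` for which `(τ, f)` represents `a`; the chosen representative is moved to
  -- the frame `f` by `div`.
  let q : X → F.carrier → T.carrier := fun a f =>
    T.act (rT a) (AdBundle.mk F (rF a) (F.div (rF a) f)⁻¹)
  have q_r_act : ∀ {τ f} (d : G), T.proj τ = F.proj f →
      q (r τ f) (F.act f d) = T.act τ (AdBundle.mk F f d⁻¹) := by
    intro τ f d h
    obtain ⟨z, hz, hz'⟩ := rep_r h
    have h1 : F.act f d = F.act (F.act f z) (z⁻¹ * d) := by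
      rw [← F.act_mul, mul_inv_cancel_left]
    change T.act (rT (r τ f)) (AdBundle.mk F (rF (r τ f)) (F.div (rF (r τ f)) _)⁻¹) = _
    rw [hz, hz', h1, F.div_act, T.act_mk_act h]
    congr 2
    group
  have q_r : ∀ {τ f}, T.proj τ = F.proj f → q (r τ f) f = τ := by
    intro τ f h
    have h1 := q_r_act 1 h
    rwa [F.act_one, inv_one, T.act_mk_one h] at h1
  have rep_at : ∀ a f, π a = F.proj f → ∃ τ, T.proj τ = F.proj f ∧ r τ f = a := by
    intro a f ha
    obtain ⟨τ, f₀, h, rfl⟩ := rep a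
    rw [π_r h] at ha
    obtain ⟨d, rfl⟩ := F.exists_act_eq ha
    exact ⟨_, by rw [proj_act_mk _ h, F.proj_act], r_act_act d h⟩
  refine ⟨E, q, ?_, ?_, ?_, ?_, ?_⟩
  · rintro ⟨a, f⟩ h
    obtain ⟨i, hi⟩ := hcov (π a)
    have h' : π a = F.proj f := h
    have hs : ∀ b : X, π b ∈ base i → F.proj (i.1.2.toOpenPartialHomeomorph.symm (φ i b)) = π b :=
      fun b hb => by
        rw [(hinv i (φ i b) (by rw [φ_apply]; exact hb)).2, φ_apply]
    -- The chosen representatives vary without regularity. Locally they are exchanged for those on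
    -- the unit section of `T`, which depend holomorphically on `b`.
    have q_eq : ∀ (b : X) (f' : F.carrier), π b = F.proj f' → π b ∈ base i →
        q b f' = T.act (unit i (π b)) (AdBundle.mk F (i.1.2.toOpenPartialHomeomorph.symm (φ i b))
          (F.div (i.1.2.toOpenPartialHomeomorph.symm (φ i b)) f')⁻¹) := by
      intro b f' hb hbi
      have h1 : r (unit i (π b)) (i.1.2.toOpenPartialHomeomorph.symm (φ i b)) = b := by
        have h2 := (φ i).left_inv (x := b) (by rw [φ_src]; exact hbi)
        rw [φ_symm] at h2
        nth_rewrite 1 [φ_apply] at h2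
        have h3 : (φ i b).1 = π b := by rw [φ_apply]
        rw [φ_apply]
        exact h2
      have h4 : T.proj (unit i (π b)) = F.proj (i.1.2.toOpenPartialHomeomorph.symm (φ i b)) := by
        rw [proj_unit i hbi.1, hs b hbi]
      rw [← q_r_act _ h4, F.act_div ((hs b hbi).trans hb), h1]
    let S : Set (X × F.carrier) := {p | π p.1 = F.proj p.2} ∩ {p | π p.1 ∈ base i}
    have hS : (a, f) ∈ S := ⟨h, hi⟩
    have h1 : ContMDiffOn ((totalModel EG).prod (totalModel EG)) (totalModel EG) ω
        (fun p : X × F.carrier => i.1.2.toOpenPartialHomeomorph.symm (φ i p.1)) S :=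
      i.2.2.2.1.comp (((hφ i).1.comp contMDiffOn_fst fun p hp => by
        rw [φ_src]; exact hp.2)) fun p hp => i.1.2.mem_target.2 (by
          change (φ i p.1).1 ∈ i.1.2.baseSet
          rw [φ_apply]; exact hp.2.2)
    have h2 : ContMDiffOn ((totalModel EG).prod (totalModel EG)) 𝓘(ℂ, EG) ω
        (fun p : X × F.carrier => F.div (i.1.2.toOpenPartialHomeomorph.symm (φ i p.1)) p.2) S :=
      F.contMDiffOn_div.comp (h1.prodMk contMDiffOn_snd) fun p hp =>
        (hs p.1 hp.2).trans hp.1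
    have h3 : ContMDiffOn ((totalModel EG).prod (totalModel EG)) (totalModel EG) ω
        (fun p : X × F.carrier => unit i (π p.1)) S := fun p hp =>
      ((unit_at i hp.2.1).comp p ((π_hol p.1).comp p contMDiffAt_fst)).contMDiffWithinAt
    have h4 : ContMDiffOn ((totalModel EG).prod (totalModel EG)) (totalModel EG) ω
        (fun p : X × F.carrier => T.act (unit i (π p.1))
          (AdBundle.mk F (i.1.2.toOpenPartialHomeomorph.symm (φ i p.1))
            (F.div (i.1.2.toOpenPartialHomeomorph.symm (φ i p.1)) p.2)⁻¹)) S :=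
      T.act_hol.comp (h3.prodMk ((AdBundle.contMDiff_mk F).comp_contMDiffOn (h1.prodMk h2.inv)))
        fun p hp => (proj_unit i hp.2.1).trans (hs p.1 hp.2).symm
    have h5 : ContMDiffOn ((totalModel EG).prod (totalModel EG)) (totalModel EG) ω
        (fun p : X × F.carrier => q p.1 p.2) S := h4.congr fun p hp => q_eq p.1 p.2 hp.1 hp.2
    exact (contMDiffWithinAt_inter (((hbase i).preimage
      (π_hol.continuous.comp continuous_fst)).mem_nhds hi)).1 (h5 _ hS)
  · intro a f h
    obtain ⟨τ, hτ, rfl⟩ := rep_at a f h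
    rw [q_r hτ, hτ]
  · intro a f a' f' h h'
    obtain ⟨τ, hτ, rfl⟩ := rep_at a f h
    obtain ⟨τ', hτ', rfl⟩ := rep_at a' f' h'
    rw [q_r hτ, q_r hτ']
    constructor
    · rintro rfl
      obtain ⟨z, rfl⟩ := F.exists_act_eq (hτ.symm.trans hτ')
      exact ⟨z, (act_r z hτ).symm, rfl⟩
    · rintro ⟨z, h1, rfl⟩
      have h2 : r τ' (F.act f z) = r τ (F.act f z) := h1.trans (act_r z hτ)
      rw [← q_r hτ', h2, q_r (hτ.trans (F.proj_act _ _).symm)]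
  · intro τ
    obtain ⟨i, hi⟩ := hcov (T.proj τ)
    let σ : T.carrier → F.carrier := fun τ' => F.trivSection i.1.2 (T.proj τ')
    have hσ : ∀ τ', T.proj τ' ∈ base i → T.proj τ' = F.proj (σ τ') := fun τ' h =>
      (F.proj_trivSection h.2).symm
    have hσ_hol : ContMDiffOn (totalModel EG) (totalModel EG) ω σ (T.proj ⁻¹' base i) :=
      (F.contMDiffOn_trivSection i.2.2).comp T.proj_hol.contMDiffOn fun p hp => hp.2
    refine ⟨T.proj ⁻¹' base i, fun τ' => (r τ' (σ τ'), σ τ'),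
      (hbase i).preimage T.proj_hol.continuous, hi, ContMDiffOn.prodMk ?_ hσ_hol,
      fun τ' h => ⟨π_r (hσ τ' h), q_r (hσ τ' h)⟩⟩
    have h1 : ContMDiffOn (totalModel EG) 𝓘(ℂ, EG) ω
        (fun τ' => AdBundle.coord (σ τ') (i.1.1.2 τ')) (T.proj ⁻¹' base i) :=
      (AdBundle.contMDiffOn_coord F).comp (hσ_hol.prodMk
        (i.2.1.2.2.2.1.mono fun p hp => src i hp.1)) fun p hp =>
          (hσ p hp).symm.trans (t_proj i hp.1).symm
    refine ((hφ i).2.comp (T.proj_hol.contMDiffOn.prodMk h1) fun p hp => by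
      rw [φ_tgt]; exact ⟨hp, mem_univ _⟩).congr fun p hp => ?_
    have h2 := hσ p hp
    rw [Function.comp_apply, φ_symm, ← inv_r i h2 (h2 ▸ hp), F.triv_trivSection hp.2, ← h2, one_mul]
  · intro a f z h
    obtain ⟨τ, hτ, rfl⟩ := rep_at a f h
    have h1 := q_r_act z⁻¹ (hτ.trans (F.proj_act f z).symm)
    rw [F.act_act_inv, inv_inv] at h1
    change T.act (q (r τ f) f) _ = q (act (r τ f) z) f
    rw [q_r hτ, act_r z hτ, h1, AdBundle.mk_act, mul_inv_cancel_right]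

end AdTorsor

end UntwistBundle

/-! ### The equivalence of categories -/

section TwistFunctor

variable {EG : Type w} [NormedAddCommGroup EG] [NormedSpace ℂ EG]
  {G : Type v} [TopologicalSpace G] [ChartedSpace EG G] [Group G] [LieGroup 𝓘(ℂ, EG) ω G]
  {Y : Type x} [TopologicalSpace Y] [ChartedSpace ℂ Y] [IsManifold 𝓘(ℂ, ℂ) ω Y]
  {F : PrincipalBundle.{u} EG G Y} {D₀ : PrincipalConnection F}

open PrincipalBundle

/-- Two twists of the same principal bundle with connection are isomorphic. -/
theorem nonempty_iso_of_isTwist {X : PrincipalBundleWithConnection.{u} EG G Y}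
    {T T' : AdTorsorWithConnection F D₀} {q : X.bundle.carrier → F.carrier → T.torsor.carrier}
    {q' : X.bundle.carrier → F.carrier → T'.torsor.carrier}
    (tw : IsTwist F X.bundle T.torsor q) (tw' : IsTwist F X.bundle T'.torsor q')
    (tc : IsTwistConnection D₀ X.conn q T.conn) (tc' : IsTwistConnection D₀ X.conn q' T'.conn) :
    Nonempty (T ≅ T') := by
  obtain ⟨k, hk⟩ := exists_twistMap tw tw' tc tc' (𝟙 X)
  obtain ⟨k', hk'⟩ := exists_twistMap tw' tw tc' tc (𝟙 X)
  refine ⟨⟨k, k', twistMap_unique tw fun e f h => ?_, twistMap_unique tw' fun e f h => ?_⟩⟩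
  · exact (congrArg k'.map (hk e f h)).trans (hk' e f h)
  · exact (congrArg k.map (hk' e f h)).trans (hk e f h)

end TwistFunctor

theorem mainTheorem8 {EG : Type w} [NormedAddCommGroup EG] [NormedSpace ℂ EG]
    [FiniteDimensional ℂ EG]
    {G : Type v} [TopologicalSpace G] [ChartedSpace EG G] [Group G] [LieGroup 𝓘(ℂ, EG) ω G]
    {Y : Type x} [TopologicalSpace Y] [ChartedSpace ℂ Y] [IsManifold 𝓘(ℂ, ℂ) ω Y]
    (F : PrincipalBundle.{u} EG G Y) (D₀ : PrincipalConnection F) :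
    ∃ (Φ : PrincipalBundleWithConnection.{u} EG G Y ⥤ AdTorsorWithConnection F D₀)
      (q : ∀ X : PrincipalBundleWithConnection.{u} EG G Y,
        X.bundle.carrier → F.carrier → (Φ.obj X).torsor.carrier),
      Φ.IsEquivalence ∧
      (∀ X, IsTwist F X.bundle (Φ.obj X).torsor (q X)) ∧
      (∀ X, IsTwistConnection D₀ X.conn (q X) (Φ.obj X).conn) ∧
      (∀ (X X' : PrincipalBundleWithConnection.{u} EG G Y) (h : X ⟶ X')
        (e : X.bundle.carrier) (f : F.carrier), X.bundle.proj e = F.proj f →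
        (Φ.map h).map (q X e f) = q X' (h.map e) f) := by
  choose T q tw using fun X : PrincipalBundleWithConnection.{u} EG G Y =>
    PrincipalBundle.exists_isTwist F X.bundle
  let obj : PrincipalBundleWithConnection.{u} EG G Y → AdTorsorWithConnection F D₀ := fun X =>
    ⟨T X, (tw X).twistConnection D₀ X.conn⟩
  have tc : ∀ X, IsTwistConnection D₀ X.conn (q X) (obj X).conn := fun X =>
    (tw X).isTwistConnection_twistConnection D₀ X.conn
  choose map hmap using fun (X X' : PrincipalBundleWithConnection.{u} EG G Y)
    (h : PrincipalBundleWithConnection.Hom X X') =>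
      exists_twistMap (T := obj X) (T' := obj X') (tw X) (tw X') (tc X) (tc X') h
  let Φ : PrincipalBundleWithConnection.{u} EG G Y ⥤ AdTorsorWithConnection F D₀ :=
    { obj := obj
      map := fun {X X'} h => map X X' h
      -- Maps out of a twist are determined by their values on the points `q e f`, where
      -- functoriality is that of `h`.
      map_id := fun X => twistMap_unique (tw X) fun e f h => hmap X X (𝟙 X) e f h
      map_comp := fun {X X' X''} h k => twistMap_unique (tw X) fun e f hef =>
        (hmap X X'' (h ≫ k) e f hef).trans ((congrArg (map X' X'' k).map
          (hmap X X' h e f hef)).trans (hmap X' X'' k _ f ((h.proj_map e).trans hef))).symm }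
  refine ⟨Φ, q, ?_, tw, tc, fun X X' h e f hef => hmap X X' h e f hef⟩
  have hfaithful : Φ.Faithful :=
    { map_injective := by
        intro X X' h h' hh
        refine PrincipalBundleWithConnection.Hom.ext (funext fun e => ?_)
        obtain ⟨f, hf⟩ := F.proj_surjective (X.bundle.proj e)
        refine (tw X').q_left_injective ((h.proj_map e).trans hf.symm)
          ((h'.proj_map e).trans hf.symm) ?_
        rw [← hmap X X' h e f hf.symm, ← hmap X X' h' e f hf.symm]
        exact congrArg (fun k : obj X ⟶ obj X' => k.map (q X e f)) hh }
  have hfull : Φ.Full :=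
    { map_surjective := by
        intro X X' k
        obtain ⟨h, hh⟩ := exists_untwistMap (T := obj X) (T' := obj X') (tw X) (tw X') (tc X)
          (tc X') k
        refine ⟨h, twistMap_unique (T := obj X) (tw X) fun e f hef => ?_⟩
        exact (hmap X X' h e f hef).trans (hh e f hef).symm }
  have hsurj : Φ.EssSurj :=
    { mem_essImage := by
        intro S
        -- The torsor is a twist of some `E`, and its connection untwists to one on `E`. Uniqueness
        -- of twists identifies it with the twist chosen in the construction of `Φ`.
        obtain ⟨E, r, hr⟩ := S.torsor.exists_isTwist
        let X : PrincipalBundleWithConnection.{u} EG G Y := ⟨E, hr.untwistConnection S.conn⟩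
        exact ⟨X, nonempty_iso_of_isTwist (X := X) (tw X) hr (tc X)
          (hr.isTwistConnection_untwistConnection S.conn)⟩ }
  exact { faithful := hfaithful, full := hfull, essSurj := hsurj }
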